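/- **Setting.** Let $\{\phi_j\}_{j\ge1}$ be the trigonometric orthonormal basis of $L^2[0,1]$: $\phi_1=1$, $\phi_{2m}(x)=\sqrt2\cos(2\pi mx)$, $\phi_{2m+1}(x)=\sqrt2\sin(2\pi mx)$ for $m\ge1$. Let $\|\cdot\|$ be the norm of $L^2[0,1]$, and for $\alpha,Q>0$ let $$E_\alpha(Q)=\Big\{f\in L^2[0,1]:\ \sum_{j\ge1}j^{2\alpha}\theta_j^2\le Q^2,\ \theta_j=\int_0^1 f\phi_j\Big\}.$$ *Block prior.* Put $l_k=\lfloor e^k\rfloor$ and $B_k=\{l_k,\dots,l_{k+1}-1\}$ for $k\ge0$. Let $g_0,g_1,\dots$ be probability densities on $(0,\infty)$ for which there are constants $c_1,c_2,c_3>0$ such that for all $k\ge0$: $g_k(t)\ge\exp(-c_1e^k)$ for all $t\in[e^{-k^2},e^{-k}]$; $\int_0^\infty t\,g_k(t)\,dt\le4\exp(-c_2k^2)$; and $\int_{e^{-k^2}}^\infty g_k(t)\,dt\le\exp(-c_3e^k)$. The block prior $\bar\Pi$ is the law of the random sequence $\theta=(\theta_1,\theta_2,\dots)$ obtained by drawing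 $A_k\sim g_k$ independently for $k\ge0$ and, given $(A_k)_{k\ge0}$, drawing the blocks $(\theta_j)_{j\in B_k}\sim N(0,A_kI)$ independently for $k\ge0$. For $B>0$ let $D=\{\theta:\sum_{j\ge1}|\theta_j|<B\}$ and let $\Pi(A)=\bar\Pi(A\cap D)/\bar\Pi(D)$; a sequence $\theta\in D$ is identified with the function $f=\sum_j\theta_j\phi_j$. *Model.* Under $P_f^{(n)}$ the observations $(X_1,Y_1),\dots,(X_n,Y_n)$ are i.i.d. with $X_i\sim U[0,1]$ and $Y_i\mid X_i\sim N(f(X_i),1)$. With $p_f^{(n)}$ the density of $P_f^{(n)}$ with respect to Lebesgue measure on $([0,1]\times\mathbb R)^n$, the posterior is $$\Pi\big(A\mid (X_i,Y_i)_{i\le n}\big)=\frac{\int_A p_f^{(n)}\big((X_i,Y_i)_{i\le n}\big)\,d\Pi(f)}{\int p_f^{(n)}\big((X_i,Y_i)_{i\le n}\big)\,d\Pi(f)}.$$ **Theorem.** Let $\alpha^*>1/2$ and $\gamma=\big(\sum_{j\ge1}j^{-2\alpha^*}\big)^{1/2}$. For all $\alpha\ge\alpha^*$ and $Q>0$ with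 $3\gamma Q\le B$ there is a constant $M>0$ such that, with $\epsilon_n=n^{-\alpha/(2\alpha+1)}$, $$\sup_{f_0\in E_\alpha(Q)}P_{f_0}^{(n)}\,\Pi\big(\|f-f_0\|>M\epsilon_n\ \big|\ X_1,\dots,X_n,Y_1,\dots,Y_n\big)\longrightarrow0\qquad(n\to\infty),$$ where $P_{f_0}^{(n)}$ in front of the posterior probability denotes expectation over the data. -/

import Mathlib

open MeasureTheory ProbabilityTheory Filter Topology
open scoped ENNReal NNReal

noncomputable section

namespace BlockPrior

/-! Throughout, a coefficient sequence `(θ_1, θ_2, …)` is a function `θ : ℕ → ℝ` in which `θ j` is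
the coefficient with index `j + 1`. -/

/-- The trigonometric orthonormal basis of `L²[0,1]`, indexed from `1`:
`φ_1 = 1`, `φ_{2m}(x) = √2 cos(2πmx)`, `φ_{2m+1}(x) = √2 sin(2πmx)` for `m ≥ 1`.
(The value at index `0` is never used.) -/
def trigBasis (j : ℕ) (x : unitInterval) : ℝ :=
  if j = 1 then 1
  else if Even j then √2 * Real.cos (2 * Real.pi * ((j / 2 : ℕ) : ℝ) * (x : ℝ))
  else √2 * Real.sin (2 * Real.pi * ((j / 2 : ℕ) : ℝ) * (x : ℝ))

/-- The Fourier coefficient `θ_{j+1} = ∫ f φ_{j+1}` of a function on `[0,1]`. -/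
def fourierCoef (f : unitInterval → ℝ) (j : ℕ) : ℝ :=
  ∫ x, f x * trigBasis (j + 1) x

/-- The Sobolev ball `E_α(Q) = {f ∈ L²[0,1] : ∑_{j ≥ 1} j^{2α} θ_j² ≤ Q²}`. The series has
nonnegative terms and is summed in `[0, ∞]`, so that the bound includes convergence. -/
def sobolevBall (α Q : ℝ) : Set (Lp ℝ 2 (volume : Measure unitInterval)) :=
  {f | ∑' j : ℕ, ENNReal.ofReal (((j : ℝ) + 1) ^ (2 * α) * fourierCoef f j ^ 2)
        ≤ ENNReal.ofReal (Q ^ 2)}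

/-- The function `f = ∑_{j ≥ 1} θ_j φ_j`. It is used for absolutely summable `θ` only, for which
the series converges uniformly on `[0,1]`. -/
def seriesFun (θ : ℕ → ℝ) (x : unitInterval) : ℝ :=
  ∑' j : ℕ, θ j * trigBasis (j + 1) x

/-! ### The block prior -/

/-- The first index `l_k = [e^k]` of the block `B_k = {l_k, …, l_{k+1} - 1}`. -/
def blockStart (k : ℕ) : ℕ := ⌊Real.exp k⌋₊

open Classical in
/-- The number `k` of the block `B_k` that contains the index `i ≥ 1`;
see `blockIndex_eq_iff`. -/
def blockIndex (i : ℕ) : ℕ := Nat.findGreatest (fun k => blockStart k ≤ i) i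

theorem blockStart_mono : Monotone blockStart := fun a b h =>
  Nat.floor_le_floor (Real.exp_le_exp.mpr (by exact_mod_cast h))

theorem lt_blockStart (k : ℕ) : k < blockStart k := by
  apply Nat.le_floor
  have := Real.add_one_le_exp (k : ℝ)
  push_cast
  linarith

theorem blockStart_zero : blockStart 0 = 1 := by simp [blockStart]

/-- `blockIndex i = k` says that `i ∈ B_k`. -/
theorem blockIndex_eq_iff {i : ℕ} (hi : 1 ≤ i) (k : ℕ) :
    blockIndex i = k ↔ blockStart k ≤ i ∧ i < blockStart (k + 1) := by
  classical
  have h1 : blockStart (blockIndex i) ≤ i := by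
    unfold blockIndex
    exact Nat.findGreatest_spec (P := fun k => blockStart k ≤ i) (Nat.zero_le i)
      (by simpa [blockStart_zero] using hi)
  have h2 : i < blockStart (blockIndex i + 1) := by
    by_contra! h
    have h4 := Nat.le_findGreatest (P := fun k => blockStart k ≤ i)
      (((lt_blockStart _).le.trans h)) h
    have h5 : blockIndex i + 1 ≤ blockIndex i := by
      unfold blockIndex at h4 ⊢
      convert h4
    omega
  constructor
  · rintro rfl
    exact ⟨h1, h2⟩
  · rintro ⟨h3, h4⟩
    apply le_antisymm
    · by_contra! h
      exact absurd (blockStart_mono (show k + 1 ≤ blockIndex i from h)) (by omega)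
    · by_contra! h
      exact absurd (blockStart_mono (show blockIndex i + 1 ≤ k from h)) (by omega)

/-- `g` is a probability density on `(0, ∞)`. Its values outside `(0, ∞)` play no role. -/
structure IsPosDensity (g : ℝ → ℝ) : Prop where
  measurable : Measurable g
  nonneg : ∀ t, 0 < t → 0 ≤ g t
  total : ∫⁻ t in Set.Ioi (0 : ℝ), ENNReal.ofReal (g t) = 1

/-- The class `𝒢` of sequences of mixing densities. -/
structure IsMixingClass (g : ℕ → ℝ → ℝ) : Prop where
  density : ∀ k, IsPosDensity (g k)
  lower : ∃ c₁ : ℝ, 0 < c₁ ∧ ∀ k : ℕ, ∀ t ∈ Set.Icc (Real.exp (-(k : ℝ) ^ 2)) (Real.exp (-(k : ℝ))),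
    Real.exp (-c₁ * Real.exp k) ≤ g k t
  mean : ∃ c₂ : ℝ, 0 < c₂ ∧ ∀ k : ℕ,
    ∫⁻ t in Set.Ioi (0 : ℝ), ENNReal.ofReal (t * g k t)
      ≤ ENNReal.ofReal (4 * Real.exp (-c₂ * (k : ℝ) ^ 2))
  tail : ∃ c₃ : ℝ, 0 < c₃ ∧ ∀ k : ℕ,
    ∫⁻ t in Set.Ioi (Real.exp (-(k : ℝ) ^ 2)), ENNReal.ofReal (g k t)
      ≤ ENNReal.ofReal (Real.exp (-c₃ * Real.exp k))

/-- The law on `ℝ` with density `g` on `(0, ∞)`. -/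
def mixingLaw (g : ℝ → ℝ) : Measure ℝ :=
  (volume.restrict (Set.Ioi 0)).withDensity fun t => ENNReal.ofReal (g t)

/-- The block prior on coefficient sequences: the law of `θ_j = √(A_k) Z_j` for `j ∈ B_k`,
with independent `A_k ∼ g_k` (`k ≥ 0`) and, independently of them, i.i.d. standard normal `Z_j`;
that is, given `(A_k)`, the blocks are independent with `θ_{B_k} ∼ N(0, A_k I)`. -/
def blockPrior (g : ℕ → ℝ → ℝ) : Measure (ℕ → ℝ) :=
  ((Measure.infinitePi fun k => mixingLaw (g k)).prod
      (Measure.infinitePi fun _ : ℕ => gaussianReal 0 1)).map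
    fun p : (ℕ → ℝ) × (ℕ → ℝ) => fun j => √(p.1 (blockIndex (j + 1))) * p.2 j

/-- The constraint set `D = {θ : ∑_j |θ_j| < B}` (series summed in `[0, ∞]`). -/
def constraintSet (B : ℝ) : Set (ℕ → ℝ) :=
  {θ | ∑' j : ℕ, ENNReal.ofReal |θ j| < ENNReal.ofReal B}

/-- The modified block prior `Π(A) = Π̄(D ∩ A) / Π̄(D)`. -/
def modifiedPrior (g : ℕ → ℝ → ℝ) (B : ℝ) : Measure (ℕ → ℝ) :=
  ProbabilityTheory.cond (blockPrior g) (constraintSet B)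

/-! ### Gaussian regression with uniform random design -/

/-- The joint density, with respect to Lebesgue measure on `[0,1] × ℝ`, of `(X, Y)` with
`X ∼ U[0,1]` and `Y | X ∼ N(f(X), 1)`. -/
def obsDensity (f : unitInterval → ℝ) (p : unitInterval × ℝ) : ℝ≥0∞ :=
  gaussianPDF (f p.1) 1 p.2

/-- The law `P_f` of a single observation `(X, Y)`. -/
def obsLaw (f : unitInterval → ℝ) : Measure (unitInterval × ℝ) :=
  volume.withDensity (obsDensity f)

/-- `P_f` is the law of `(X, Y)` with `X ∼ U[0,1]` and `Y | X ∼ N(f(X), 1)`. -/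
theorem obsLaw_prod {f : unitInterval → ℝ} (hf : Measurable f) {S : Set unitInterval} {T : Set ℝ}
    (hS : MeasurableSet S) (hT : MeasurableSet T) :
    obsLaw f (S ×ˢ T) = ∫⁻ x in S, gaussianReal (f x) 1 T := by
  have hm : Measurable (obsDensity f) := by
    unfold obsDensity gaussianPDF gaussianPDFReal
    fun_prop
  rw [obsLaw, withDensity_apply _ (hS.prod hT), Measure.volume_eq_prod,
    ← Measure.prod_restrict, lintegral_prod _ hm.aemeasurable]
  refine lintegral_congr fun x => ?_
  rw [gaussianReal_apply _ one_ne_zero]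
  rfl

/-- The law `P_f^{(n)}` of `n` i.i.d. observations `(X_1, Y_1), …, (X_n, Y_n)`. -/
def sampleLaw (f : unitInterval → ℝ) (n : ℕ) : Measure (Fin n → unitInterval × ℝ) :=
  Measure.pi fun _ => obsLaw f

/-- The density `p_f^{(n)}` of the sample, for `f = ∑_j θ_j φ_j`. -/
def likelihood {n : ℕ} (z : Fin n → unitInterval × ℝ) (θ : ℕ → ℝ) : ℝ≥0∞ :=
  ∏ i, obsDensity (seriesFun θ) (z i)

/-- The posterior distribution
`Π(A | z) = ∫_A p_f^{(n)}(z) dΠ(f) / ∫ p_f^{(n)}(z) dΠ(f)`. Dividing both integrands by the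
positive finite number `p_{f₀}^{(n)}(z)`, as is sometimes done, does not change it. -/
def posterior (prior : Measure (ℕ → ℝ)) {n : ℕ} (z : Fin n → unitInterval × ℝ)
    (A : Set (ℕ → ℝ)) : ℝ≥0∞ :=
  (∫⁻ θ in A, likelihood z θ ∂prior) / ∫⁻ θ, likelihood z θ ∂prior

/-- The rate `ε_n = n^{-α/(2α+1)}`. -/
def rate (α : ℝ) (n : ℕ) : ℝ := (n : ℝ) ^ (-(α / (2 * α + 1)))

/-- The constant `γ = (∑_{j ≥ 1} j^{-2α*})^{1/2}`. -/
def gammaConst (αs : ℝ) : ℝ := √(∑' j : ℕ, ((j : ℝ) + 1) ^ (-(2 * αs)))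

/-- The set `{f : ‖f - f₀‖ > r}` with the norm of `L²[0,1]`, in terms of the coefficients of `f`. -/
def farSet (f₀ : unitInterval → ℝ) (r : ℝ) : Set (ℕ → ℝ) :=
  {θ | ENNReal.ofReal r < eLpNorm (fun x => seriesFun θ x - f₀ x) 2 volume}

end BlockPrior

end

open MeasureTheory ProbabilityTheory Filter Topology
open scoped ENNReal NNReal

noncomputable section

namespace BlockPrior

/-! ### The trigonometric basis -/

/-! Put `N = n ε_n² = n^{1/(2α+1)}` and choose `K` with `N ≤ e^K ≤ 3N`. The blocks before `K` then
hold at most `3N` coefficients, and a sequence in the Sobolev ball has energy of order `ε_n²` beyond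
them. Contraction follows by comparing probabilities that are all exponential in `N`.

Prior mass (`exists_le_blockPrior_neighborhood`). The prior does not know `α`, but for every `α` the
variance `A_k` lies within a constant factor of `e^{-(2α+1)k}` with probability at least `exp(-C
e^k)`. These costs add up to order `e^K`, because the blocks grow geometrically. Given such
variances, Gaussian small-ball bounds put mass `exp(-C e^K)` on a ball of radius of order `ε_n`
around the truth. The ball stays inside `D`, since the truth uses at most `B/3` of the allowed `ℓ¹`
norm.

Sieve (`exists_blockPrior_tail_le`). Enlarging the cutoff to `K + m` makes the prior probability of
tail energy above `e^{-2αK}` as small a power of `exp(-e^K)` as desired.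

Tests (`exists_test`). Outside the ball but inside the sieve, `f` differs from the truth already in
its first `J` coefficients, with `J` of order `N`. Linear statistics in at most `5^J` directions
detect this. The sieve need not be covered, because the tests see only `J` coordinates and `D`
bounds `|f - f₀|` uniformly.

Evidence (`lintegral_posterior_le`). With `L` the likelihood ratio, Cauchy–Schwarz gives `π(S)² ≤
∫_S L dπ · ∫_S L⁻¹ dπ`, and `L⁻¹` has expectation at most `exp(n e^{H²} v)` on an `L²` ball of
squared radius `v`. So Markov's inequality bounds the denominator from below.

The condition `α > 1/2` keeps the small ball in `D` and gives `ε_n √N → 0`, which keeps the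
random-design statistics in their Gaussian deviation range. Every bound depends on the truth only
through `α`, `Q` and `B`, whence the uniformity. -/

theorem integral_cos_unit (m : ℤ) (c : ℝ) :
    ∫ x : unitInterval, Real.cos (2 * Real.pi * m * (x : ℝ) - c)
      = if m = 0 then Real.cos c else 0 := by
  split_ifs with hm
  · subst hm
    simp
  have h1 : ∫ x : unitInterval, Real.cos (2 * Real.pi * m * (x : ℝ) - c)
      = ∫ x in (0 : ℝ)..1, Real.cos (2 * Real.pi * m * x - c) := by
    rw [intervalIntegral.integral_of_le zero_le_one, ← integral_Icc_eq_integral_Ioc]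
    exact unitInterval.measurePreserving_coe.integral_comp
      unitInterval.measurableEmbedding_coe (fun x : ℝ => Real.cos (2 * Real.pi * m * x - c))
  have h2 : (2 * Real.pi * m : ℝ) ≠ 0 := by
    have : (m : ℝ) ≠ 0 := by exact_mod_cast hm
    positivity
  rw [h1, intervalIntegral.integral_comp_mul_sub (fun y => Real.cos y) h2, integral_cos]
  have h3 : Real.sin (2 * Real.pi * m * 1 - c) = Real.sin (2 * Real.pi * m * 0 - c) := by
    have := Real.sin_add_int_mul_two_pi (2 * Real.pi * m * 0 - c) m
    rw [← this]
    congr 1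
    ring
  rw [h3, sub_self, smul_zero]

/-- The phase shift that writes `φ_j`, `j ≥ 2`, as a shifted cosine. -/
def trigPhase (j : ℕ) : ℝ := if Even j then 0 else Real.pi / 2

theorem trigBasis_eq_cos {j : ℕ} (hj : j ≠ 1) (x : unitInterval) :
    trigBasis j x = √2 * Real.cos (2 * Real.pi * ((j / 2 : ℕ) : ℝ) * (x : ℝ) - trigPhase j) := by
  unfold trigBasis trigPhase
  rw [if_neg hj]
  split_ifs
  · simp
  · rw [Real.cos_sub_pi_div_two]

theorem abs_trigBasis_le (j : ℕ) (x : unitInterval) : |trigBasis j x| ≤ √2 := by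
  by_cases hj : j = 1
  · simp only [trigBasis, if_pos hj, abs_one]
    exact Real.one_le_sqrt.mpr (by norm_num)
  · rw [trigBasis_eq_cos hj, abs_mul, abs_of_nonneg (Real.sqrt_nonneg 2)]
    exact mul_le_of_le_one_right (Real.sqrt_nonneg 2) (Real.abs_cos_le_one _)

@[fun_prop]
theorem measurable_trigBasis (j : ℕ) : Measurable (trigBasis j) := by
  unfold trigBasis
  split_ifs <;> fun_prop

theorem integrable_trigBasis_mul (j : ℕ) {f : unitInterval → ℝ} (hf : Integrable f volume) :
    Integrable (fun x => f x * trigBasis j x) volume := by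
  refine hf.mul_bdd (c := √2) (measurable_trigBasis j).aestronglyMeasurable ?_
  exact ae_of_all _ fun x => by simpa using abs_trigBasis_le j x

theorem integrable_cos_unit (a c : ℝ) :
    Integrable (fun x : unitInterval => Real.cos (a * (x : ℝ) - c)) volume := by
  refine Integrable.of_bound (C := 1) (by fun_prop) (ae_of_all _ fun x => ?_)
  simpa using Real.abs_cos_le_one _

/-- Written as shifted cosines, two nonconstant basis functions multiply to a cosine of the sum
frequency, which is never zero, plus one of the difference frequency. The latter vanishes only
within a cosine–sine pair or for `i = j`, and in a pair the phase difference `±π/2` kills the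
integral. -/
theorem integral_trigBasis_mul {i j : ℕ} (hi : 1 ≤ i) (hj : 1 ≤ j) :
    ∫ x, trigBasis i x * trigBasis j x = if i = j then 1 else 0 := by
  have one : ∀ k : ℕ, 1 < k → ∫ x, trigBasis k x = 0 := by
    intro k hk
    simp_rw [trigBasis_eq_cos (show k ≠ 1 by omega)]
    rw [integral_const_mul]
    have := integral_cos_unit ((k / 2 : ℕ) : ℤ) (trigPhase k)
    rw [if_neg (by omega)] at this
    rw [Int.cast_natCast] at this
    rw [this, mul_zero]
  rcases eq_or_lt_of_le hi with rfl | hi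
  · rcases eq_or_lt_of_le hj with rfl | hj
    · simp [trigBasis]
    · rw [if_neg (by omega), ← one j hj]
      simp [trigBasis]
  rcases eq_or_lt_of_le hj with rfl | hj
  · rw [if_neg (by omega), ← one i hi]
    simp [trigBasis]
  have key : ∀ x : unitInterval, trigBasis i x * trigBasis j x =
      Real.cos (2 * Real.pi * (((i / 2 : ℕ) - (j / 2 : ℕ) : ℤ) : ℝ) * (x : ℝ)
          - (trigPhase i - trigPhase j))
      + Real.cos (2 * Real.pi * (((i / 2 : ℕ) + (j / 2 : ℕ) : ℤ) : ℝ) * (x : ℝ)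
          - (trigPhase i + trigPhase j)) := by
    intro x
    rw [trigBasis_eq_cos (by omega), trigBasis_eq_cos (by omega)]
    have h := Real.two_mul_cos_mul_cos
      (2 * Real.pi * ((i / 2 : ℕ) : ℝ) * (x : ℝ) - trigPhase i)
      (2 * Real.pi * ((j / 2 : ℕ) : ℝ) * (x : ℝ) - trigPhase j)
    have h2 : √2 * √2 = (2 : ℝ) := Real.mul_self_sqrt (by norm_num)
    calc _ = (√2 * √2) * Real.cos (2 * Real.pi * ((i / 2 : ℕ) : ℝ) * (x : ℝ) - trigPhase i)
          * Real.cos (2 * Real.pi * ((j / 2 : ℕ) : ℝ) * (x : ℝ) - trigPhase j) := by ring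
      _ = _ := by
        rw [h2, h]
        congr 2 <;> simp only [Int.cast_sub, Int.cast_add, Int.cast_natCast] <;> ring
  simp_rw [key]
  rw [integral_add (integrable_cos_unit _ _) (integrable_cos_unit _ _), integral_cos_unit,
    integral_cos_unit, if_neg (show ¬(((i / 2 : ℕ) : ℤ) + ((j / 2 : ℕ) : ℤ) = 0) by omega), add_zero]
  by_cases hij : i = j
  · simp [hij]
  rw [if_neg hij]
  split_ifs with h
  · unfold trigPhase
    by_cases h1 : Even i <;> by_cases h2 : Even j
    · rw [Nat.even_iff] at h1 h2; omega
    · simp [h1, h2]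
    · simp [h1, h2]
    · rw [Nat.even_iff] at h1 h2; omega
  · rfl

/-- Completeness of the basis: the complex Fourier coefficients are combinations of the real ones,
so they all vanish and Parseval's identity gives `∫ f² = 0`. -/
theorem ae_eq_zero_of_fourierCoef_eq_zero {f : unitInterval → ℝ} (hf : MemLp f 2 volume)
    (h0 : ∀ j, fourierCoef f j = 0) : f =ᵐ[volume] 0 := by
  have hint : Integrable f volume := hf.integrable (by norm_num)
  have hcos : ∀ m : ℕ, ∫ x : unitInterval, f x * Real.cos (2 * Real.pi * m * (x : ℝ)) = 0 := by
    intro m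
    rcases Nat.eq_zero_or_pos m with rfl | hm
    · simpa [fourierCoef, trigBasis] using h0 0
    · have := h0 (2 * m - 1)
      unfold fourierCoef trigBasis at this
      rw [show 2 * m - 1 + 1 = 2 * m by omega] at this
      simp_rw [if_neg (show 2 * m ≠ 1 by omega), if_pos (even_two_mul m),
        Nat.mul_div_cancel_left m two_pos, mul_left_comm _ √2, integral_const_mul] at this
      simpa using this
  have hsin : ∀ m : ℕ, ∫ x : unitInterval, f x * Real.sin (2 * Real.pi * m * (x : ℝ)) = 0 := by
    intro m
    rcases Nat.eq_zero_or_pos m with rfl | hm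
    · simp
    · have := h0 (2 * m)
      unfold fourierCoef trigBasis at this
      simp_rw [if_neg (show 2 * m + 1 ≠ 1 by omega),
        if_neg (show ¬ Even (2 * m + 1) by simp),
        show (2 * m + 1) / 2 = m by omega, mul_left_comm _ √2, integral_const_mul] at this
      simpa using this
  -- The extension of `f` outside `[0,1]` is arbitrary; only the interval enters `fourierCoeffOn`.
  let F : ℝ → ℂ := fun x => ((f (Set.projIcc 0 1 zero_le_one x) : ℝ) : ℂ)
  have hFI : ∀ x : unitInterval, F x = f x := fun x => by simp [F]
  have hmp := unitInterval.measurePreserving_coe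
  have hemb := unitInterval.measurableEmbedding_coe
  have hF : MemLp F 2 ((volume : Measure ℝ).restrict (Set.Ioc 0 1)) := by
    rw [restrict_Ioc_eq_restrict_Icc, ← unitInterval, ← hmp.map_eq, hemb.memLp_map_measure_iff]
    have : F ∘ Subtype.val = fun x => ((f x : ℝ) : ℂ) := funext hFI
    rw [this]
    exact hf.ofReal
  have hint' : ∀ {G : ℝ → ℂ}, ∫ x in (0 : ℝ)..1, G x = ∫ x : unitInterval, G x := by
    intro G
    rw [intervalIntegral.integral_of_le zero_le_one, ← integral_Icc_eq_integral_Ioc]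
    exact (hmp.integral_comp hemb G).symm
  have hicos : ∀ a : ℝ, Integrable (fun x : unitInterval => f x * Real.cos (a * x)) volume :=
    fun a => hint.mul_bdd (c := 1) (by fun_prop) (ae_of_all _ fun x => by
      simpa using Real.abs_cos_le_one _)
  have hisin : ∀ a : ℝ, Integrable (fun x : unitInterval => f x * Real.sin (a * x)) volume :=
    fun a => hint.mul_bdd (c := 1) (by fun_prop) (ae_of_all _ fun x => by
      simpa using Real.abs_sin_le_one _)
  have hcoef : ∀ n : ℤ, fourierCoeffOn (zero_lt_one' ℝ) F n = 0 := by
    intro n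
    rw [fourierCoeffOn_eq_integral, hint']
    have h1 : ∀ x : unitInterval,
        (fourier (-n) ((x : ℝ) : AddCircle ((1 : ℝ) - 0)) • F x : ℂ)
        = ((f x * Real.cos (2 * Real.pi * n * (x : ℝ)) : ℝ) : ℂ)
          - ((f x * Real.sin (2 * Real.pi * n * (x : ℝ)) : ℝ) : ℂ) * Complex.I := by
      intro x
      rw [hFI, fourier_coe_apply, smul_eq_mul]
      have : (2 * Real.pi * Complex.I * ((-n : ℤ) : ℂ) * ((x : ℝ) : ℂ) / ((1 - 0 : ℝ) : ℂ))
        = ((-(2 * Real.pi * n * (x : ℝ)) : ℝ) : ℂ) * Complex.I := by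
        push_cast; ring
      rw [this, Complex.exp_mul_I, ← Complex.ofReal_cos, ← Complex.ofReal_sin, Real.cos_neg,
        Real.sin_neg]
      push_cast; ring
    simp_rw [h1]
    rw [integral_sub (hicos _).ofReal ((hisin _).ofReal.mul_const _), integral_mul_const,
      integral_complex_ofReal, integral_complex_ofReal]
    have h2 : ∫ x : unitInterval, f x * Real.cos (2 * Real.pi * n * (x : ℝ)) = 0 := by
      rcases Int.natAbs_eq n with h | h <;> rw [h]
      · simpa using hcos n.natAbs
      · simpa using hcos n.natAbs
    have h3 : ∫ x : unitInterval, f x * Real.sin (2 * Real.pi * n * (x : ℝ)) = 0 := by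
      rcases Int.natAbs_eq n with h | h <;> rw [h]
      · simpa using hsin n.natAbs
      · have := hsin n.natAbs
        simp only [Int.cast_neg, Int.cast_natCast, mul_neg, neg_mul, Real.sin_neg, integral_neg,
          this, neg_zero]
    rw [h2, h3]
    simp
  have hsum := hasSum_sq_fourierCoeffOn (zero_lt_one' ℝ) hF
  simp_rw [hcoef] at hsum
  have hz : ∫ x in (0 : ℝ)..1, ‖F x‖ ^ 2 = 0 := by
    have := hsum.tsum_eq.symm
    simpa using this
  rw [intervalIntegral.integral_of_le zero_le_one, ← integral_Icc_eq_integral_Ioc] at hz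
  have hz' : ∫ x : unitInterval, f x ^ 2 = 0 := by
    have h := hmp.integral_comp hemb (fun x : ℝ => ‖F x‖ ^ 2)
    rw [← unitInterval] at hz
    rw [hz] at h
    simpa [hFI] using h
  rw [integral_eq_zero_iff_of_nonneg (fun x => sq_nonneg _) hf.integrable_sq] at hz'
  filter_upwards [hz'] with x hx
  simpa using hx

/-! ### Absolutely convergent trigonometric series -/

theorem summable_seriesFun {a : ℕ → ℝ} (ha : Summable fun j => |a j|) (x : unitInterval) :
    Summable fun j => a j * trigBasis (j + 1) x := by
  refine Summable.of_norm_bounded (g := fun j => |a j| * √2) (ha.mul_right _) fun j => ?_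
  rw [Real.norm_eq_abs, abs_mul]
  exact mul_le_mul_of_nonneg_left (abs_trigBasis_le _ _) (abs_nonneg _)

theorem abs_seriesFun_le {a : ℕ → ℝ} (ha : Summable fun j => |a j|) (x : unitInterval) :
    |seriesFun a x| ≤ √2 * ∑' j, |a j| := by
  have h : ∀ j, ‖a j * trigBasis (j + 1) x‖ ≤ √2 * |a j| := fun j => by
    rw [Real.norm_eq_abs, abs_mul, mul_comm]
    exact mul_le_mul_of_nonneg_right (abs_trigBasis_le _ _) (abs_nonneg _)
  rw [← tsum_mul_left]
  exact tsum_of_norm_bounded (ha.mul_left _).hasSum h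

theorem seriesFun_sub {a b : ℕ → ℝ} (ha : Summable fun j => |a j|) (hb : Summable fun j => |b j|)
    (x : unitInterval) : seriesFun a x - seriesFun b x = seriesFun (fun j => a j - b j) x := by
  unfold seriesFun
  rw [← (summable_seriesFun ha x).tsum_sub (summable_seriesFun hb x)]
  simp_rw [sub_mul]

theorem measurable_seriesFun_uncurry :
    Measurable fun p : (ℕ → ℝ) × unitInterval => seriesFun p.1 p.2 := by
  unfold seriesFun
  refine Measurable.tsum fun j => ?_
  exact ((measurable_pi_apply j).comp measurable_fst).mul
    ((measurable_trigBasis _).comp measurable_snd)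

@[fun_prop]
theorem measurable_seriesFun (a : ℕ → ℝ) : Measurable (seriesFun a) :=
  measurable_seriesFun_uncurry.comp measurable_prodMk_left

/-- Sum and integral commute because the terms are dominated by `C √2 |a j|`. Orthonormality then
yields the coefficients of a series and Parseval's identity for absolutely summable sequences. -/
theorem integral_mul_seriesFun {a : ℕ → ℝ} (ha : Summable fun j => |a j|) {f : unitInterval → ℝ}
    {C : ℝ} (hf : Measurable f) (hC : ∀ x, |f x| ≤ C) :
    ∫ x, f x * seriesFun a x = ∑' j, a j * fourierCoef f j := by
  have hfi : Integrable f volume := Integrable.of_bound hf.aestronglyMeasurable C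
    (ae_of_all _ hC)
  have h1 : ∀ x, f x * seriesFun a x = ∑' j, a j * (f x * trigBasis (j + 1) x) := by
    intro x
    unfold seriesFun
    rw [← tsum_mul_left]
    exact tsum_congr fun j => by ring
  simp_rw [h1]
  have h2 := hasSum_integral_of_summable_integral_norm
    (F := fun j x => a j * (f x * trigBasis (j + 1) x)) (μ := (volume : Measure unitInterval))
    (fun j => (integrable_trigBasis_mul (j + 1) hfi).const_mul (a j)) ?_
  · rw [← h2.tsum_eq]
    exact tsum_congr fun j => integral_const_mul _ _
  · refine Summable.of_nonneg_of_le (fun j => integral_nonneg fun x => norm_nonneg _) (fun j => ?_)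
      (ha.mul_right (C * √2))
    calc ∫ x, ‖a j * (f x * trigBasis (j + 1) x)‖
        ≤ ∫ _ : unitInterval, |a j| * (C * √2) := by
          refine integral_mono (((integrable_trigBasis_mul (j + 1) hfi).const_mul (a j)).norm)
            (integrable_const _) fun x => ?_
          simp only [Real.norm_eq_abs, abs_mul]
          gcongr
          · exact (abs_nonneg _).trans (hC x)
          · exact hC x
          · exact abs_trigBasis_le _ _
      _ = |a j| * (C * √2) := by simp

theorem fourierCoef_seriesFun {a : ℕ → ℝ} (ha : Summable fun j => |a j|) (j : ℕ) :
    fourierCoef (seriesFun a) j = a j := by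
  have h := integral_mul_seriesFun ha (measurable_trigBasis (j + 1)) (abs_trigBasis_le (j + 1))
  unfold fourierCoef at h ⊢
  simp_rw [mul_comm (seriesFun a _)]
  rw [h, tsum_eq_single j]
  · rw [integral_trigBasis_mul (by omega) (by omega), if_pos rfl, mul_one]
  · intro i hi
    rw [integral_trigBasis_mul (by omega) (by omega), if_neg (by omega), mul_zero]

theorem integral_seriesFun_mul {a b : ℕ → ℝ} (ha : Summable fun j => |a j|)
    (hb : Summable fun j => |b j|) :
    ∫ x, seriesFun a x * seriesFun b x = ∑' j, a j * b j := by
  rw [integral_mul_seriesFun hb (measurable_seriesFun a) (abs_seriesFun_le ha)]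
  exact tsum_congr fun j => by rw [fourierCoef_seriesFun ha, mul_comm]

theorem integral_seriesFun_sq {a : ℕ → ℝ} (ha : Summable fun j => |a j|) :
    ∫ x, seriesFun a x ^ 2 = ∑' j, a j ^ 2 := by
  simp_rw [sq]
  exact integral_seriesFun_mul ha ha

theorem memLp_seriesFun {a : ℕ → ℝ} (ha : Summable fun j => |a j|) (p : ℝ≥0∞) :
    MemLp (seriesFun a) p (volume : Measure unitInterval) :=
  MemLp.of_bound (measurable_seriesFun a).aestronglyMeasurable _ (ae_of_all _ (abs_seriesFun_le ha))

theorem ae_eq_seriesFun_fourierCoef {f : unitInterval → ℝ} (hf : MemLp f 2 volume)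
    (h : Summable fun j => |fourierCoef f j|) : f =ᵐ[volume] seriesFun (fourierCoef f) := by
  have h1 : MemLp (f - seriesFun (fourierCoef f)) 2 volume := hf.sub (memLp_seriesFun h 2)
  have h2 := ae_eq_zero_of_fourierCoef_eq_zero h1 fun j => by
    rw [fourierCoef]
    simp only [Pi.sub_apply, sub_mul]
    rw [integral_sub (integrable_trigBasis_mul _ (hf.integrable (by norm_num)))
      (integrable_trigBasis_mul _ ((memLp_seriesFun h 2).integrable (by norm_num)))]
    exact sub_eq_zero.mpr (fourierCoef_seriesFun h j).symm
  filter_upwards [h2] with x hx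
  simpa [sub_eq_zero] using hx

theorem eLpNorm_seriesFun {a : ℕ → ℝ} (ha : Summable fun j => |a j|) :
    eLpNorm (seriesFun a) 2 (volume : Measure unitInterval)
      = ENNReal.ofReal (√(∑' j, a j ^ 2)) := by
  rw [(memLp_seriesFun ha 2).eLpNorm_eq_integral_rpow_norm (by norm_num) (by norm_num)]
  congr 1
  rw [← integral_seriesFun_sq ha, Real.sqrt_eq_rpow]
  norm_num

/-! ### Exponential moments of the observations -/

@[fun_prop]
theorem measurable_obsDensity {f : unitInterval → ℝ} (hf : Measurable f) :
    Measurable (obsDensity f) := by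
  unfold obsDensity gaussianPDF gaussianPDFReal
  fun_prop

/-- Completing the square in `y` turns the tilted density into that of `N(f(x) + a(x), 1)`. The
likelihood ratio, its inverse and the exponentials of the test statistics all have this form, so
only an integral over the design remains. -/
theorem lintegral_obsLaw_exp {f a b : unitInterval → ℝ} (hf : Measurable f) (ha : Measurable a)
    (hb : Measurable b) :
    ∫⁻ p, ENNReal.ofReal (Real.exp (a p.1 * (p.2 - f p.1) + b p.1)) ∂(obsLaw f)
      = ∫⁻ x, ENNReal.ofReal (Real.exp (a x ^ 2 / 2 + b x)) := by
  have hm : Measurable fun p : unitInterval × ℝ =>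
      ENNReal.ofReal (Real.exp (a p.1 * (p.2 - f p.1) + b p.1)) := by fun_prop
  rw [obsLaw, lintegral_withDensity_eq_lintegral_mul _ (measurable_obsDensity hf) hm,
    Measure.volume_eq_prod,
    lintegral_prod _ ((measurable_obsDensity hf).mul hm).aemeasurable]
  refine lintegral_congr fun x => ?_
  have h : ∀ y : ℝ, (obsDensity f * fun p : unitInterval × ℝ =>
      ENNReal.ofReal (Real.exp (a p.1 * (p.2 - f p.1) + b p.1))) (x, y)
      = ENNReal.ofReal (Real.exp (a x ^ 2 / 2 + b x)) * gaussianPDF (f x + a x) 1 y := by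
    intro y
    simp only [Pi.mul_apply, obsDensity, gaussianPDF, gaussianPDFReal]
    rw [← ENNReal.ofReal_mul (by positivity), ← ENNReal.ofReal_mul (by positivity), mul_assoc,
      ← Real.exp_add, mul_left_comm, ← Real.exp_add]
    congr 3
    push_cast
    ring
  simp_rw [h]
  rw [lintegral_const_mul _ (measurable_gaussianPDF _ _),
    lintegral_gaussianPDF_eq_one _ one_ne_zero, mul_one]

theorem isProbabilityMeasure_obsLaw {f : unitInterval → ℝ} (hf : Measurable f) :
    IsProbabilityMeasure (obsLaw f) := by
  constructor
  have := lintegral_obsLaw_exp hf (measurable_const (a := (0 : ℝ))) (measurable_const (a := (0 : ℝ)))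
  simpa using this

theorem isProbabilityMeasure_sampleLaw {f : unitInterval → ℝ} (hf : Measurable f) (n : ℕ) :
    IsProbabilityMeasure (sampleLaw f n) := by
  have := isProbabilityMeasure_obsLaw hf
  unfold sampleLaw
  infer_instance

theorem lintegral_sampleLaw_prod {f : unitInterval → ℝ} (hf : Measurable f) (n : ℕ)
    {G : unitInterval × ℝ → ℝ≥0∞} (hG : Measurable G) :
    ∫⁻ z, ∏ i, G (z i) ∂(sampleLaw f n) = (∫⁻ p, G p ∂(obsLaw f)) ^ n := by
  have := isProbabilityMeasure_obsLaw hf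
  unfold sampleLaw
  have hind := iIndepFun_pi (μ := fun _ : Fin n => obsLaw f) (X := fun _ => G)
    (fun _ => hG.aemeasurable)
  rw [lintegral_prod_eq_prod_lintegral_of_indepFun Finset.univ _ hind
    fun i => hG.comp (measurable_pi_apply i)]
  have : ∀ i : Fin n, ∫⁻ z, G (z i) ∂(Measure.pi fun _ : Fin n => obsLaw f)
      = ∫⁻ p, G p ∂(obsLaw f) := fun i =>
    (measurePreserving_eval (fun _ : Fin n => obsLaw f) i).lintegral_comp hG
  simp [this]

theorem lintegral_sampleLaw_exp_le {f a b : unitInterval → ℝ} (hf : Measurable f)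
    (ha : Measurable a) (hb : Measurable b) (n : ℕ) {c : ℝ}
    (hc : ∫⁻ x, ENNReal.ofReal (Real.exp (a x ^ 2 / 2 + b x)) ≤ ENNReal.ofReal (Real.exp c)) :
    ∫⁻ z, ∏ i, ENNReal.ofReal (Real.exp (a (z i).1 * ((z i).2 - f (z i).1) + b (z i).1))
      ∂(sampleLaw f n) ≤ ENNReal.ofReal (Real.exp (n * c)) := by
  rw [lintegral_sampleLaw_prod hf n (G := fun p =>
    ENNReal.ofReal (Real.exp (a p.1 * (p.2 - f p.1) + b p.1))) (by fun_prop),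
    lintegral_obsLaw_exp hf ha hb, Real.exp_nat_mul, ENNReal.ofReal_pow (Real.exp_nonneg _)]
  exact pow_le_pow_left' hc n

/-- The likelihood ratio `p_f / p_{f₀}` of a single observation. -/
def obsRatio (f₀ f : unitInterval → ℝ) (p : unitInterval × ℝ) : ℝ≥0∞ :=
  ENNReal.ofReal (Real.exp ((f p.1 - f₀ p.1) * (p.2 - f₀ p.1) + -((f p.1 - f₀ p.1) ^ 2 / 2)))

theorem obsDensity_eq_mul_obsRatio (f₀ f : unitInterval → ℝ) (p : unitInterval × ℝ) :
    obsDensity f p = obsDensity f₀ p * obsRatio f₀ f p := by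
  simp only [obsDensity, obsRatio, gaussianPDF, gaussianPDFReal]
  rw [← ENNReal.ofReal_mul (by positivity), mul_assoc _ (Real.exp _), ← Real.exp_add]
  congr 3
  push_cast
  ring

theorem lintegral_prod_obsRatio_le_one {f₀ f : unitInterval → ℝ} (hf₀ : Measurable f₀)
    (hf : Measurable f) (n : ℕ) :
    ∫⁻ z, ∏ i, obsRatio f₀ f (z i) ∂(sampleLaw f₀ n) ≤ 1 := by
  have := lintegral_sampleLaw_exp_le hf₀ (a := fun x => f x - f₀ x)
    (b := fun x => -((f x - f₀ x) ^ 2 / 2)) (by fun_prop) (by fun_prop) n (c := 0) (by simp)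
  simpa [obsRatio] using this

/-- After integration `1 + c ≤ e^c` restores the exponential form, which is stable under taking the
`n`-fold product. -/
theorem lintegral_ofReal_exp_le {F : unitInterval → ℝ} {G : unitInterval → ℝ} {c : ℝ}
    (hG : Integrable G volume) (hFG : ∀ x, Real.exp (F x) ≤ 1 + G x) (hc : ∫ x, G x ≤ c) :
    ∫⁻ x, ENNReal.ofReal (Real.exp (F x)) ≤ ENNReal.ofReal (Real.exp c) := by
  calc ∫⁻ x, ENNReal.ofReal (Real.exp (F x)) ≤ ∫⁻ x, ENNReal.ofReal (1 + G x) :=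
        lintegral_mono fun x => ENNReal.ofReal_le_ofReal (hFG x)
    _ = ENNReal.ofReal (∫ x, (1 + G x)) := by
        refine (ofReal_integral_eq_lintegral_ofReal
          (f := fun x => 1 + G x) ((integrable_const 1).add hG) ?_).symm
        exact ae_of_all _ fun x => (Real.exp_nonneg _).trans (hFG x)
    _ ≤ _ := by
        refine ENNReal.ofReal_le_ofReal ?_
        rw [integral_add (integrable_const 1) hG]
        have := Real.add_one_le_exp c
        simp
        linarith

/-- For the inverse ratio the Gaussian integral leaves `∫ exp((f - f₀)²)`, and the uniform bound `H`
makes this at most `1 + e^{H²} ∫ (f - f₀)²`. This single moment replaces bounds on the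
Kullback–Leibler divergence and on the variance of the log-likelihood. -/
theorem lintegral_inv_prod_obsRatio_le {f₀ f : unitInterval → ℝ} (hf₀ : Measurable f₀)
    (hf : Measurable f) (n : ℕ) {H v : ℝ} (hH : ∀ x, |f x - f₀ x| ≤ H)
    (hv : ∫ x, (f x - f₀ x) ^ 2 ≤ v) :
    ∫⁻ z, (∏ i, obsRatio f₀ f (z i))⁻¹ ∂(sampleLaw f₀ n)
      ≤ ENNReal.ofReal (Real.exp (n * (Real.exp (H ^ 2) * v))) := by
  have hsq : ∀ x, (f x - f₀ x) ^ 2 ≤ H ^ 2 := fun x =>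
    sq_le_sq' (by linarith [neg_le_of_abs_le (hH x)]) (le_of_abs_le (hH x))
  have h1 : ∀ z : Fin n → unitInterval × ℝ, (∏ i, obsRatio f₀ f (z i))⁻¹
      = ∏ i, ENNReal.ofReal (Real.exp ((fun x => -(f x - f₀ x)) (z i).1 * ((z i).2 - f₀ (z i).1)
        + (fun x => (f x - f₀ x) ^ 2 / 2) (z i).1)) := by
    intro z
    unfold obsRatio
    rw [← ENNReal.ofReal_prod_of_nonneg (fun i _ => Real.exp_nonneg _),
      ← ENNReal.ofReal_prod_of_nonneg (fun i _ => Real.exp_nonneg _),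
      ← ENNReal.ofReal_inv_of_pos (Finset.prod_pos fun i _ => Real.exp_pos _),
      ← Finset.prod_inv_distrib]
    simp_rw [← Real.exp_neg]
    congr 1
    refine Finset.prod_congr rfl fun i _ => ?_
    congr 1
    ring
  simp_rw [h1]
  refine lintegral_sampleLaw_exp_le hf₀ (a := fun x => -(f x - f₀ x))
    (b := fun x => (f x - f₀ x) ^ 2 / 2) (by fun_prop) (by fun_prop) n ?_
  have hint : Integrable (fun x => (f x - f₀ x) ^ 2) volume :=
    Integrable.of_bound (by fun_prop) (H ^ 2) (ae_of_all _ fun x => by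
      rw [Real.norm_eq_abs, abs_of_nonneg (sq_nonneg _)]; exact hsq x)
  refine lintegral_ofReal_exp_le (G := fun x => Real.exp (H ^ 2) * (f x - f₀ x) ^ 2)
    (hint.const_mul _) (fun x => ?_) ?_
  · have h2 : (-(f x - f₀ x)) ^ 2 / 2 + (f x - f₀ x) ^ 2 / 2 = (f x - f₀ x) ^ 2 := by ring
    rw [h2]
    set s := (f x - f₀ x) ^ 2
    -- `1 - s ≤ e^{-s}` gives `e^s ≤ 1 + s e^s`, and then `s ≤ H²` in the last factor.
    have h3 := Real.add_one_le_exp (-s)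
    rw [Real.exp_neg] at h3
    have h4 := Real.exp_pos s
    have h5 : Real.exp s * (-s + 1) ≤ 1 := by
      calc Real.exp s * (-s + 1) ≤ Real.exp s * (Real.exp s)⁻¹ := by gcongr
        _ = 1 := mul_inv_cancel₀ h4.ne'
    have h6 : Real.exp s * s ≤ Real.exp (H ^ 2) * s :=
      mul_le_mul_of_nonneg_right (Real.exp_le_exp.mpr (hsq x)) (sq_nonneg _)
    linarith
  · rw [integral_const_mul]
    exact mul_le_mul_of_nonneg_left hv (Real.exp_nonneg _)

/-- The linear statistic `∑ (Y_i - f₀(X_i)) u(X_i)`. -/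
def linStat (f₀ u : unitInterval → ℝ) {n : ℕ} (z : Fin n → unitInterval × ℝ) : ℝ :=
  ∑ i, ((z i).2 - f₀ (z i).1) * u (z i).1

@[fun_prop]
theorem measurable_linStat {f₀ u : unitInterval → ℝ} (hf₀ : Measurable f₀) (hu : Measurable u)
    (n : ℕ) : Measurable (linStat f₀ u (n := n)) := by
  unfold linStat
  fun_prop

/-- Chernoff's bound with parameter `t/2`. Given the design the statistic is Gaussian; averaging
over the design leaves `exp(t² u²/8)`. As `tU ≤ 1`, its exponent is at most `1`, so it is at most `1
+ t² u²/4`. The exponent per observation is `t²/4 - t²/2`. -/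
theorem sampleLaw_linStat_ge_le {f₀ u : unitInterval → ℝ} (hf₀ : Measurable f₀)
    (hu : Measurable u) (n : ℕ) {t U : ℝ} (ht : 0 ≤ t) (hU : ∀ x, |u x| ≤ U)
    (hu2 : ∫ x, u x ^ 2 ≤ 1) (htU : t * U ≤ 1) :
    sampleLaw f₀ n {z | n * t ≤ linStat f₀ u z} ≤ ENNReal.ofReal (Real.exp (-(n * (t ^ 2 / 4)))) := by
  have hsq : ∀ x, u x ^ 2 ≤ U ^ 2 := fun x =>
    sq_le_sq' (by linarith [neg_le_of_abs_le (hU x)]) (le_of_abs_le (hU x))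
  have hint : Integrable (fun x => u x ^ 2) volume :=
    Integrable.of_bound (by fun_prop) (U ^ 2) (ae_of_all _ fun x => by
      rw [Real.norm_eq_abs, abs_of_nonneg (sq_nonneg _)]; exact hsq x)
  have hU0 : 0 ≤ U := (abs_nonneg _).trans (hU 0)
  have hm : MeasurableSet {z : Fin n → unitInterval × ℝ | n * t ≤ linStat f₀ u z} :=
    measurableSet_le measurable_const (by fun_prop)
  have key := lintegral_sampleLaw_exp_le hf₀ (a := fun x => t / 2 * u x)
    (b := fun _ => -(t / 2 * t)) (by fun_prop) (by fun_prop) n (c := -(t ^ 2 / 4)) ?_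
  · rw [← lintegral_indicator_one hm]
    refine (lintegral_mono fun z => ?_).trans (key.trans_eq (by ring_nf))
    rw [← ENNReal.ofReal_prod_of_nonneg (fun i _ => Real.exp_nonneg _), ← Real.exp_sum]
    by_cases hz : n * t ≤ linStat f₀ u z
    · rw [Set.indicator_of_mem (by exact hz)]
      rw [Pi.one_apply, ← ENNReal.ofReal_one]
      refine ENNReal.ofReal_le_ofReal (Real.one_le_exp ?_)
      have : ∑ i, (t / 2 * u (z i).1 * ((z i).2 - f₀ (z i).1) + -(t / 2 * t))
          = t / 2 * (linStat f₀ u z - n * t) := by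
        rw [Finset.sum_add_distrib, linStat, mul_sub, Finset.mul_sum]
        simp only [Finset.sum_const, Finset.card_univ, Fintype.card_fin, nsmul_eq_mul]
        rw [sub_eq_add_neg]
        congr 1
        · exact Finset.sum_congr rfl fun i _ => by ring
        · ring
      rw [this]
      exact mul_nonneg (by linarith) (by linarith)
    · rw [Set.indicator_of_notMem (by exact hz)]
      exact zero_le
  · have h1 : ∀ x, ENNReal.ofReal (Real.exp ((t / 2 * u x) ^ 2 / 2 + -(t / 2 * t)))
        = ENNReal.ofReal (Real.exp (-(t / 2 * t)))
          * ENNReal.ofReal (Real.exp ((t / 2 * u x) ^ 2 / 2)) := fun x => by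
      rw [← ENNReal.ofReal_mul (Real.exp_nonneg _), ← Real.exp_add, add_comm]
    simp_rw [h1]
    rw [lintegral_const_mul _ (by fun_prop)]
    have h2 : ∫⁻ x, ENNReal.ofReal (Real.exp ((t / 2 * u x) ^ 2 / 2))
        ≤ ENNReal.ofReal (Real.exp (t ^ 2 / 4)) := by
      refine lintegral_ofReal_exp_le (G := fun x => t ^ 2 / 4 * u x ^ 2)
        (hint.const_mul _) (fun x => ?_) ?_
      · set s := (t / 2 * u x) ^ 2 / 2 with hs
        have hs0 : 0 ≤ s := by positivity
        have hs1 : s ≤ 1 := by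
          have : t ^ 2 * u x ^ 2 ≤ 1 := by
            calc t ^ 2 * u x ^ 2 ≤ t ^ 2 * U ^ 2 := mul_le_mul_of_nonneg_left (hsq x) (sq_nonneg _)
              _ = (t * U) ^ 2 := by ring
              _ ≤ 1 := pow_le_one₀ (by positivity) htU
          rw [hs]
          nlinarith
        have h3 := (abs_le.mp (Real.abs_exp_sub_one_sub_id_le
          (abs_le.mpr ⟨by linarith, hs1⟩))).2
        have h4 : t ^ 2 / 4 * u x ^ 2 = 2 * s := by rw [hs]; ring
        rw [h4]
        nlinarith
      · rw [integral_const_mul]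
        nlinarith [sq_nonneg t]
    calc _ ≤ ENNReal.ofReal (Real.exp (-(t / 2 * t))) * ENNReal.ofReal (Real.exp (t ^ 2 / 4)) := by
          gcongr
      _ = _ := by
        rw [← ENNReal.ofReal_mul (Real.exp_nonneg _), ← Real.exp_add]
        congr 2
        ring

/-- The left side is the probability under `P_f^{(n)}` that the test does not reject. There the
statistic has mean at least `2nt`, so staying below `nt` is a deviation, bounded by Chernoff. The
constant depends on `H` because the random design contributes the variance of `(f - f₀) u`. -/
theorem lintegral_prod_obsRatio_linStat_lt_le {f₀ f u : unitInterval → ℝ} (hf₀ : Measurable f₀)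
    (hf : Measurable f) (hu : Measurable u) (n : ℕ) {t U H : ℝ} (ht : 0 ≤ t)
    (hU : ∀ x, |u x| ≤ U) (hu2 : ∫ x, u x ^ 2 ≤ 1) (htU : t * U ≤ 1)
    (hH : ∀ x, |f x - f₀ x| ≤ H) (hfu : 2 * t ≤ ∫ x, (f x - f₀ x) * u x) :
    ∫⁻ z in {z | linStat f₀ u z < n * t}, ∏ i, obsRatio f₀ f (z i) ∂(sampleLaw f₀ n)
      ≤ ENNReal.ofReal (Real.exp (-(n * (t ^ 2 / (4 * (2 * H ^ 2 + 2)))))) := by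
  have hsq : ∀ x, u x ^ 2 ≤ U ^ 2 := fun x =>
    sq_le_sq' (by linarith [neg_le_of_abs_le (hU x)]) (le_of_abs_le (hU x))
  have hint : Integrable (fun x => u x ^ 2) volume :=
    Integrable.of_bound (by fun_prop) (U ^ 2) (ae_of_all _ fun x => by
      rw [Real.norm_eq_abs, abs_of_nonneg (sq_nonneg _)]; exact hsq x)
  have hU0 : 0 ≤ U := (abs_nonneg _).trans (hU 0)
  have hH0 : 0 ≤ H := (abs_nonneg _).trans (hH 0)
  have hint2 : Integrable (fun x => (f x - f₀ x) * u x) volume :=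
    Integrable.of_bound (by fun_prop) (H * U) (ae_of_all _ fun x => by
      rw [Real.norm_eq_abs, abs_mul]; exact mul_le_mul (hH x) (hU x) (abs_nonneg _) hH0)
  have hm : MeasurableSet {z : Fin n → unitInterval × ℝ | linStat f₀ u z < n * t} :=
    measurableSet_lt (by fun_prop) measurable_const
  set C := 2 * H ^ 2 + 2 with hC
  have hC0 : 0 < C := by positivity
  -- The minimiser of the final exponent `l t - 2 l t + l² C`; the minimum is `-t²/(4C)`.
  set l := t / (2 * C) with hl
  have hl0 : 0 ≤ l := by positivity
  have hlC : l * (2 * C) = t := div_mul_cancel₀ _ (by positivity)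
  have key := lintegral_sampleLaw_exp_le hf₀ (a := fun x => (f x - f₀ x) - l * u x)
    (b := fun x => l * t + -((f x - f₀ x) ^ 2 / 2)) (by fun_prop) (by fun_prop) n
    (c := -(t ^ 2 / (4 * C))) ?_
  · rw [← lintegral_indicator hm]
    refine (lintegral_mono fun z => ?_).trans (key.trans_eq (by ring_nf))
    by_cases hz : linStat f₀ u z < n * t
    · rw [Set.indicator_of_mem (by exact hz)]
      unfold obsRatio
      rw [← ENNReal.ofReal_prod_of_nonneg (fun i _ => Real.exp_nonneg _), ← Real.exp_sum,
        ← ENNReal.ofReal_prod_of_nonneg (fun i _ => Real.exp_nonneg _), ← Real.exp_sum]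
      refine ENNReal.ofReal_le_ofReal (Real.exp_le_exp.mpr ?_)
      have : ∑ i, ((f (z i).1 - f₀ (z i).1 - l * u (z i).1) * ((z i).2 - f₀ (z i).1)
            + (l * t + -((f (z i).1 - f₀ (z i).1) ^ 2 / 2)))
          = ∑ i, ((f (z i).1 - f₀ (z i).1) * ((z i).2 - f₀ (z i).1)
            + -((f (z i).1 - f₀ (z i).1) ^ 2 / 2)) + l * (n * t - linStat f₀ u z) := by
        have h7 : l * (n * t - linStat f₀ u z)
            = ∑ i : Fin n, (l * t - l * (((z i).2 - f₀ (z i).1) * u (z i).1)) := by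
          rw [Finset.sum_sub_distrib, linStat, mul_sub, Finset.mul_sum]
          simp only [Finset.sum_const, Finset.card_univ, Fintype.card_fin, nsmul_eq_mul]
          ring
        rw [h7, ← Finset.sum_add_distrib]
        exact Finset.sum_congr rfl fun i _ => by ring
      rw [this]
      have := mul_nonneg hl0 (sub_nonneg.mpr hz.le)
      linarith
    · rw [Set.indicator_of_notMem (by exact hz)]
      exact zero_le
  · have h1 : ∀ x, ENNReal.ofReal (Real.exp ((f x - f₀ x - l * u x) ^ 2 / 2
          + (l * t + -((f x - f₀ x) ^ 2 / 2))))
        = ENNReal.ofReal (Real.exp (l * t))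
          * ENNReal.ofReal (Real.exp (-(l * ((f x - f₀ x) * u x)) + l ^ 2 * u x ^ 2 / 2)) := by
      intro x
      rw [← ENNReal.ofReal_mul (Real.exp_nonneg _), ← Real.exp_add]
      congr 2
      ring
    simp_rw [h1]
    rw [lintegral_const_mul _ (by fun_prop)]
    have h2 : ∫⁻ x, ENNReal.ofReal
          (Real.exp (-(l * ((f x - f₀ x) * u x)) + l ^ 2 * u x ^ 2 / 2))
        ≤ ENNReal.ofReal (Real.exp (-(2 * l * t) + l ^ 2 * C)) := by
      refine lintegral_ofReal_exp_le
        (G := fun x => -(l * ((f x - f₀ x) * u x)) + l ^ 2 * (2 * H ^ 2 + 3 / 2) * u x ^ 2)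
        ((hint2.const_mul l).neg.add (hint.const_mul _)) (fun x => ?_) ?_
      · have hlU : l * U * (2 * C) ≤ 1 := by
          calc l * U * (2 * C) = l * (2 * C) * U := by ring
            _ ≤ 1 := by rw [hlC]; exact htU
        have hlU0 : 0 ≤ l * U := by positivity
        have hC2 : 2 ≤ C := by rw [hC]; nlinarith [sq_nonneg H]
        have hHC : 4 * H ≤ C := by rw [hC]; nlinarith [sq_nonneg (H - 1)]
        have hlU4 : l * U ≤ 1 / 4 := by nlinarith
        have hHlU : H * (l * U) ≤ 1 / 8 := by nlinarith
        set p := l * ((f x - f₀ x) * u x) with hp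
        set q := l ^ 2 * u x ^ 2 / 2 with hq
        have hpa : |p| ≤ H * (l * U) := by
          rw [hp, abs_mul, abs_mul, abs_of_nonneg hl0]
          calc l * (|f x - f₀ x| * |u x|) ≤ l * (H * U) := by
                gcongr
                · exact hH x
                · exact hU x
            _ = _ := by ring
        have hq0 : 0 ≤ q := by positivity
        have hq1 : q ≤ 1 / 2 := by
          have : l ^ 2 * u x ^ 2 ≤ (l * U) ^ 2 := by
            rw [mul_pow]; exact mul_le_mul_of_nonneg_left (hsq x) (sq_nonneg _)
          rw [hq]
          nlinarith
        have hp2 : p ^ 2 ≤ 2 * H ^ 2 * q := by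
          have : (f x - f₀ x) ^ 2 ≤ H ^ 2 :=
            sq_le_sq' (by linarith [neg_le_of_abs_le (hH x)]) (le_of_abs_le (hH x))
          calc p ^ 2 = l ^ 2 * u x ^ 2 * (f x - f₀ x) ^ 2 := by rw [hp]; ring
            _ ≤ l ^ 2 * u x ^ 2 * H ^ 2 := by gcongr
            _ = _ := by rw [hq]; ring
        have hpl := abs_le.mp hpa
        -- `e^x ≤ 1 + x + x²` for `|x| ≤ 1`. The square is at most `2p² + 2q²`, which `p² ≤ 2H² q`
        -- and `q ≤ 1/2` make linear in `q`.
        have h3 := (abs_le.mp (Real.abs_exp_sub_one_sub_id_le (x := -p + q)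
          (abs_le.mpr ⟨by linarith, by linarith⟩))).2
        have h4 : l ^ 2 * (2 * H ^ 2 + 3 / 2) * u x ^ 2 = 2 * q * (2 * H ^ 2 + 3 / 2) := by
          rw [hq]; ring
        rw [h4]
        nlinarith [sq_nonneg (p + q)]
      · have hn : Integrable (fun x => -(l * ((f x - f₀ x) * u x))) volume :=
          (hint2.const_mul l).neg
        rw [integral_add hn (hint.const_mul _), integral_neg,
          integral_const_mul, integral_const_mul]
        have h5 : l * (2 * t) ≤ l * ∫ x, (f x - f₀ x) * u x := by gcongr
        have h6 : l ^ 2 * (2 * H ^ 2 + 3 / 2) * ∫ x, u x ^ 2 ≤ l ^ 2 * (2 * H ^ 2 + 3 / 2) * 1 := by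
          gcongr
        nlinarith [sq_nonneg l]
    calc _ ≤ ENNReal.ofReal (Real.exp (l * t))
          * ENNReal.ofReal (Real.exp (-(2 * l * t) + l ^ 2 * C)) := by
          gcongr
      _ = _ := by
        rw [← ENNReal.ofReal_mul (Real.exp_nonneg _), ← Real.exp_add]
        congr 2
        rw [hl]
        field_simp
        ring

/-! ### The test -/

/-- A maximal `1/2`-separated subset of the unit ball has at most `5^J` points by volume comparison
and is a `1/2`-net. The net point near `v/‖v‖` loses at most half of the inner product. -/
theorem exists_finset_half_le_inner (J : ℕ) : ∃ s : Finset (EuclideanSpace ℝ (Fin J)),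
    s.card ≤ 5 ^ J ∧ (∀ c ∈ s, ‖c‖ ≤ 1) ∧ ∀ v, ∃ c ∈ s, ‖v‖ / 2 ≤ inner ℝ v c := by
  classical
  let E := EuclideanSpace ℝ (Fin J)
  let P : ℕ → Prop := fun n => ∃ s : Finset E, s.card = n ∧ (∀ c ∈ s, ‖c‖ ≤ 1) ∧
    ∀ c ∈ s, ∀ d ∈ s, c ≠ d → 1 / 2 ≤ ‖c - d‖
  have hb : ∀ n, P n → n ≤ 5 ^ J := by
    rintro _ ⟨s, rfl, h1, h2⟩
    -- The packing bound is for `1`-separated points in the ball of radius `2`, hence the scaling by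
    -- `2`.
    have h := Besicovitch.card_le_of_separated (s.image fun c => (2 : ℝ) • c) ?_ ?_
    · rw [Finset.card_image_of_injective _ (smul_right_injective E (two_ne_zero' ℝ))] at h
      simpa [E] using h
    · intro c hc
      obtain ⟨c, hc', rfl⟩ := Finset.mem_image.mp hc
      rw [norm_smul]
      have := h1 c hc'
      norm_num
      linarith
    · intro c hc d hd hcd
      obtain ⟨c, hc', rfl⟩ := Finset.mem_image.mp hc
      obtain ⟨d, hd', rfl⟩ := Finset.mem_image.mp hd
      rw [← smul_sub, norm_smul]
      have := h2 c hc' d hd' (fun h => hcd (by rw [h]))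
      norm_num
      linarith
  have h0 : P 0 := ⟨∅, by simp⟩
  obtain ⟨s, hs, h1, h2⟩ := Nat.findGreatest_spec (P := P) (Nat.zero_le (5 ^ J)) h0
  refine ⟨s, hs ▸ Nat.findGreatest_le _, h1, fun v => ?_⟩
  -- For `v = 0` this is `0`, which still lies in the unit ball, so the net argument needs no
  -- separate case.
  set w : E := ‖v‖⁻¹ • v with hw
  have hw1 : ‖w‖ ≤ 1 := by
    rw [hw, norm_smul, norm_inv, norm_norm]
    exact inv_mul_le_one
  have hex : ∃ c ∈ s, ‖w - c‖ < 1 / 2 := by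
    by_contra! hcon
    have hws : w ∉ s := fun h => by have := hcon w h; norm_num at this
    have hP : P (s.card + 1) := by
      refine ⟨insert w s, Finset.card_insert_of_notMem hws, ?_, ?_⟩
      · intro c hc
        rcases Finset.mem_insert.mp hc with rfl | hc
        · exact hw1
        · exact h1 c hc
      · intro c hc d hd hcd
        rcases Finset.mem_insert.mp hc with rfl | hc <;> rcases Finset.mem_insert.mp hd with rfl | hd
        · exact absurd rfl hcd
        · exact hcon d hd
        · rw [norm_sub_rev]; exact hcon c hc
        · exact h2 c hc d hd hcd
    have := Nat.le_findGreatest (hb _ hP) hP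
    omega
  obtain ⟨c, hc, hwc⟩ := hex
  refine ⟨c, hc, ?_⟩
  have h3 : inner ℝ v c = inner ℝ v w - inner ℝ v (w - c) := by rw [inner_sub_right]; ring
  have h4 : inner ℝ v w = ‖v‖ := by
    rw [hw, inner_smul_right, real_inner_self_eq_norm_sq]
    rcases eq_or_ne ‖v‖ 0 with h | h
    · simp [h]
    · field_simp
  have h5 : inner ℝ v (w - c) ≤ ‖v‖ * (1 / 2) :=
    (real_inner_le_norm _ _).trans (by gcongr)
  rw [h3, h4]
  linarith

/-- The coefficient sequence that starts with the entries of a vector and ends with zeros. -/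
def extendZero {J : ℕ} (c : EuclideanSpace ℝ (Fin J)) (j : ℕ) : ℝ :=
  if h : j < J then c ⟨j, h⟩ else 0

theorem extendZero_of_notMem {J : ℕ} (c : EuclideanSpace ℝ (Fin J)) {j : ℕ}
    (hj : j ∉ Finset.range J) : extendZero c j = 0 := by
  unfold extendZero
  rw [dif_neg (by simpa using hj)]

theorem tsum_mul_extendZero {J : ℕ} (c : EuclideanSpace ℝ (Fin J)) (a : ℕ → ℝ) :
    ∑' j, a j * extendZero c j = ∑ i : Fin J, a i * c i := by
  rw [tsum_eq_sum (s := Finset.range J) (fun j hj => by rw [extendZero_of_notMem c hj, mul_zero]),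
    ← Fin.sum_univ_eq_sum_range (fun j => a j * extendZero c j)]
  refine Finset.sum_congr rfl fun i _ => ?_
  simp [extendZero]

theorem summable_abs_extendZero {J : ℕ} (c : EuclideanSpace ℝ (Fin J)) :
    Summable fun j => |extendZero c j| :=
  summable_of_ne_finset_zero (s := Finset.range J)
    fun j hj => by rw [extendZero_of_notMem c hj, abs_zero]

/-- Cauchy–Schwarz. Through `abs_seriesFun_le` it gives the uniform bound `√2 √J` on the test
directions, the source of the restriction `t √(2J) ≤ 1`. -/
theorem tsum_abs_extendZero_le {J : ℕ} (c : EuclideanSpace ℝ (Fin J)) (hc : ‖c‖ ≤ 1) :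
    ∑' j, |extendZero c j| ≤ √J := by
  rw [tsum_eq_sum (s := Finset.range J) fun j hj => by rw [extendZero_of_notMem c hj, abs_zero],
    ← Fin.sum_univ_eq_sum_range (fun j => |extendZero c j|)]
  have h1 : ∀ i : Fin J, |extendZero c i| = |c i| := fun i => by simp [extendZero]
  simp_rw [h1]
  refine Real.le_sqrt_of_sq_le ?_
  have h2 := sq_sum_le_card_mul_sum_sq (s := (Finset.univ : Finset (Fin J))) (f := fun i => |c i|)
  simp only [Finset.card_univ, Fintype.card_fin, sq_abs] at h2
  have h3 : ∑ i, c i ^ 2 ≤ 1 := by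
    have := EuclideanSpace.real_norm_sq_eq c
    rw [← this]
    exact pow_le_one₀ (norm_nonneg _) hc
  nlinarith [Nat.cast_nonneg (α := ℝ) J]

/-- The test rejects if the linear statistic of some net direction exceeds `nt`; the first error is
a union bound. For the second, one direction suffices: a head difference of norm at least `4t` has
inner product at least `2t` with some net point, and the tail is orthogonal to that direction. -/
theorem exists_test {a₀ : ℕ → ℝ} (ha₀ : Summable fun j => |a₀ j|) (n J : ℕ) {t H : ℝ} (ht : 0 ≤ t)
    (htJ : t * (√2 * √J) ≤ 1) :
    ∃ R : Set (Fin n → unitInterval × ℝ), MeasurableSet R ∧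
      sampleLaw (seriesFun a₀) n R ≤ 5 ^ J * ENNReal.ofReal (Real.exp (-(n * (t ^ 2 / 4)))) ∧
      ∀ a : ℕ → ℝ, (Summable fun j => |a j|) → √2 * ∑' j, |a j - a₀ j| ≤ H →
        (4 * t) ^ 2 ≤ ∑ j ∈ Finset.range J, (a j - a₀ j) ^ 2 →
        ∫⁻ z in Rᶜ, ∏ i, obsRatio (seriesFun a₀) (seriesFun a) (z i) ∂(sampleLaw (seriesFun a₀) n)
          ≤ ENNReal.ofReal (Real.exp (-(n * (t ^ 2 / (4 * (2 * H ^ 2 + 2)))))) := by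
  obtain ⟨s, hcard, hs1, hs⟩ := exists_finset_half_le_inner J
  have hub : ∀ c ∈ s, ∀ x, |seriesFun (extendZero c) x| ≤ √2 * √J := fun c hc x =>
    (abs_seriesFun_le (summable_abs_extendZero c) x).trans
      (by gcongr; exact tsum_abs_extendZero_le c (hs1 c hc))
  have hu2 : ∀ c ∈ s, ∫ x, seriesFun (extendZero c) x ^ 2 ≤ 1 := fun c hc => by
    simp_rw [sq]
    rw [integral_seriesFun_mul (summable_abs_extendZero c) (summable_abs_extendZero c),
      tsum_mul_extendZero]
    have h1 : ∀ i : Fin J, extendZero c i * c i = c i ^ 2 := fun i => by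
      simp [extendZero, sq]
    simp_rw [h1]
    rw [← EuclideanSpace.real_norm_sq_eq c]
    exact pow_le_one₀ (norm_nonneg _) (hs1 c hc)
  refine ⟨⋃ c ∈ s, {z | n * t ≤ linStat (seriesFun a₀) (seriesFun (extendZero c)) z}, ?_, ?_, ?_⟩
  · exact Finset.measurableSet_biUnion _ fun c _ =>
      measurableSet_le measurable_const (by fun_prop)
  · calc _ ≤ ∑ c ∈ s, sampleLaw (seriesFun a₀) n
            {z | n * t ≤ linStat (seriesFun a₀) (seriesFun (extendZero c)) z} :=
          measure_biUnion_finset_le _ _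
      _ ≤ ∑ c ∈ s, ENNReal.ofReal (Real.exp (-(n * (t ^ 2 / 4)))) :=
          Finset.sum_le_sum fun c hc => sampleLaw_linStat_ge_le (by fun_prop) (by fun_prop) n ht
            (hub c hc) (hu2 c hc) htJ
      _ ≤ _ := by
          rw [Finset.sum_const, nsmul_eq_mul]
          gcongr
          exact_mod_cast hcard
  · intro a ha hH hdist
    have hd : Summable fun j => |a j - a₀ j| :=
      Summable.of_nonneg_of_le (fun _ => abs_nonneg _) (fun j => abs_sub _ _) (ha.add ha₀)
    obtain ⟨c, hc, hcv⟩ := hs (WithLp.toLp 2 fun i : Fin J => a i - a₀ i)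
    have hsub : (⋃ c ∈ s, {z : Fin n → unitInterval × ℝ |
        n * t ≤ linStat (seriesFun a₀) (seriesFun (extendZero c)) z})ᶜ
        ⊆ {z | linStat (seriesFun a₀) (seriesFun (extendZero c)) z < n * t} := by
      intro z hz
      simp only [Set.mem_compl_iff, Set.mem_iUnion, not_exists, Set.mem_ofPred_eq, not_le] at hz ⊢
      exact hz c hc
    refine (lintegral_mono_set hsub).trans
      (lintegral_prod_obsRatio_linStat_lt_le (by fun_prop) (by fun_prop) (by fun_prop) n ht
        (hub c hc) (hu2 c hc) htJ (fun x => ?_) ?_)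
    · rw [seriesFun_sub ha ha₀]
      exact (abs_seriesFun_le hd x).trans hH
    · simp_rw [seriesFun_sub ha ha₀]
      rw [integral_seriesFun_mul hd (summable_abs_extendZero c), tsum_mul_extendZero]
      have h1 : inner ℝ (WithLp.toLp 2 fun i : Fin J => a i - a₀ i) c
          = ∑ i : Fin J, (a i - a₀ i) * c i := by
        simp [PiLp.inner_apply, mul_comm]
      rw [← h1]
      refine le_trans ?_ hcv
      have h2 : 4 * t ≤ ‖(WithLp.toLp 2 fun i : Fin J => a i - a₀ i : EuclideanSpace ℝ (Fin J))‖ := by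
        refine le_of_sq_le_sq ?_ (norm_nonneg _)
        rw [EuclideanSpace.real_norm_sq_eq]
        rw [← Fin.sum_univ_eq_sum_range (fun j => (a j - a₀ j) ^ 2)] at hdist
        exact hdist
      linarith

/-! ### Posterior contraction from prior mass and tests -/

/-- Cauchy–Schwarz for `1 = L^{1/2} L^{-1/2}` on `S`. -/
theorem sq_measure_le_lintegral_mul_lintegral_inv {Θ : Type*} [MeasurableSpace Θ] (μ : Measure Θ)
    {L : Θ → ℝ≥0∞} (hL : Measurable L) (h0 : ∀ θ, L θ ≠ 0) (htop : ∀ θ, L θ ≠ ∞) (S : Set Θ) :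
    μ S ^ 2 ≤ (∫⁻ θ in S, L θ ∂μ) * ∫⁻ θ in S, (L θ)⁻¹ ∂μ := by
  have h := ENNReal.lintegral_mul_le_Lp_mul_Lq (μ.restrict S) Real.HolderConjugate.two_two
    (f := fun θ => L θ ^ (1 / 2 : ℝ)) (g := fun θ => (L θ)⁻¹ ^ (1 / 2 : ℝ))
    (hL.pow_const _).aemeasurable (hL.inv.pow_const _).aemeasurable
  have h1 : ∀ θ, ((fun θ => L θ ^ (1 / 2 : ℝ)) * fun θ => (L θ)⁻¹ ^ (1 / 2 : ℝ)) θ = 1 := by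
    intro θ
    rw [Pi.mul_apply, ← ENNReal.mul_rpow_of_nonneg _ _ (by norm_num),
      ENNReal.mul_inv_cancel (h0 θ) (htop θ), ENNReal.one_rpow]
  simp_rw [h1, ← ENNReal.rpow_mul] at h
  norm_num at h
  calc μ S ^ 2 ≤ ((∫⁻ θ in S, L θ ∂μ) ^ (1 / 2 : ℝ) * (∫⁻ θ in S, (L θ)⁻¹ ∂μ) ^ (1 / 2 : ℝ)) ^ 2 :=
        pow_le_pow_left' h 2
    _ = _ := by
        rw [mul_pow, ← ENNReal.rpow_natCast, ← ENNReal.rpow_natCast, ← ENNReal.rpow_mul,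
          ← ENNReal.rpow_mul]
        norm_num

/-- The posterior mass is at most `1` where the test rejects or the evidence bound fails. Elsewhere
the denominator is at least `b μ(S)`, and by Tonelli the numerator has expectation at most `d` times
the total mass plus `μ(Fᶜ)`, as likelihood ratios integrate to at most `1`. -/
theorem lintegral_posterior_le {Θ Z : Type*} [MeasurableSpace Θ] [MeasurableSpace Z]
    (P : Measure Z) [IsProbabilityMeasure P] (μ : Measure Θ) [IsFiniteMeasure μ]
    {L : Θ → Z → ℝ≥0∞} (hL : Measurable (Function.uncurry L)) (h0 : ∀ θ z, L θ z ≠ 0)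
    (htop : ∀ θ z, L θ z ≠ ∞) {S A F : Set Θ} (hA : MeasurableSet A) (hF : MeasurableSet F)
    {R : Set Z} (hR : MeasurableSet R) {b c d : ℝ≥0∞} (hS0 : μ S ≠ 0) (hb0 : b ≠ 0) (hbt : b ≠ ∞)
    (hc : ∀ θ ∈ S, ∫⁻ z, (L θ z)⁻¹ ∂P ≤ c) (hone : ∀ θ, ∫⁻ z, L θ z ∂P ≤ 1)
    (hd : ∀ θ ∈ A, θ ∈ F → ∫⁻ z in Rᶜ, L θ z ∂P ≤ d) (hSm : MeasurableSet S) :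
    ∫⁻ z, (∫⁻ θ in A, L θ z ∂μ) / (∫⁻ θ, L θ z ∂μ) ∂P
      ≤ P R + c * b + (b * μ S)⁻¹ * (d * μ Set.univ + μ Fᶜ) := by
  have hSt : μ S ≠ ∞ := measure_ne_top μ S
  have hLz : ∀ z, Measurable fun θ => L θ z := fun z => hL.comp measurable_prodMk_right
  have hinv : Measurable (Function.uncurry fun θ z => (L θ z)⁻¹) := hL.inv
  have hI : Measurable fun z => ∫⁻ θ in S, (L θ z)⁻¹ ∂μ := hinv.lintegral_prod_left'
  have hN : Measurable fun z => ∫⁻ θ in A, L θ z ∂μ := hL.lintegral_prod_left'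
  -- Off `T`, Cauchy–Schwarz gives `μ(S)² ≤ (∫_S L) μ(S)/b`, which is the evidence bound `b μ(S) ≤
  -- ∫_S L`.
  set T : Set Z := {z | μ S / b ≤ ∫⁻ θ in S, (L θ z)⁻¹ ∂μ} with hT
  have hTm : MeasurableSet T := measurableSet_le measurable_const hI
  have hPT : P T ≤ c * b := by
    have h1 := mul_meas_ge_le_lintegral (μ := P) hI (μ S / b)
    have h2 : ∫⁻ z, ∫⁻ θ in S, (L θ z)⁻¹ ∂μ ∂P ≤ c * μ S := by
      rw [lintegral_lintegral_swap (f := fun z θ => (L θ z)⁻¹)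
        (hinv.comp measurable_swap).aemeasurable]
      calc ∫⁻ θ in S, ∫⁻ z, (L θ z)⁻¹ ∂P ∂μ ≤ ∫⁻ _ in S, c ∂μ :=
            setLIntegral_mono' hSm fun θ hθ => hc θ hθ
        _ = c * μ S := by rw [setLIntegral_const]
    have h3 := h1.trans h2
    have h4 : μ S / b * P T = μ S * (P T / b) := by
      rw [div_eq_mul_inv, div_eq_mul_inv]; ring
    rw [h4, mul_comm c, ENNReal.mul_le_mul_iff_right hS0 hSt] at h3
    rwa [ENNReal.div_le_iff hb0 hbt] at h3
  have hpt : ∀ z, (∫⁻ θ in A, L θ z ∂μ) / (∫⁻ θ, L θ z ∂μ)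
      ≤ R.indicator 1 z + T.indicator 1 z
        + (b * μ S)⁻¹ * Rᶜ.indicator (fun z => ∫⁻ θ in A, L θ z ∂μ) z := by
    intro z
    have hle1 : (∫⁻ θ in A, L θ z ∂μ) / (∫⁻ θ, L θ z ∂μ) ≤ 1 :=
      ENNReal.div_le_of_le_mul (by rw [one_mul]; exact setLIntegral_le_lintegral _ _)
    by_cases hzR : z ∈ R
    · rw [Set.indicator_of_mem hzR, Pi.one_apply, add_assoc]
      exact hle1.trans le_self_add
    by_cases hzT : z ∈ T
    · rw [Set.indicator_of_mem hzT, Pi.one_apply]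
      exact hle1.trans (le_add_self.trans le_self_add)
    rw [Set.indicator_of_mem (show z ∈ Rᶜ from hzR), div_eq_mul_inv, mul_comm]
    refine le_trans ?_ le_add_self
    gcongr
    have h1 : ∫⁻ θ in S, (L θ z)⁻¹ ∂μ < μ S / b := not_le.mp hzT
    have h2 := sq_measure_le_lintegral_mul_lintegral_inv μ (hLz z) (fun θ => h0 θ z)
      (fun θ => htop θ z) S
    refine le_trans ?_ (setLIntegral_le_lintegral S _)
    have h3 : μ S ^ 2 ≤ (∫⁻ θ in S, L θ z ∂μ) * (μ S / b) := h2.trans (by gcongr)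
    rw [div_eq_mul_inv, mul_left_comm, sq, ENNReal.mul_le_mul_iff_right hS0 hSt,
      ← div_eq_mul_inv, ENNReal.le_div_iff_mul_le (Or.inl hb0) (Or.inl hbt)] at h3
    rwa [mul_comm]
  refine (lintegral_mono hpt).trans ?_
  rw [lintegral_add_left (by
      exact (measurable_one.indicator hR).add (measurable_one.indicator hTm)),
    lintegral_add_left (measurable_one.indicator hR), lintegral_indicator_one hR,
    lintegral_indicator_one hTm, lintegral_const_mul _ (hN.indicator hR.compl),
    lintegral_indicator hR.compl]
  gcongr
  rw [lintegral_lintegral_swap (f := fun z θ => L θ z) (hL.comp measurable_swap).aemeasurable]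
  calc ∫⁻ θ in A, ∫⁻ z in Rᶜ, L θ z ∂P ∂μ
      ≤ ∫⁻ θ in A, (d + Fᶜ.indicator 1 θ) ∂μ := by
        refine setLIntegral_mono' hA fun θ hθ => ?_
        by_cases hθF : θ ∈ F
        · exact (hd θ hθ hθF).trans le_self_add
        · rw [Set.indicator_of_mem (show θ ∈ Fᶜ from hθF), Pi.one_apply]
          exact ((setLIntegral_le_lintegral _ _).trans (hone θ)).trans le_add_self
    _ ≤ ∫⁻ θ, (d + Fᶜ.indicator 1 θ) ∂μ := setLIntegral_le_lintegral _ _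
    _ = _ := by
        rw [lintegral_add_left measurable_const, lintegral_const, lintegral_indicator_one hF.compl]

/-! ### Infinite product measures -/

theorem setLIntegral_pi_infinitePi (μ : ℕ → Measure ℝ) [∀ i, IsProbabilityMeasure (μ i)]
    {S : Finset ℕ} {t : ℕ → Set ℝ} (ht : ∀ i, MeasurableSet (t i)) {f : ℝ → ℝ≥0∞}
    (hf : Measurable f) {k : ℕ} (hk : k ∉ S) :
    ∫⁻ x in (S : Set ℕ).pi t, f (x k) ∂(Measure.infinitePi μ)
      = Measure.infinitePi μ ((S : Set ℕ).pi t) * ∫⁻ y, f y ∂(μ k) := by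
  classical
  have hbox : MeasurableSet ((S : Set ℕ).pi t) :=
    MeasurableSet.pi S.countable_toSet fun i _ => ht i
  let X : ℕ → ℝ → ℝ≥0∞ := fun i => if i = k then f else (t i).indicator 1
  have hX : ∀ i, Measurable (X i) := by
    intro i
    by_cases h : i = k
    · simp only [X, if_pos h, hf]
    · simp only [X, if_neg h]
      exact measurable_one.indicator (ht i)
  have h := lintegral_prod_eq_prod_lintegral_of_indepFun (insert k S) _
    (iIndepFun_infinitePi (P := μ) hX) fun i => (hX i).comp (measurable_pi_apply i)
  have heval : ∀ i, ∫⁻ x, X i (x i) ∂(Measure.infinitePi μ) = ∫⁻ y, X i y ∂(μ i) := fun i =>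
    (measurePreserving_eval_infinitePi μ i).lintegral_comp (hX i)
  have hXS : ∀ i ∈ S, X i = (t i).indicator 1 := fun i hi =>
    if_neg (by rintro rfl; exact hk hi)
  have hXk : X k = f := if_pos rfl
  simp_rw [heval, Finset.prod_insert hk, hXk] at h
  rw [Finset.prod_congr rfl fun i hi => by rw [hXS i hi, lintegral_indicator_one (ht i)],
    ← Measure.infinitePi_pi μ (fun i _ => ht i), mul_comm (∫⁻ y, f y ∂(μ k))] at h
  rw [← h, ← lintegral_indicator hbox]
  refine lintegral_congr fun x => ?_
  rw [Finset.prod_congr rfl fun i hi => by rw [hXS i hi]]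
  by_cases hx : x ∈ (S : Set ℕ).pi t
  · rw [Set.indicator_of_mem hx, Finset.prod_eq_one, mul_one]
    intro i hi
    rw [Set.indicator_of_mem (hx i hi), Pi.one_apply]
  · rw [Set.indicator_of_notMem hx]
    obtain ⟨i, hi, hit⟩ : ∃ i ∈ S, x i ∉ t i := by simpa [Set.pi] using hx
    rw [Finset.prod_eq_zero hi (Set.indicator_of_notMem hit _), mul_zero]

/-- A box event has large conditional probability given that a sum of functions of the other
coordinates, with small mean, is small. -/
theorem half_prod_le_infinitePi_pi_inter (μ : ℕ → Measure ℝ) [∀ i, IsProbabilityMeasure (μ i)]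
    {S : Finset ℕ} {t : ℕ → Set ℝ} (ht : ∀ i, MeasurableSet (t i)) {f : ℕ → ℝ → ℝ≥0∞}
    (hf : ∀ j, Measurable (f j)) {κ : ℕ → ℕ} (hκ : ∀ j, κ j ∈ S → f j = 0) {τ : ℝ≥0∞}
    (hτ0 : τ ≠ 0) (hτ : τ ≠ ∞) (hmean : ∑' j, ∫⁻ y, f j y ∂(μ (κ j)) ≤ τ / 2) :
    (∏ i ∈ S, μ i (t i)) / 2
      ≤ Measure.infinitePi μ ((S : Set ℕ).pi t ∩ {x | ∑' j, f j (x (κ j)) ≤ τ}) := by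
  set ν := Measure.infinitePi μ
  set box := (S : Set ℕ).pi t with hboxdef
  have hbox : MeasurableSet box := MeasurableSet.pi S.countable_toSet fun i _ => ht i
  have hνbox : ν box = ∏ i ∈ S, μ i (t i) := Measure.infinitePi_pi μ fun i _ => ht i
  rw [← hνbox]
  -- Each summand need only be independent of the box, not of the other summands. So many `j` may
  -- share one coordinate `κ j`, as all indices of a block share `A_k`.
  have hsum : ∫⁻ x in box, ∑' j, f j (x (κ j)) ∂ν ≤ ν box * (τ / 2) := by
    rw [lintegral_tsum (f := fun j (x : ℕ → ℝ) => f j (x (κ j)))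
      fun j => ((hf j).comp (measurable_pi_apply (κ j))).aemeasurable]
    calc ∑' j, ∫⁻ x in box, f j (x (κ j)) ∂ν = ∑' j, ν box * ∫⁻ y, f j y ∂(μ (κ j)) := by
          refine tsum_congr fun j => ?_
          by_cases hj : κ j ∈ S
          · simp [hκ j hj]
          · exact setLIntegral_pi_infinitePi μ ht (hf j) hj
      _ = ν box * ∑' j, ∫⁻ y, f j y ∂(μ (κ j)) := ENNReal.tsum_mul_left
      _ ≤ _ := by gcongr
  have hm : Measurable fun x : ℕ → ℝ => ∑' j, f j (x (κ j)) :=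
    Measurable.tsum fun j => (hf j).comp (measurable_pi_apply (κ j))
  have hmk := mul_meas_ge_le_lintegral (μ := ν.restrict box) hm τ
  rw [Measure.restrict_apply (measurableSet_le measurable_const hm)] at hmk
  have h1 : ν ({x | τ ≤ ∑' j, f j (x (κ j))} ∩ box) ≤ ν box / 2 := by
    have h2 : τ * ν ({x | τ ≤ ∑' j, f j (x (κ j))} ∩ box) ≤ τ * (ν box / 2) := by
      refine (hmk.trans hsum).trans_eq ?_
      rw [div_eq_mul_inv, div_eq_mul_inv]; ring
    rwa [ENNReal.mul_le_mul_iff_right hτ0 hτ] at h2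
  have h3 : ν box ≤ ν (box ∩ {x | ∑' j, f j (x (κ j)) ≤ τ}) + ν box / 2 := by
    calc ν box ≤ ν ((box ∩ {x | ∑' j, f j (x (κ j)) ≤ τ})
          ∪ ({x | τ ≤ ∑' j, f j (x (κ j))} ∩ box)) := by
          refine measure_mono fun x hx => ?_
          rcases le_total (∑' j, f j (x (κ j))) τ with h | h
          · exact Or.inl ⟨hx, h⟩
          · exact Or.inr ⟨h, hx⟩
      _ ≤ _ := (measure_union_le _ _).trans (by gcongr)
  have h4 : ν box / 2 + ν box / 2 ≤ ν (box ∩ {x | ∑' j, f j (x (κ j)) ≤ τ}) + ν box / 2 := by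
    rwa [ENNReal.add_halves]
  exact (ENNReal.add_le_add_iff_right
    (ENNReal.div_ne_top (measure_ne_top ν box) two_ne_zero)).mp h4

/-! ### Standard normal bounds -/

/-- Against the `N(0,1)` density, `e^{z²/4}` is `√2` times the `N(0,2)` density. This moment gives
both the first absolute moment and the tail bound below. -/
theorem lintegral_exp_sq_div_four :
    ∫⁻ z, ENNReal.ofReal (Real.exp (z ^ 2 / 4)) ∂(gaussianReal 0 1) = ENNReal.ofReal √2 := by
  rw [gaussianReal_of_var_ne_zero _ one_ne_zero,
    lintegral_withDensity_eq_lintegral_mul _ (measurable_gaussianPDF _ _) (by fun_prop)]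
  have h : ∀ z : ℝ, (gaussianPDF 0 1 * fun z => ENNReal.ofReal (Real.exp (z ^ 2 / 4))) z
      = ENNReal.ofReal √2 * gaussianPDF 0 2 z := by
    intro z
    simp only [Pi.mul_apply, gaussianPDF, gaussianPDFReal]
    rw [← ENNReal.ofReal_mul (by positivity), ← ENNReal.ofReal_mul (by positivity), mul_assoc,
      ← Real.exp_add]
    congr 1
    have h1 : √(2 * Real.pi * ((2 : ℝ≥0) : ℝ)) = √2 * √(2 * Real.pi * ((1 : ℝ≥0) : ℝ)) := by
      rw [← Real.sqrt_mul (by norm_num)]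
      congr 1
      push_cast
      ring
    have h2 : √2 ≠ 0 := by positivity
    rw [h1, mul_inv, ← mul_assoc, ← mul_assoc, mul_inv_cancel₀ h2, one_mul]
    congr 2
    push_cast
    ring
  simp_rw [h]
  rw [lintegral_const_mul _ (measurable_gaussianPDF _ _),
    lintegral_gaussianPDF_eq_one _ two_ne_zero, mul_one]

theorem ofReal_sqrt_two_le : ENNReal.ofReal √2 ≤ 2 := by
  rw [← ENNReal.ofReal_ofNat]
  exact ENNReal.ofReal_le_ofReal (Real.sqrt_le_iff.mpr ⟨by norm_num, by norm_num⟩)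

theorem lintegral_abs_gaussianReal_le :
    ∫⁻ z, ENNReal.ofReal |z| ∂(gaussianReal 0 1) ≤ 2 := by
  refine le_trans (lintegral_mono fun z => ENNReal.ofReal_le_ofReal ?_)
    (lintegral_exp_sq_div_four.trans_le ofReal_sqrt_two_le)
  have h1 := Real.add_one_le_exp (z ^ 2 / 4)
  have h2 := sq_nonneg (|z| - 2)
  have h3 := sq_abs z
  nlinarith

theorem gaussianReal_abs_gt_le {r : ℝ} (hr : 0 ≤ r) :
    gaussianReal 0 1 {z | r < |z|} ≤ 2 * ENNReal.ofReal (Real.exp (-(r ^ 2 / 4))) := by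
  have h := mul_meas_ge_le_lintegral (μ := gaussianReal 0 1)
    (f := fun z => ENNReal.ofReal (Real.exp (z ^ 2 / 4))) (by fun_prop)
    (ENNReal.ofReal (Real.exp (r ^ 2 / 4)))
  rw [lintegral_exp_sq_div_four] at h
  have hsub : {z : ℝ | r < |z|} ⊆ {z | ENNReal.ofReal (Real.exp (r ^ 2 / 4))
      ≤ ENNReal.ofReal (Real.exp (z ^ 2 / 4))} := by
    intro z hz
    refine ENNReal.ofReal_le_ofReal (Real.exp_le_exp.mpr ?_)
    have h1 : r < |z| := hz
    have := sq_abs z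
    nlinarith
  have h1 : ENNReal.ofReal (Real.exp (-(r ^ 2 / 4))) * ENNReal.ofReal (Real.exp (r ^ 2 / 4)) = 1 := by
    rw [← ENNReal.ofReal_mul (Real.exp_nonneg _), ← Real.exp_add]
    simp
  calc gaussianReal 0 1 {z | r < |z|}
      ≤ gaussianReal 0 1 {z | ENNReal.ofReal (Real.exp (r ^ 2 / 4))
          ≤ ENNReal.ofReal (Real.exp (z ^ 2 / 4))} := measure_mono hsub
    _ = ENNReal.ofReal (Real.exp (-(r ^ 2 / 4))) * (ENNReal.ofReal (Real.exp (r ^ 2 / 4))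
        * gaussianReal 0 1 {z | ENNReal.ofReal (Real.exp (r ^ 2 / 4))
          ≤ ENNReal.ofReal (Real.exp (z ^ 2 / 4))}) := by
        rw [← mul_assoc, h1, one_mul]
    _ ≤ ENNReal.ofReal (Real.exp (-(r ^ 2 / 4))) * 2 := by
        gcongr
        exact h.trans ofReal_sqrt_two_le
    _ = _ := mul_comm _ _

/-- Interval length times the least density. The event is an interval of length `2δ/√a`, bounded
below through `hi`; on it `a z² ≤ 2(h² + δ²)`, so the Gaussian exponent is controlled through `lo`.
The bound is uniform over the variance window. -/
theorem exp_neg_le_gaussianReal_abs_sub_le {a lo hi h δ : ℝ} (hlo : 0 < lo) (ha1 : lo ≤ a)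
    (ha2 : a ≤ hi) (hδ : 0 < δ) :
    ENNReal.ofReal (δ / √hi * Real.exp (-(1 + (h ^ 2 + δ ^ 2) / lo)))
      ≤ gaussianReal 0 1 {z | |√a * z - h| ≤ δ} := by
  have ha : 0 < a := hlo.trans_le ha1
  have hsa : 0 < √a := Real.sqrt_pos.mpr ha
  have hset : {z | |√a * z - h| ≤ δ} = Set.Icc ((h - δ) / √a) ((h + δ) / √a) := by
    ext z
    rw [Set.mem_ofPred_eq, abs_le, Set.mem_Icc, div_le_iff₀ hsa, le_div_iff₀ hsa, mul_comm z]
    constructor <;> rintro ⟨h1, h2⟩ <;> constructor <;> linarith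
  rw [gaussianReal_apply _ one_ne_zero, hset]
  set m : ℝ := (√(2 * Real.pi))⁻¹ * Real.exp (-((h ^ 2 + δ ^ 2) / lo)) with hm
  have hlow : ∀ z ∈ Set.Icc ((h - δ) / √a) ((h + δ) / √a),
      ENNReal.ofReal m ≤ gaussianPDF 0 1 z := by
    intro z hz
    rw [← hset, Set.mem_ofPred_eq] at hz
    unfold gaussianPDF gaussianPDFReal
    refine ENNReal.ofReal_le_ofReal ?_
    simp only [NNReal.coe_one, mul_one, sub_zero]
    rw [hm]
    gcongr
    have h1 : (√a * z) ^ 2 ≤ 2 * (h ^ 2 + δ ^ 2) := by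
      have h2 : (√a * z - h) ^ 2 ≤ δ ^ 2 := by
        rw [← sq_abs]; exact pow_le_pow_left₀ (abs_nonneg _) hz 2
      nlinarith [sq_nonneg (√a * z - 2 * h)]
    rw [mul_pow, Real.sq_sqrt ha.le] at h1
    have h3 : z ^ 2 / 2 ≤ (h ^ 2 + δ ^ 2) / lo := by
      rw [le_div_iff₀ hlo]
      nlinarith [sq_nonneg z]
    linarith
  calc ENNReal.ofReal (δ / √hi * Real.exp (-(1 + (h ^ 2 + δ ^ 2) / lo)))
      ≤ ENNReal.ofReal (m * (2 * δ / √a)) := by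
        refine ENNReal.ofReal_le_ofReal ?_
        have h1 : δ / √hi ≤ δ / √a := by gcongr
        have h2 : Real.exp (-1) ≤ (√(2 * Real.pi))⁻¹ * 2 := by
          have h3 : √(2 * Real.pi) ≤ 3 :=
            Real.sqrt_le_iff.mpr ⟨by norm_num, by nlinarith [Real.pi_lt_d2]⟩
          have h4 : (0 : ℝ) < √(2 * Real.pi) := by positivity
          have h5 : (2 : ℝ) ≤ Real.exp 1 := by linarith [Real.add_one_le_exp (1 : ℝ)]
          rw [Real.exp_neg, inv_mul_eq_div, inv_eq_one_div, div_le_div_iff₀ (Real.exp_pos _) h4]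
          linarith
        calc δ / √hi * Real.exp (-(1 + (h ^ 2 + δ ^ 2) / lo))
            = δ / √hi * (Real.exp (-1) * Real.exp (-((h ^ 2 + δ ^ 2) / lo))) := by
              rw [← Real.exp_add]; ring_nf
          _ ≤ δ / √a * ((√(2 * Real.pi))⁻¹ * 2 * Real.exp (-((h ^ 2 + δ ^ 2) / lo))) := by
              gcongr
          _ = _ := by rw [hm]; ring
    _ = ∫⁻ _ in Set.Icc ((h - δ) / √a) ((h + δ) / √a), ENNReal.ofReal m := by
        rw [setLIntegral_const, Real.volume_Icc, ← ENNReal.ofReal_mul (by positivity)]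
        congr 2
        ring
    _ ≤ _ := setLIntegral_mono' measurableSet_Icc hlow

/-! ### Blocks -/

/-- The number of coefficients in the blocks `B_0, …, B_{K-1}`. -/
def headSize (K : ℕ) : ℕ := blockStart K - 1

theorem headSize_add_one (K : ℕ) : headSize K + 1 = blockStart K :=
  Nat.sub_add_cancel (by have := lt_blockStart K; omega)

/-- Position `j` carries the coefficient with index `j + 1`, hence the shift. -/
theorem lt_headSize_iff {j K : ℕ} : j < headSize K ↔ blockIndex (j + 1) < K := by
  obtain ⟨h1, h2⟩ := (blockIndex_eq_iff (show 1 ≤ j + 1 by omega) _).mp rfl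
  have h3 := headSize_add_one K
  constructor
  · intro h
    by_contra! hK
    have := blockStart_mono hK
    omega
  · intro h
    have := blockStart_mono (show blockIndex (j + 1) + 1 ≤ K from h)
    omega

theorem headSize_le_exp (K : ℕ) : (headSize K : ℝ) ≤ Real.exp K := by
  have h1 : (headSize K : ℝ) ≤ blockStart K := by
    exact_mod_cast (Nat.sub_le _ _)
  exact h1.trans (Nat.floor_le (Real.exp_nonneg _))

theorem exp_le_two_mul_blockStart (K : ℕ) : Real.exp K ≤ 2 * (blockStart K : ℝ) := by
  have h1 : Real.exp K < blockStart K + 1 := Nat.lt_floor_add_one _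
  have h2 : (1 : ℝ) ≤ blockStart K := by
    exact_mod_cast (show 1 ≤ blockStart K by have := lt_blockStart K; omega)
  linarith

theorem exp_le_two_mul_headSize_add_one (K : ℕ) :
    Real.exp K ≤ 2 * ((headSize K : ℝ) + 1) := by
  have := exp_le_two_mul_blockStart K
  rw [← headSize_add_one] at this
  exact_mod_cast this

theorem exp_blockIndex_le (j : ℕ) :
    Real.exp (blockIndex (j + 1)) ≤ 2 * ((j : ℝ) + 1) := by
  obtain ⟨h1, -⟩ := (blockIndex_eq_iff (show 1 ≤ j + 1 by omega) _).mp rfl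
  have h2 : (blockStart (blockIndex (j + 1)) : ℝ) ≤ (j : ℝ) + 1 := by exact_mod_cast h1
  linarith [exp_le_two_mul_blockStart (blockIndex (j + 1))]

theorem add_one_le_exp_blockIndex (j : ℕ) :
    (j : ℝ) + 1 ≤ Real.exp ((blockIndex (j + 1) : ℝ) + 1) := by
  obtain ⟨-, h2⟩ := (blockIndex_eq_iff (show 1 ≤ j + 1 by omega) _).mp rfl
  have h3 : ((j + 1 : ℕ) : ℝ) ≤ blockStart (blockIndex (j + 1) + 1) := by exact_mod_cast h2.le
  have h4 : (blockStart (blockIndex (j + 1) + 1) : ℝ)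
      ≤ Real.exp ((blockIndex (j + 1) + 1 : ℕ) : ℝ) := Nat.floor_le (Real.exp_nonneg _)
  push_cast at h3 h4
  exact h3.trans h4

/-- Since block sizes grow geometrically, most coefficients lie within boundedly many blocks of the
last one. The small-ball cost of the blocks is thus of order `e^K` and not `K e^K`, which saves the
logarithm in the rate. -/
theorem sum_sub_blockIndex_le (K : ℕ) :
    ∑ j ∈ Finset.range (headSize K), ((K : ℝ) - blockIndex (j + 1)) ≤ 2 * Real.exp K := by
  induction K with
  | zero => simp [headSize, blockStart_zero]
  | succ K ih =>
    have hle : headSize K ≤ headSize (K + 1) := Nat.sub_le_sub_right (blockStart_mono (by omega)) 1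
    have h1 : ∑ j ∈ Finset.range (headSize (K + 1)), (((K + 1 : ℕ) : ℝ) - blockIndex (j + 1))
        = ∑ j ∈ Finset.range (headSize (K + 1)), ((K : ℝ) - blockIndex (j + 1))
          + headSize (K + 1) := by
      push_cast
      simp_rw [add_sub_right_comm]
      rw [Finset.sum_add_distrib]
      simp
    have h2 : ∑ j ∈ Finset.range (headSize (K + 1)), ((K : ℝ) - blockIndex (j + 1))
        = ∑ j ∈ Finset.range (headSize K), ((K : ℝ) - blockIndex (j + 1)) := by
      refine (Finset.sum_subset (Finset.range_mono hle) fun j hj hj' => ?_).symm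
      rw [Finset.mem_range, lt_headSize_iff] at hj hj'
      rw [show blockIndex (j + 1) = K by omega, sub_self]
    rw [h1, h2]
    have h3 := headSize_le_exp (K + 1)
    have h4 : Real.exp ((K + 1 : ℕ) : ℝ) = Real.exp K * Real.exp 1 := by
      rw [← Real.exp_add]; push_cast; rfl
    have h5 : (2 : ℝ) ≤ Real.exp 1 := by linarith [Real.add_one_le_exp (1 : ℝ)]
    nlinarith [Real.exp_pos (K : ℝ)]

theorem sum_exp_range_le (K : ℕ) : ∑ k ∈ Finset.range K, Real.exp k ≤ Real.exp K := by
  induction K with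
  | zero => simp
  | succ K ih =>
    rw [Finset.sum_range_succ]
    have h4 : Real.exp ((K + 1 : ℕ) : ℝ) = Real.exp K * Real.exp 1 := by
      rw [← Real.exp_add]; push_cast; rfl
    have h5 : (2 : ℝ) ≤ Real.exp 1 := by linarith [Real.add_one_le_exp (1 : ℝ)]
    nlinarith [Real.exp_pos (K : ℝ)]

/-- An index in block `k` is at most `e^{k+1}`, and `e^{-ck²}` beats every `e^{-pk}`; the constant
comes from the maximum `p²/(4c)` of `pk - ck²`. -/
theorem exists_exp_neg_sq_blockIndex_le {c p : ℝ} (hc : 0 < c) (hp : 0 ≤ p) :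
    ∃ D : ℝ, 0 < D ∧ ∀ j : ℕ,
      Real.exp (-c * (blockIndex (j + 1) : ℝ) ^ 2) ≤ D * ((j : ℝ) + 1) ^ (-p) := by
  refine ⟨Real.exp (p + p ^ 2 / (4 * c)), Real.exp_pos _, fun j => ?_⟩
  set k : ℝ := (blockIndex (j + 1) : ℝ)
  have h1 : Real.exp (-p * (k + 1)) ≤ ((j : ℝ) + 1) ^ (-p) := by
    have h2 : Real.exp (-p * (k + 1)) = Real.exp (k + 1) ^ (-p) := by
      rw [← Real.exp_mul]; ring_nf
    rw [h2]
    exact Real.rpow_le_rpow_of_nonpos (by positivity) (add_one_le_exp_blockIndex j) (by linarith)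
  refine le_trans ?_ (mul_le_mul_of_nonneg_left h1 (Real.exp_nonneg _))
  rw [← Real.exp_add, Real.exp_le_exp]
  have h3 : p * k ≤ p ^ 2 / (4 * c) + c * k ^ 2 := by
    have : p ^ 2 / (4 * c) + c * k ^ 2 - p * k = (p - 2 * c * k) ^ 2 / (4 * c) := by
      field_simp; ring
    have h4 : 0 ≤ (p - 2 * c * k) ^ 2 / (4 * c) := by positivity
    linarith
  linarith

/-- Of the three spare powers, two make the series converge and one yields a factor `e^{-K}`, which
absorbs `D` and all other constants into `ε`. -/
theorem eventually_tsum_tail_rpow_le {p D ε : ℝ} (hp : 0 ≤ p) (hD : 0 ≤ D) (hε : 0 < ε) :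
    ∀ᶠ K : ℕ in atTop, ∑' j : ℕ, (if j < headSize K then 0 else
      ENNReal.ofReal (D * ((j : ℝ) + 1) ^ (-(p + 3)))) ≤ ENNReal.ofReal (ε * Real.exp (-(p * K))) := by
  have hsum : Summable fun j : ℕ => ((j : ℝ) + 1) ^ (-2 : ℝ) := by
    have := (summable_nat_add_iff 1).mpr (Real.summable_nat_rpow.mpr (show (-2 : ℝ) < -1 by norm_num))
    simpa using this
  set Z := ∑' j : ℕ, ((j : ℝ) + 1) ^ (-2 : ℝ)
  have hZ : 0 ≤ Z := tsum_nonneg fun j => by positivity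
  have hlim : Tendsto (fun K : ℕ => D * 2 ^ (p + 1) * Z * Real.exp (-(K : ℝ))) atTop (𝓝 0) := by
    have h := (Real.tendsto_exp_neg_atTop_nhds_zero.comp tendsto_natCast_atTop_atTop).const_mul
      (D * 2 ^ (p + 1) * Z)
    rw [mul_zero] at h
    exact h
  filter_upwards [hlim.eventually (eventually_le_nhds hε)] with K hK
  have hterm : ∀ j : ℕ, (if j < headSize K then 0 else
      ENNReal.ofReal (D * ((j : ℝ) + 1) ^ (-(p + 3))))
      ≤ ENNReal.ofReal (D * (2 ^ (p + 1) * Real.exp (-((p + 1) * K))) * ((j : ℝ) + 1) ^ (-2 : ℝ)) := by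
    intro j
    split_ifs with hj
    · exact zero_le
    refine ENNReal.ofReal_le_ofReal ?_
    have hj1 : (0 : ℝ) < (j : ℝ) + 1 := by positivity
    rw [show -(p + 3) = -(p + 1) + -2 by ring, Real.rpow_add hj1, mul_assoc D]
    gcongr
    have h1 : Real.exp K / 2 ≤ (j : ℝ) + 1 := by
      have h2 := exp_le_two_mul_headSize_add_one K
      have h3 : (headSize K : ℝ) ≤ j := by exact_mod_cast not_lt.mp hj
      linarith
    calc ((j : ℝ) + 1) ^ (-(p + 1)) ≤ (Real.exp K / 2) ^ (-(p + 1)) :=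
          Real.rpow_le_rpow_of_nonpos (by positivity) h1 (by linarith)
      _ = _ := by
        rw [Real.div_rpow (Real.exp_nonneg _) (by norm_num), ← Real.exp_mul,
          Real.rpow_neg (by norm_num : (0 : ℝ) ≤ 2), div_inv_eq_mul, mul_comm]
        ring_nf
  calc _ ≤ ∑' j : ℕ, ENNReal.ofReal
        (D * (2 ^ (p + 1) * Real.exp (-((p + 1) * K))) * ((j : ℝ) + 1) ^ (-2 : ℝ)) :=
        ENNReal.tsum_le_tsum hterm
    _ = ENNReal.ofReal (D * (2 ^ (p + 1) * Real.exp (-((p + 1) * K))) * Z) := by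
        rw [← ENNReal.ofReal_tsum_of_nonneg (fun j => by positivity) (hsum.mul_left _),
          tsum_mul_left]
    _ ≤ _ := by
        refine ENNReal.ofReal_le_ofReal ?_
        calc D * (2 ^ (p + 1) * Real.exp (-((p + 1) * K))) * Z
            = D * 2 ^ (p + 1) * Z * Real.exp (-(K : ℝ)) * Real.exp (-(p * K)) := by
              rw [show -((p + 1) * (K : ℝ)) = -(K : ℝ) + -(p * K) by ring, Real.exp_add]; ring
          _ ≤ _ := by gcongr

theorem tsum_ofReal_exp_neg_le {c x : ℝ} (hc : 0 < c) :
    ∑' i : ℕ, ENNReal.ofReal (Real.exp (-c * (x + i)))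
      ≤ ENNReal.ofReal ((1 - Real.exp (-c))⁻¹ * Real.exp (-c * x)) := by
  have h1 : ∀ i : ℕ, Real.exp (-c * (x + i)) = Real.exp (-c * x) * Real.exp (-c) ^ i := fun i => by
    rw [← Real.exp_nat_mul, ← Real.exp_add]; ring_nf
  have hlt : Real.exp (-c) < 1 := Real.exp_lt_one_iff.mpr (by linarith)
  simp_rw [h1]
  rw [← ENNReal.ofReal_tsum_of_nonneg (fun i => by positivity)
    ((summable_geometric_of_lt_one (Real.exp_nonneg _) hlt).mul_left _), tsum_mul_left,
    tsum_geometric_of_lt_one (Real.exp_nonneg _) hlt, mul_comm]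

/-! ### The mixing laws -/

theorem isProbabilityMeasure_mixingLaw {g : ℝ → ℝ} (hg : IsPosDensity g) :
    IsProbabilityMeasure (mixingLaw g) :=
  ⟨by rw [mixingLaw, withDensity_apply _ MeasurableSet.univ, Measure.restrict_univ]
      exact hg.total⟩

theorem mixingLaw_apply (g : ℝ → ℝ) {s : Set ℝ} (hs : MeasurableSet s) :
    mixingLaw g s = ∫⁻ t in s ∩ Set.Ioi 0, ENNReal.ofReal (g t) := by
  rw [mixingLaw, withDensity_apply _ hs, Measure.restrict_restrict hs]

/-- Integrates `√t ≤ t/s + s`; the free parameter `s` is balanced against the mean later. -/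
theorem lintegral_sqrt_mixingLaw_le {g : ℝ → ℝ} (hg : IsPosDensity g) {s m : ℝ} (hs : 0 < s)
    (hm0 : 0 ≤ m)
    (hm : ∫⁻ t in Set.Ioi (0 : ℝ), ENNReal.ofReal (t * g t) ≤ ENNReal.ofReal m) :
    ∫⁻ a, ENNReal.ofReal √a ∂(mixingLaw g) ≤ ENNReal.ofReal (m / s + s) := by
  have hgm : Measurable fun t => ENNReal.ofReal (g t) := hg.measurable.ennreal_ofReal
  rw [mixingLaw, lintegral_withDensity_eq_lintegral_mul _ hgm (by fun_prop)]
  calc ∫⁻ t in Set.Ioi 0, ((fun t => ENNReal.ofReal (g t)) * fun a => ENNReal.ofReal √a) t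
      ≤ ∫⁻ t in Set.Ioi 0, (ENNReal.ofReal s⁻¹ * ENNReal.ofReal (t * g t)
          + ENNReal.ofReal s * ENNReal.ofReal (g t)) := by
        refine setLIntegral_mono' measurableSet_Ioi fun t ht => ?_
        have ht0 : 0 < t := ht
        have hgt := hg.nonneg t ht0
        rw [Pi.mul_apply, ← ENNReal.ofReal_mul hgt, ← ENNReal.ofReal_mul (by positivity),
          ← ENNReal.ofReal_mul hs.le, ← ENNReal.ofReal_add (by positivity) (by positivity)]
        refine ENNReal.ofReal_le_ofReal ?_
        have h1 : √t ≤ s⁻¹ * t + s := by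
          have h2 := Real.sq_sqrt ht0.le
          have h3 : s * √t ≤ t + s * s := by nlinarith [sq_nonneg (√t - s), Real.sqrt_nonneg t]
          calc √t = s⁻¹ * (s * √t) := by field_simp
            _ ≤ s⁻¹ * (t + s * s) := by gcongr
            _ = _ := by field_simp
        calc g t * √t ≤ g t * (s⁻¹ * t + s) := by gcongr
          _ = _ := by ring
    _ = ENNReal.ofReal s⁻¹ * (∫⁻ t in Set.Ioi 0, ENNReal.ofReal (t * g t)) + ENNReal.ofReal s := by
        have hg1 := hg.measurable
        rw [lintegral_add_left (by fun_prop), lintegral_const_mul _ (by fun_prop),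
          lintegral_const_mul _ hgm, hg.total, mul_one]
    _ ≤ ENNReal.ofReal s⁻¹ * ENNReal.ofReal m + ENNReal.ofReal s := by gcongr
    _ = _ := by
        rw [← ENNReal.ofReal_mul (by positivity), ← ENNReal.ofReal_add (by positivity) hs.le]
        congr 1
        field_simp

theorem IsMixingClass.exists_lintegral_sqrt_le {g : ℕ → ℝ → ℝ} (hg : IsMixingClass g) :
    ∃ c : ℝ, 0 < c ∧ ∀ k : ℕ, ∫⁻ a, ENNReal.ofReal √a ∂(mixingLaw (g k))
      ≤ ENNReal.ofReal (5 * Real.exp (-c * (k : ℝ) ^ 2)) := by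
  obtain ⟨c₂, hc₂, h⟩ := hg.mean
  refine ⟨c₂ / 2, by positivity, fun k => ?_⟩
  -- With `s = e^{-c₂k²/2}` both terms are multiples of `e^{-c₂k²/2}`, and the constants are `4 +
  -- 1`.
  refine (lintegral_sqrt_mixingLaw_le (hg.density k) (Real.exp_pos (-(c₂ / 2) * (k : ℝ) ^ 2))
    (by positivity) (h k)).trans_eq ?_
  congr 1
  rw [mul_div_assoc, ← Real.exp_sub]
  ring_nf

theorem IsMixingClass.exists_mixingLaw_Ioi_le {g : ℕ → ℝ → ℝ} (hg : IsMixingClass g) :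
    ∃ c : ℝ, 0 < c ∧ ∀ k : ℕ, mixingLaw (g k) (Set.Ioi (Real.exp (-(k : ℝ) ^ 2)))
      ≤ ENNReal.ofReal (Real.exp (-c * Real.exp k)) := by
  obtain ⟨c₃, hc₃, h⟩ := hg.tail
  refine ⟨c₃, hc₃, fun k => ?_⟩
  rw [mixingLaw_apply _ measurableSet_Ioi, Set.inter_eq_left.mpr
    (Set.Ioi_subset_Ioi (Real.exp_nonneg _))]
  exact h k

/-- Continuity of measure along intervals that exhaust `(0, ∞)`. It serves the finitely many blocks
where the lower bound on `g_k` need not reach the required variance. -/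
theorem IsPosDensity.exists_le_mixingLaw_Icc {g : ℝ → ℝ} (hg : IsPosDensity g) (r : ℝ) :
    ∃ C : ℝ, 0 < C ∧ ENNReal.ofReal (Real.exp (-C))
      ≤ mixingLaw g (Set.Icc (Real.exp (-C - r)) (Real.exp (C - r))) := by
  have hp := isProbabilityMeasure_mixingLaw hg
  let I : ℕ → Set ℝ := fun n => Set.Icc (Real.exp (-(n : ℝ) - r)) (Real.exp ((n : ℝ) - r))
  have hmono : Monotone I := fun m n hmn => by
    have : (m : ℝ) ≤ n := by exact_mod_cast hmn
    exact Set.Icc_subset_Icc (Real.exp_le_exp.mpr (by linarith))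
      (Real.exp_le_exp.mpr (by linarith))
  have hU : ⋃ n, I n = Set.Ioi 0 := by
    ext t
    simp only [Set.mem_iUnion, I, Set.mem_Icc, Set.mem_Ioi]
    constructor
    · rintro ⟨n, h, -⟩
      exact (Real.exp_pos _).trans_le h
    · intro ht
      obtain ⟨n, hn⟩ := exists_nat_ge |Real.log t + r|
      have hn' := abs_le.mp hn
      refine ⟨n, ?_, ?_⟩
      · rw [← Real.le_log_iff_exp_le ht]; linarith [hn'.1]
      · rw [← Real.log_le_iff_le_exp ht]; linarith [hn'.2]
  have hfull : mixingLaw g (Set.Ioi 0) = 1 := by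
    rw [mixingLaw_apply _ measurableSet_Ioi, Set.inter_self]
    exact hg.total
  have hlim := tendsto_measure_iUnion_atTop (μ := mixingLaw g) hmono
  rw [hU, hfull] at hlim
  obtain ⟨n, hn, hn1⟩ := ((hlim.eventually (lt_mem_nhds (show ENNReal.ofReal (Real.exp (-1)) < 1 by
    rw [ENNReal.ofReal_lt_one]
    exact Real.exp_lt_one_iff.mpr (by norm_num)))).and (eventually_ge_atTop 1)).exists
  have hn1' : (1 : ℝ) ≤ n := by exact_mod_cast hn1
  exact ⟨n, by linarith, le_trans (ENNReal.ofReal_le_ofReal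
    (Real.exp_le_exp.mpr (by linarith))) hn.le⟩

/-- For late blocks `[e^{-1-sk}, e^{-sk}]` lies where `g_k ≥ exp(-c₁e^k)`, and its length
`e^{-O(k)}` costs little against `exp(-e^k)`. Later `s = 2α + 1`; this is where the prior adapts to
any `α`. -/
theorem IsMixingClass.exists_le_mixingLaw_Icc {g : ℕ → ℝ → ℝ} (hg : IsMixingClass g) {s : ℝ}
    (hs : 1 ≤ s) : ∃ C : ℝ, 0 < C ∧ ∀ k : ℕ, ENNReal.ofReal (Real.exp (-(C * Real.exp k)))
      ≤ mixingLaw (g k) (Set.Icc (Real.exp (-C - s * k)) (Real.exp (C - s * k))) := by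
  have hmono : ∀ k : ℕ, ∀ C C' : ℝ, C ≤ C' → ENNReal.ofReal (Real.exp (-(C * Real.exp k)))
      ≤ mixingLaw (g k) (Set.Icc (Real.exp (-C - s * k)) (Real.exp (C - s * k))) →
      ENNReal.ofReal (Real.exp (-(C' * Real.exp k)))
      ≤ mixingLaw (g k) (Set.Icc (Real.exp (-C' - s * k)) (Real.exp (C' - s * k))) := by
    intro k C C' hCC h
    have h1 : ENNReal.ofReal (Real.exp (-(C' * Real.exp k)))
        ≤ ENNReal.ofReal (Real.exp (-(C * Real.exp k))) := by
      refine ENNReal.ofReal_le_ofReal (Real.exp_le_exp.mpr (neg_le_neg ?_))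
      gcongr
    exact h1.trans (h.trans (measure_mono (Set.Icc_subset_Icc (Real.exp_le_exp.mpr (by linarith))
      (Real.exp_le_exp.mpr (by linarith)))))
  obtain ⟨c₁, hc₁, hlow⟩ := hg.lower
  -- `k ≥ s + 1` gives `1 + sk ≤ k²`, so the interval lies above `e^{-k²}`.
  obtain ⟨k₀, hk₀⟩ := exists_nat_ge (s + 1)
  have hlarge : ∀ k : ℕ, k₀ ≤ k → ENNReal.ofReal (Real.exp (-((1 + s + c₁) * Real.exp k)))
      ≤ mixingLaw (g k) (Set.Icc (Real.exp (-(1 + s + c₁) - s * k))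
        (Real.exp ((1 + s + c₁) - s * k))) := by
    intro k hk
    have hk' : s + 1 ≤ k := hk₀.trans (by exact_mod_cast hk)
    have hsub : Set.Icc (Real.exp (-1 - s * k)) (Real.exp (-(s * k)))
        ⊆ Set.Icc (Real.exp (-(1 + s + c₁) - s * k)) (Real.exp ((1 + s + c₁) - s * k)) :=
      Set.Icc_subset_Icc (Real.exp_le_exp.mpr (by linarith)) (Real.exp_le_exp.mpr (by linarith))
    refine le_trans ?_ (measure_mono hsub)
    have hpos : Set.Icc (Real.exp (-1 - s * k)) (Real.exp (-(s * k))) ∩ Set.Ioi 0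
        = Set.Icc (Real.exp (-1 - s * k)) (Real.exp (-(s * k))) :=
      Set.inter_eq_left.mpr fun t ht => (Real.exp_pos _).trans_le ht.1
    rw [mixingLaw_apply _ measurableSet_Icc, hpos]
    have hlen : Real.exp (-1 - s * k) ≤ Real.exp (-(s * k)) - Real.exp (-1 - s * k) := by
      have h1 : Real.exp (-(s * k)) = Real.exp 1 * Real.exp (-1 - s * k) := by
        rw [← Real.exp_add]; ring_nf
      have h2 : (2 : ℝ) ≤ Real.exp 1 := by linarith [Real.add_one_le_exp (1 : ℝ)]
      rw [h1]
      nlinarith [Real.exp_pos (-1 - s * k)]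
    calc ENNReal.ofReal (Real.exp (-((1 + s + c₁) * Real.exp k)))
        ≤ ENNReal.ofReal (Real.exp (-c₁ * Real.exp k)
            * (Real.exp (-(s * k)) - Real.exp (-1 - s * k))) := by
          refine ENNReal.ofReal_le_ofReal ?_
          refine le_trans ?_ (mul_le_mul_of_nonneg_left hlen (Real.exp_nonneg _))
          rw [← Real.exp_add, Real.exp_le_exp]
          have h3 := Real.add_one_le_exp (k : ℝ)
          have h4 : (0 : ℝ) ≤ k := Nat.cast_nonneg k
          nlinarith
      _ = ∫⁻ _ in Set.Icc (Real.exp (-1 - s * k)) (Real.exp (-(s * k))),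
            ENNReal.ofReal (Real.exp (-c₁ * Real.exp k)) := by
          rw [setLIntegral_const, Real.volume_Icc, ← ENNReal.ofReal_mul (Real.exp_nonneg _)]
      _ ≤ _ := by
          refine setLIntegral_mono' measurableSet_Icc fun t ht => ENNReal.ofReal_le_ofReal ?_
          refine hlow k t ⟨le_trans (Real.exp_le_exp.mpr ?_) ht.1,
            ht.2.trans (Real.exp_le_exp.mpr ?_)⟩
          · nlinarith
          · have h4 : (0 : ℝ) ≤ k := Nat.cast_nonneg k
            nlinarith
  have hsmall : ∀ k : ℕ, ∃ C : ℝ, 0 < C ∧ ENNReal.ofReal (Real.exp (-(C * Real.exp k)))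
      ≤ mixingLaw (g k) (Set.Icc (Real.exp (-C - s * k)) (Real.exp (C - s * k))) := by
    intro k
    obtain ⟨C, hC, h⟩ := (hg.density k).exists_le_mixingLaw_Icc (s * k)
    refine ⟨C, hC, le_trans (ENNReal.ofReal_le_ofReal (Real.exp_le_exp.mpr (neg_le_neg ?_))) h⟩
    exact le_mul_of_one_le_right hC.le (Real.one_le_exp (Nat.cast_nonneg k))
  choose C hC hCk using hsmall
  refine ⟨(1 + s + c₁) + ∑ k ∈ Finset.range k₀, C k, ?_, fun k => ?_⟩
  · have := Finset.sum_nonneg fun k (_ : k ∈ Finset.range k₀) => (hC k).le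
    positivity
  · rcases lt_or_ge k k₀ with hk | hk
    · refine hmono k (C k) _ ?_ (hCk k)
      have := Finset.single_le_sum (fun i _ => (hC i).le) (Finset.mem_range.mpr hk)
      linarith
    · refine hmono k _ _ ?_ (hlarge k hk)
      have := Finset.sum_nonneg fun k (_ : k ∈ Finset.range k₀) => (hC k).le
      linarith

/-! ### Prior mass of neighbourhoods -/

/-- The map `(A, Z) ↦ θ` that generates the block prior. -/
def priorMap (p : (ℕ → ℝ) × (ℕ → ℝ)) : ℕ → ℝ := fun j => √(p.1 (blockIndex (j + 1))) * p.2 j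

@[fun_prop]
theorem measurable_priorMap : Measurable priorMap := by
  unfold priorMap
  fun_prop

theorem isProbabilityMeasure_blockPrior {g : ℕ → ℝ → ℝ} (hg : ∀ k, IsPosDensity (g k)) :
    IsProbabilityMeasure (blockPrior g) := by
  have _ k := isProbabilityMeasure_mixingLaw (hg k)
  exact Measure.isProbabilityMeasure_map measurable_priorMap.aemeasurable

theorem prod_ofReal_exp_neg_le {s : Finset ℕ} {p : ℕ → ℝ} {m : ℕ → ℝ≥0∞}
    (h : ∀ i ∈ s, ENNReal.ofReal (Real.exp (-p i)) ≤ m i) :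
    ENNReal.ofReal (Real.exp (-∑ i ∈ s, p i) / 2) ≤ (∏ i ∈ s, m i) / 2 := by
  rw [ENNReal.ofReal_div_of_pos two_pos, ENNReal.ofReal_ofNat, ← Finset.sum_neg_distrib,
    Real.exp_sum, ENNReal.ofReal_prod_of_nonneg fun i _ => Real.exp_nonneg _]
  gcongr with i hi
  exact h i hi

theorem measurable_tailSum (J : ℕ) {f : ℝ → ℝ} (hf : Measurable f) :
    Measurable fun θ : ℕ → ℝ => ∑' j, (if j < J then 0 else ENNReal.ofReal (f (θ j))) := by
  refine Measurable.tsum fun j => ?_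
  split_ifs
  · exact measurable_const
  · exact (hf.comp (measurable_pi_apply j)).ennreal_ofReal

/-- Tonelli in two stages, variances first and normals given the variances. In each stage the head
is a box event, and Markov's inequality makes the independent tail small at the price of a factor
`1/2`, hence the `1/4`. -/
theorem le_blockPrior_of_windows {g : ℕ → ℝ → ℝ} (hg : ∀ k, IsPosDensity (g k)) {K : ℕ}
    {W : ℕ → Set ℝ} (hW : ∀ k, MeasurableSet (W k)) {p q θ₀ : ℕ → ℝ} {δ : ℝ} {τ : ℝ≥0∞}
    (hp : ∀ k ∈ Finset.range K, ENNReal.ofReal (Real.exp (-p k)) ≤ mixingLaw (g k) (W k))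
    (hq : ∀ j ∈ Finset.range (headSize K), ∀ a ∈ W (blockIndex (j + 1)),
      ENNReal.ofReal (Real.exp (-q j)) ≤ gaussianReal 0 1 {z | |√a * z - θ₀ j| ≤ δ})
    (hτ0 : τ ≠ 0) (hτ : τ ≠ ∞)
    (hmean : ∑' j, (if j < headSize K then 0 else
      ∫⁻ a, ENNReal.ofReal √a ∂(mixingLaw (g (blockIndex (j + 1))))) ≤ τ / 2 / 2 / 2) :
    ENNReal.ofReal (Real.exp (-(∑ j ∈ Finset.range (headSize K), q j
        + ∑ k ∈ Finset.range K, p k)) / 4)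
      ≤ blockPrior g {θ | (∀ j ∈ Finset.range (headSize K), |θ j - θ₀ j| ≤ δ) ∧
          ∑' j, (if j < headSize K then 0 else ENNReal.ofReal |θ j|) ≤ τ} := by
  have _ k := isProbabilityMeasure_mixingLaw (hg k)
  set G : Set (ℕ → ℝ) := {θ | (∀ j ∈ Finset.range (headSize K), |θ j - θ₀ j| ≤ δ) ∧
          ∑' j, (if j < headSize K then 0 else ENNReal.ofReal |θ j|) ≤ τ} with hG
  have hGm : MeasurableSet G := by
    have hGeq : G = (⋂ j ∈ Finset.range (headSize K), {θ | |θ j - θ₀ j| ≤ δ}) ∩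
        {θ | ∑' j, (if j < headSize K then 0 else ENNReal.ofReal |θ j|) ≤ τ} := by
      ext
      simp [hG]
    rw [hGeq]
    refine MeasurableSet.inter (Finset.measurableSet_biInter _ fun j _ =>
      measurableSet_le (by fun_prop) measurable_const) ?_
    exact measurableSet_le (measurable_tailSum _ measurable_abs) measurable_const
  have hdiv : ∀ x : ℝ≥0∞, x ≠ 0 → x / 2 ≠ 0 := fun x hx =>
    (ENNReal.div_pos hx ENNReal.ofNat_ne_top).ne'
  have hdivt : ∀ x : ℝ≥0∞, x ≠ ∞ → x / 2 ≠ ∞ := fun x hx => ENNReal.div_ne_top hx two_ne_zero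
  -- The tail of `√A` is kept below `τ/4`: with `E|Z_j| ≤ 2` the second stage then has mean at most
  -- `τ/2`. Markov at level `τ/4` needs the mean `τ/8`.
  have hA := half_prod_le_infinitePi_pi_inter (fun k => mixingLaw (g k)) (S := Finset.range K) hW
    (f := fun j => if j < headSize K then 0 else fun a => ENNReal.ofReal √a)
    (fun j => by
      split_ifs
      · exact measurable_zero
      · fun_prop)
    (κ := fun j => blockIndex (j + 1))
    (fun j hj => if_pos (lt_headSize_iff.mpr (Finset.mem_range.mp hj)))
    (hdiv _ (hdiv _ hτ0)) (hdivt _ (hdivt _ hτ)) (by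
      refine le_trans (ENNReal.tsum_le_tsum fun j => ?_) hmean
      split_ifs <;> simp)
  set EA := (Finset.range K : Set ℕ).pi W ∩ {x : ℕ → ℝ | ∑' j,
    (if j < headSize K then (0 : ℝ → ℝ≥0∞) else fun a => ENNReal.ofReal √a)
      (x (blockIndex (j + 1))) ≤ τ / 2 / 2} with hEA
  have hZ : ∀ A ∈ EA, ENNReal.ofReal (Real.exp (-∑ j ∈ Finset.range (headSize K), q j) / 2)
      ≤ Measure.infinitePi (fun _ : ℕ => gaussianReal 0 1) (Prod.mk A ⁻¹' (priorMap ⁻¹' G)) := by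
    intro A hAE
    have hsumA : ∑' j, (if j < headSize K then 0 else
        ENNReal.ofReal √(A (blockIndex (j + 1)))) ≤ τ / 2 / 2 := by
      refine le_trans (ENNReal.tsum_le_tsum fun j => ?_) hAE.2
      split_ifs <;> simp
    have h := half_prod_le_infinitePi_pi_inter (fun _ => gaussianReal 0 1)
      (S := Finset.range (headSize K))
      (t := fun j => {z | |√(A (blockIndex (j + 1))) * z - θ₀ j| ≤ δ})
      (fun j => measurableSet_le (by fun_prop) measurable_const)
      (f := fun j => if j < headSize K then 0 else
        fun z => ENNReal.ofReal √(A (blockIndex (j + 1))) * ENNReal.ofReal |z|)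
      (fun j => by
        split_ifs
        · exact measurable_zero
        · fun_prop)
      (κ := id) (fun j hj => if_pos (Finset.mem_range.mp hj)) hτ0 hτ (by
        calc _ ≤ ∑' j, 2 * (if j < headSize K then 0 else
                ENNReal.ofReal √(A (blockIndex (j + 1)))) := by
              refine ENNReal.tsum_le_tsum fun j => ?_
              split_ifs
              · simp
              · rw [lintegral_const_mul _ (by fun_prop), mul_comm]
                gcongr
                exact lintegral_abs_gaussianReal_le
          _ ≤ 2 * (τ / 2 / 2) := by
              rw [ENNReal.tsum_mul_left]; gcongr
          _ = τ / 2 := ENNReal.mul_div_cancel two_ne_zero ENNReal.ofNat_ne_top)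
    refine (prod_ofReal_exp_neg_le fun j hj => hq j hj _ (hAE.1 _ ?_)).trans
      (h.trans (measure_mono ?_))
    · rw [Finset.mem_coe, Finset.mem_range, ← lt_headSize_iff]
      exact Finset.mem_range.mp hj
    · rintro Z ⟨hZ1, hZ2⟩
      refine ⟨fun j hj => hZ1 j hj, le_trans (ENNReal.tsum_le_tsum fun j => ?_) hZ2⟩
      split_ifs
      · exact zero_le
      · simp only [priorMap, id, abs_mul, abs_of_nonneg (Real.sqrt_nonneg _)]
        rw [ENNReal.ofReal_mul (Real.sqrt_nonneg _)]
  have hmap : blockPrior g G = ∫⁻ A, Measure.infinitePi (fun _ : ℕ => gaussianReal 0 1)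
      (Prod.mk A ⁻¹' (priorMap ⁻¹' G)) ∂(Measure.infinitePi fun k => mixingLaw (g k)) := by
    rw [← Measure.prod_apply (measurable_priorMap hGm)]
    exact Measure.map_apply measurable_priorMap hGm
  rw [hmap]
  have hEAm : MeasurableSet EA := by
    refine (MeasurableSet.pi (Finset.countable_toSet _) fun i _ => hW i).inter
      (measurableSet_le (Measurable.tsum fun j => ?_) measurable_const)
    split_ifs
    · exact measurable_const
    · fun_prop
  calc _ = ENNReal.ofReal (Real.exp (-∑ j ∈ Finset.range (headSize K), q j) / 2)
        * ENNReal.ofReal (Real.exp (-∑ k ∈ Finset.range K, p k) / 2) := by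
        rw [← ENNReal.ofReal_mul (by positivity), neg_add, Real.exp_add]
        congr 1
        ring
    _ ≤ ENNReal.ofReal (Real.exp (-∑ j ∈ Finset.range (headSize K), q j) / 2)
        * Measure.infinitePi (fun k => mixingLaw (g k)) EA := by
        gcongr
        exact (prod_ofReal_exp_neg_le hp).trans hA
    _ = ∫⁻ _ in EA, ENNReal.ofReal (Real.exp (-∑ j ∈ Finset.range (headSize K), q j) / 2)
          ∂(Measure.infinitePi fun k => mixingLaw (g k)) := by rw [setLIntegral_const]
    _ ≤ _ := (setLIntegral_mono' hEAm hZ).trans (setLIntegral_le_lintegral _ _)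

theorem tsum_sq_le_sq_tsum (x : ℕ → ℝ≥0∞) : ∑' j, x j ^ 2 ≤ (∑' j, x j) ^ 2 := by
  calc ∑' j, x j ^ 2 ≤ ∑' j, x j * ∑' i, x i := by
        refine ENNReal.tsum_le_tsum fun j => ?_
        rw [sq]
        gcongr
        exact ENNReal.le_tsum j
    _ = _ := by rw [ENNReal.tsum_mul_right, sq]

theorem tsum_ite_lt_const (J : ℕ) (c : ℝ≥0∞) :
    ∑' j : ℕ, (if j < J then c else 0) = J * c := by
  rw [tsum_eq_sum (s := Finset.range J) fun j hj => if_neg (by simpa using hj),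
    Finset.sum_congr rfl fun j hj => if_pos (Finset.mem_range.mp hj)]
  simp

theorem exp_mul_blockIndex_le {α : ℝ} (hα : 0 ≤ α) (j : ℕ) :
    Real.exp (2 * α * blockIndex (j + 1)) ≤ 2 ^ (2 * α) * ((j : ℝ) + 1) ^ (2 * α) := by
  rw [← Real.mul_rpow (by norm_num) (by positivity), mul_comm, Real.exp_mul]
  exact Real.rpow_le_rpow (Real.exp_nonneg _) (exp_blockIndex_le j) (by positivity)

theorem tail_sq_le {α Q : ℝ} (hα : 0 ≤ α) {θ₀ : ℕ → ℝ}
    (hs : Summable fun j : ℕ => ((j : ℝ) + 1) ^ (2 * α) * θ₀ j ^ 2)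
    (hQ : ∑' j : ℕ, ((j : ℝ) + 1) ^ (2 * α) * θ₀ j ^ 2 ≤ Q ^ 2) (K : ℕ) :
    ∑' j, (if j < headSize K then 0 else ENNReal.ofReal (θ₀ j ^ 2))
      ≤ ENNReal.ofReal (2 ^ (2 * α) * Q ^ 2 * Real.exp (-(2 * α * K))) := by
  calc _ ≤ ∑' j : ℕ, ENNReal.ofReal (2 ^ (2 * α) * Real.exp (-(2 * α * K))
        * (((j : ℝ) + 1) ^ (2 * α) * θ₀ j ^ 2)) := by
        refine ENNReal.tsum_le_tsum fun j => ?_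
        split_ifs with hj
        · exact zero_le
        refine ENNReal.ofReal_le_ofReal ?_
        rw [← mul_assoc]
        refine le_mul_of_one_le_left (sq_nonneg _) ?_
        have h1 : K ≤ blockIndex (j + 1) := not_lt.mp (lt_headSize_iff.not.mp hj)
        have h2 : Real.exp (2 * α * K) ≤ Real.exp (2 * α * blockIndex (j + 1)) := by
          rw [Real.exp_le_exp]; gcongr
        have h3 := h2.trans (exp_mul_blockIndex_le hα j)
        calc (1 : ℝ) = Real.exp (-(2 * α * K)) * Real.exp (2 * α * K) := by
              rw [← Real.exp_add]; simp
          _ ≤ Real.exp (-(2 * α * K)) * (2 ^ (2 * α) * ((j : ℝ) + 1) ^ (2 * α)) := by gcongr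
          _ = _ := by ring
    _ = ENNReal.ofReal (2 ^ (2 * α) * Real.exp (-(2 * α * K))
          * ∑' j : ℕ, ((j : ℝ) + 1) ^ (2 * α) * θ₀ j ^ 2) := by
        rw [← ENNReal.ofReal_tsum_of_nonneg (fun j => by positivity) (hs.mul_left _), tsum_mul_left]
    _ ≤ _ := by
        refine ENNReal.ofReal_le_ofReal ?_
        calc _ ≤ 2 ^ (2 * α) * Real.exp (-(2 * α * K)) * Q ^ 2 := by gcongr
          _ = _ := by ring

theorem tsum_abs_le_of_head_tail {θ θ₀ : ℕ → ℝ} {J : ℕ} {δ b τ : ℝ} (hδ : 0 ≤ δ) (hτ : 0 ≤ τ)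
    (hs : Summable fun j => |θ₀ j|) (hb : ∑' j, |θ₀ j| ≤ b)
    (h1 : ∀ j ∈ Finset.range J, |θ j - θ₀ j| ≤ δ)
    (h2 : ∑' j, (if j < J then 0 else ENNReal.ofReal |θ j|) ≤ ENNReal.ofReal τ) :
    ∑' j, ENNReal.ofReal |θ j| ≤ ENNReal.ofReal (b + J * δ + τ) := by
  have hb0 : 0 ≤ b := (tsum_nonneg fun j => abs_nonneg _).trans hb
  calc ∑' j, ENNReal.ofReal |θ j|
      ≤ ∑' j, (ENNReal.ofReal |θ₀ j| + (if j < J then ENNReal.ofReal δ else 0)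
          + (if j < J then 0 else ENNReal.ofReal |θ j|)) := by
        refine ENNReal.tsum_le_tsum fun j => ?_
        split_ifs with hj
        · rw [add_zero, ← ENNReal.ofReal_add (abs_nonneg _) hδ]
          refine ENNReal.ofReal_le_ofReal ?_
          have := h1 j (Finset.mem_range.mpr hj)
          have := abs_sub_abs_le_abs_sub (θ j) (θ₀ j)
          linarith
        · exact le_add_self
    _ = ENNReal.ofReal (∑' j, |θ₀ j|) + J * ENNReal.ofReal δ
          + ∑' j, (if j < J then 0 else ENNReal.ofReal |θ j|) := by
        rw [ENNReal.tsum_add, ENNReal.tsum_add, tsum_ite_lt_const,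
          ENNReal.ofReal_tsum_of_nonneg (fun j => abs_nonneg _) hs]
    _ ≤ ENNReal.ofReal b + J * ENNReal.ofReal δ + ENNReal.ofReal τ := by gcongr
    _ = _ := by
        rw [← ENNReal.ofReal_natCast, ← ENNReal.ofReal_mul (by positivity),
          ← ENNReal.ofReal_add hb0 (by positivity), ← ENNReal.ofReal_add (by positivity) hτ]

theorem tsum_sub_sq_le_of_head_tail {θ θ₀ : ℕ → ℝ} {J : ℕ} {δ v τ : ℝ} (hv : 0 ≤ v) (hτ : 0 ≤ τ)
    (hv' : ∑' j, (if j < J then 0 else ENNReal.ofReal (θ₀ j ^ 2)) ≤ ENNReal.ofReal v)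
    (h1 : ∀ j ∈ Finset.range J, |θ j - θ₀ j| ≤ δ)
    (h2 : ∑' j, (if j < J then 0 else ENNReal.ofReal |θ j|) ≤ ENNReal.ofReal τ) :
    ∑' j, ENNReal.ofReal ((θ j - θ₀ j) ^ 2)
      ≤ ENNReal.ofReal (J * δ ^ 2 + 2 * τ ^ 2 + 2 * v) := by
  calc ∑' j, ENNReal.ofReal ((θ j - θ₀ j) ^ 2)
      ≤ ∑' j, ((if j < J then ENNReal.ofReal (δ ^ 2) else 0)
          + 2 * (if j < J then 0 else ENNReal.ofReal |θ j|) ^ 2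
          + 2 * (if j < J then 0 else ENNReal.ofReal (θ₀ j ^ 2))) := by
        refine ENNReal.tsum_le_tsum fun j => ?_
        split_ifs with hj
        · simp only [ne_eq, OfNat.ofNat_ne_zero, not_false_eq_true, zero_pow, mul_zero, add_zero]
          refine ENNReal.ofReal_le_ofReal ?_
          rw [← sq_abs]
          exact pow_le_pow_left₀ (abs_nonneg _) (h1 j (Finset.mem_range.mpr hj)) 2
        · rw [zero_add, ← ENNReal.ofReal_pow (abs_nonneg _), sq_abs, ← ENNReal.ofReal_ofNat 2,
            ← ENNReal.ofReal_mul (by norm_num), ← ENNReal.ofReal_mul (by norm_num),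
            ← ENNReal.ofReal_add (by positivity) (by positivity)]
          refine ENNReal.ofReal_le_ofReal ?_
          nlinarith [sq_nonneg (θ j + θ₀ j)]
    _ = J * ENNReal.ofReal (δ ^ 2)
          + 2 * ∑' j, (if j < J then 0 else ENNReal.ofReal |θ j|) ^ 2
          + 2 * ∑' j, (if j < J then 0 else ENNReal.ofReal (θ₀ j ^ 2)) := by
        rw [ENNReal.tsum_add, ENNReal.tsum_add, tsum_ite_lt_const, ENNReal.tsum_mul_left,
          ENNReal.tsum_mul_left]
    _ ≤ J * ENNReal.ofReal (δ ^ 2) + 2 * ENNReal.ofReal τ ^ 2 + 2 * ENNReal.ofReal v := by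
        gcongr
        exact (tsum_sq_le_sq_tsum _).trans (pow_le_pow_left' h2 2)
    _ = _ := by
        rw [← ENNReal.ofReal_natCast, ← ENNReal.ofReal_mul (by positivity),
          ← ENNReal.ofReal_pow hτ, ← ENNReal.ofReal_ofNat 2, ← ENNReal.ofReal_mul (by norm_num),
          ← ENNReal.ofReal_mul (by norm_num), ← ENNReal.ofReal_add (by positivity) (by positivity),
          ← ENNReal.ofReal_add (by positivity) (by positivity)]

/-- Variances near `e^{-(2α+1)k}` match smoothness `α`. Bringing each head coefficient within `δ` of
the truth costs a constant, a multiple of `K - k`, and `θ₀²` divided by the variance, which the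
Sobolev bound sums. Each total is of order `e^K`. The tail is small since `E√A_k` decays faster than
any power of the index. -/
theorem exists_le_blockPrior_neighborhood {g : ℕ → ℝ → ℝ} (hg : IsMixingClass g) {α Q B : ℝ}
    (hα : 1 / 2 < α) (hB : 0 < B) :
    ∃ C : ℝ, 0 < C ∧ ∀ᶠ K : ℕ in atTop, ∀ θ₀ : ℕ → ℝ,
      (Summable fun j : ℕ => ((j : ℝ) + 1) ^ (2 * α) * θ₀ j ^ 2) →
      ∑' j : ℕ, ((j : ℝ) + 1) ^ (2 * α) * θ₀ j ^ 2 ≤ Q ^ 2 →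
      (Summable fun j => |θ₀ j|) → ∑' j, |θ₀ j| ≤ B / 3 →
      ENNReal.ofReal (Real.exp (-(C * Real.exp K)))
        ≤ blockPrior g {θ | θ ∈ constraintSet B ∧
            ∑' j, ENNReal.ofReal ((θ j - θ₀ j) ^ 2)
              ≤ ENNReal.ofReal (C * Real.exp (-(2 * α * K)))} := by
  have hα0 : 0 < α := by linarith
  set s := 2 * α + 1 with hs
  obtain ⟨C, hC, hwin⟩ := hg.exists_le_mixingLaw_Icc (s := s) (by linarith)
  obtain ⟨c, hc, hsqrt⟩ := hg.exists_lintegral_sqrt_le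
  obtain ⟨D, hD, hDj⟩ := exists_exp_neg_sq_blockIndex_le hc (show 0 ≤ α + 3 by linarith)
  have htail := eventually_tsum_tail_rpow_le hα0.le (show 0 ≤ 5 * D by positivity)
    (show (0 : ℝ) < 1 / 8 by norm_num)
  have hlim : Tendsto (fun K : ℕ => Real.exp (-((α - 1 / 2) * K)) + Real.exp (-(α * K)))
      atTop (𝓝 0) := by
    have h : ∀ a : ℝ, 0 < a → Tendsto (fun K : ℕ => Real.exp (-(a * K))) atTop (𝓝 0) :=
      fun a ha => Real.tendsto_exp_neg_atTop_nhds_zero.comp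
        (tendsto_natCast_atTop_atTop.const_mul_atTop ha)
    simpa using (h (α - 1 / 2) (by linarith)).add (h α hα0)
  set C₁ := (1 + C / 2 + Real.exp C) + s + Real.exp C * 2 ^ (2 * α) * Q ^ 2 + C with hC₁
  set C₂ := 3 + 2 * (2 ^ (2 * α) * Q ^ 2) with hC₂
  have hC₁0 : 0 < C₁ := by positivity
  have hC₂0 : 0 < C₂ := by positivity
  refine ⟨C₁ + 2 + C₂, by positivity, ?_⟩
  filter_upwards [htail, hlim.eventually (gt_mem_nhds (show (0 : ℝ) < B / 3 by positivity))]
    with K hK hKB θ₀ hθs hθQ hθ1 hθB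
  -- With at most `e^K` head coefficients the squared `ℓ²` error is at most `e^{-2αK}`. The `ℓ¹`
  -- error is at most `e^{-(α-1/2)K}`, which tends to `0` since `α > 1/2` and so keeps the ball in
  -- `D`.
  set δ := Real.exp (-(s / 2 * K)) with hδ
  have hδ0 : 0 < δ := Real.exp_pos _
  have hexpK : 1 ≤ Real.exp (K : ℝ) := Real.one_le_exp (Nat.cast_nonneg K)
  -- The terms bound, in order, the constants together with `δ²/lo`, the logarithm of
  -- `√(e^{-sk})/δ`, and `θ₀²/lo`.
  let q : ℕ → ℝ := fun j => (1 + C / 2 + Real.exp C) + s / 2 * ((K : ℝ) - blockIndex (j + 1))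
    + Real.exp C * Real.exp K * 2 ^ (2 * α) * (((j : ℝ) + 1) ^ (2 * α) * θ₀ j ^ 2)
  have hmass := le_blockPrior_of_windows hg.density (K := K)
    (W := fun k => Set.Icc (Real.exp (-C - s * k)) (Real.exp (C - s * k)))
    (fun k => measurableSet_Icc) (p := fun k => C * Real.exp k) (q := q) (θ₀ := θ₀) (δ := δ)
    (τ := ENNReal.ofReal (Real.exp (-(α * K)))) (fun k _ => hwin k) ?_
    (ENNReal.ofReal_pos.mpr (Real.exp_pos _)).ne' ENNReal.ofReal_ne_top ?_
  · refine le_trans ?_ (hmass.trans (measure_mono ?_))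
    · refine ENNReal.ofReal_le_ofReal ?_
      have hqsum : ∑ j ∈ Finset.range (headSize K), q j ≤ Real.exp K * (1 + C / 2 + Real.exp C)
          + s * Real.exp K + Real.exp C * Real.exp K * 2 ^ (2 * α) * Q ^ 2 := by
        simp only [q]
        rw [Finset.sum_add_distrib, Finset.sum_add_distrib, ← Finset.mul_sum, ← Finset.mul_sum,
          Finset.sum_const, Finset.card_range, nsmul_eq_mul]
        have h1 := headSize_le_exp K
        have h2 := sum_sub_blockIndex_le K
        have h3 : ∑ j ∈ Finset.range (headSize K), ((j : ℝ) + 1) ^ (2 * α) * θ₀ j ^ 2 ≤ Q ^ 2 :=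
          (hθs.sum_le_tsum _ fun j _ => by positivity).trans hθQ
        have h4 : s / 2 * ∑ j ∈ Finset.range (headSize K), ((K : ℝ) - blockIndex (j + 1))
            ≤ s / 2 * (2 * Real.exp K) := by gcongr
        have h5 : (headSize K : ℝ) * (1 + C / 2 + Real.exp C)
            ≤ Real.exp K * (1 + C / 2 + Real.exp C) := by gcongr
        have h6 : Real.exp C * Real.exp K * 2 ^ (2 * α)
              * ∑ j ∈ Finset.range (headSize K), ((j : ℝ) + 1) ^ (2 * α) * θ₀ j ^ 2
            ≤ Real.exp C * Real.exp K * 2 ^ (2 * α) * Q ^ 2 := by gcongr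
        linarith
      have hpsum : ∑ k ∈ Finset.range K, C * Real.exp k ≤ C * Real.exp K := by
        rw [← Finset.mul_sum]
        exact mul_le_mul_of_nonneg_left (sum_exp_range_le K) hC.le
      have h4 : Real.exp (-2) ≤ 1 / 4 := by
        have h5 : (2 : ℝ) ≤ Real.exp 1 := by linarith [Real.add_one_le_exp (1 : ℝ)]
        have h6 : Real.exp 2 = Real.exp 1 * Real.exp 1 := by rw [← Real.exp_add]; norm_num
        rw [Real.exp_neg, ← one_div]
        exact one_div_le_one_div_of_le (by norm_num) (by rw [h6]; nlinarith)
      calc Real.exp (-((C₁ + 2 + C₂) * Real.exp K))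
          ≤ Real.exp (-(C₁ * Real.exp K) + -2) := by
            rw [Real.exp_le_exp]
            nlinarith
        _ = Real.exp (-(C₁ * Real.exp K)) * Real.exp (-2) := Real.exp_add _ _
        _ ≤ Real.exp (-(∑ j ∈ Finset.range (headSize K), q j
              + ∑ k ∈ Finset.range K, C * Real.exp k)) * (1 / 4) := by
            gcongr
            rw [hC₁]
            linarith
        _ = _ := by ring
    · rintro θ ⟨h1, h2⟩
      have hJδ : (headSize K : ℝ) * δ ≤ Real.exp (-((α - 1 / 2) * K)) := by
        calc (headSize K : ℝ) * δ ≤ Real.exp K * δ := by gcongr; exact headSize_le_exp K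
          _ = _ := by rw [hδ, ← Real.exp_add, hs]; congr 1; ring
      have hJδ2 : (headSize K : ℝ) * δ ^ 2 ≤ Real.exp (-(2 * α * K)) := by
        calc (headSize K : ℝ) * δ ^ 2 ≤ Real.exp K * δ ^ 2 := by gcongr; exact headSize_le_exp K
          _ = _ := by rw [hδ, ← Real.exp_nat_mul, ← Real.exp_add, hs]; congr 1; push_cast; ring
      refine ⟨?_, ?_⟩
      · refine lt_of_le_of_lt
          (tsum_abs_le_of_head_tail hδ0.le (Real.exp_nonneg _) hθ1 hθB h1 h2) ?_
        refine (ENNReal.ofReal_lt_ofReal_iff hB).mpr ?_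
        linarith
      · refine (tsum_sub_sq_le_of_head_tail (by positivity) (Real.exp_nonneg _)
          (tail_sq_le hα0.le hθs hθQ K) h1 h2).trans (ENNReal.ofReal_le_ofReal ?_)
        have h3 : Real.exp (-(α * K)) ^ 2 = Real.exp (-(2 * α * K)) := by
          rw [← Real.exp_nat_mul]; congr 1; push_cast; ring
        rw [h3]
        have h4 : Real.exp (-(2 * α * K)) + 2 * Real.exp (-(2 * α * K))
            + 2 * (2 ^ (2 * α) * Q ^ 2 * Real.exp (-(2 * α * K)))
            = C₂ * Real.exp (-(2 * α * K)) := by rw [hC₂]; ring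
        nlinarith [Real.exp_pos (-(2 * α * K))]
  · intro j hj a ha
    set k := blockIndex (j + 1) with hk
    have hkK : k < K := lt_headSize_iff.mp (Finset.mem_range.mp hj)
    have hkK' : (k : ℝ) ≤ K := by exact_mod_cast hkK.le
    refine le_trans (ENNReal.ofReal_le_ofReal ?_)
      (exp_neg_le_gaussianReal_abs_sub_le (Real.exp_pos _) ha.1 ha.2 hδ0)
    have h1 : δ / √(Real.exp (C - s * k)) = Real.exp (-(s / 2 * (K - k)) - C / 2) := by
      rw [← Real.exp_half, hδ, ← Real.exp_sub]
      congr 1; ring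
    rw [h1, ← Real.exp_add, Real.exp_le_exp]
    have h2 : (θ₀ j ^ 2 + δ ^ 2) / Real.exp (-C - s * k)
        = Real.exp C * (Real.exp (s * k) * θ₀ j ^ 2) + Real.exp C * (Real.exp (s * k) * δ ^ 2) := by
      rw [div_eq_mul_inv, ← Real.exp_neg, show -(-C - s * k) = C + s * k by ring, Real.exp_add]
      ring
    have h3 : Real.exp (s * k) * δ ^ 2 ≤ 1 := by
      rw [hδ, ← Real.exp_nat_mul, ← Real.exp_add, Real.exp_le_one_iff]
      push_cast
      nlinarith
    have h4 : Real.exp (s * k) * θ₀ j ^ 2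
        ≤ Real.exp K * 2 ^ (2 * α) * (((j : ℝ) + 1) ^ (2 * α) * θ₀ j ^ 2) := by
      have h5 : Real.exp (s * k) = Real.exp k * Real.exp (2 * α * k) := by
        rw [← Real.exp_add, hs]; congr 1; ring
      rw [h5]
      calc Real.exp k * Real.exp (2 * α * k) * θ₀ j ^ 2
          ≤ Real.exp K * (2 ^ (2 * α) * ((j : ℝ) + 1) ^ (2 * α)) * θ₀ j ^ 2 := by
            gcongr
            exact exp_mul_blockIndex_le hα0.le j
        _ = _ := by ring
    have h6 := mul_le_mul_of_nonneg_left h3 (Real.exp_nonneg C)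
    have h7 := mul_le_mul_of_nonneg_left h4 (Real.exp_nonneg C)
    rw [h2]
    simp only [q, ← hk]
    linarith
  · have h8 : ENNReal.ofReal (Real.exp (-(α * K))) / 2 / 2 / 2
        = ENNReal.ofReal (1 / 8 * Real.exp (-(α * K))) := by
      rw [← ENNReal.ofReal_ofNat 2, ← ENNReal.ofReal_div_of_pos two_pos,
        ← ENNReal.ofReal_div_of_pos two_pos, ← ENNReal.ofReal_div_of_pos two_pos]
      congr 1; ring
    rw [h8]
    refine le_trans (ENNReal.tsum_le_tsum fun j => ?_) hK
    split_ifs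
    · exact le_rfl
    · refine (hsqrt _).trans (ENNReal.ofReal_le_ofReal ?_)
      rw [mul_assoc]
      exact mul_le_mul_of_nonneg_left (hDj j) (by norm_num)

/-! ### Prior mass of the complement of the sieve -/

theorem infinitePi_eval_preimage (μ : ℕ → Measure ℝ) [∀ i, IsProbabilityMeasure (μ i)] (i : ℕ)
    {s : Set ℝ} (hs : MeasurableSet s) : Measure.infinitePi μ {x | x i ∈ s} = μ i s :=
  (measurePreserving_eval_infinitePi μ i).measure_preimage hs.nullMeasurableSet

theorem infinitePi_mixingLaw_exists_gt_le {g : ℕ → ℝ → ℝ} (hg : ∀ k, IsPosDensity (g k)) {c : ℝ}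
    (hc : 0 < c) (h : ∀ k : ℕ, mixingLaw (g k) (Set.Ioi (Real.exp (-(k : ℝ) ^ 2)))
      ≤ ENNReal.ofReal (Real.exp (-c * Real.exp k))) (K : ℕ) :
    Measure.infinitePi (fun k => mixingLaw (g k))
        {A | ∃ k, K ≤ k ∧ Real.exp (-(k : ℝ) ^ 2) < A k}
      ≤ ENNReal.ofReal ((1 - Real.exp (-c))⁻¹ * Real.exp (-c * Real.exp K)) := by
  have _ k := isProbabilityMeasure_mixingLaw (hg k)
  have hsub : {A : ℕ → ℝ | ∃ k, K ≤ k ∧ Real.exp (-(k : ℝ) ^ 2) < A k}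
      ⊆ ⋃ i : ℕ, {A | A (K + i) ∈ Set.Ioi (Real.exp (-((K + i : ℕ) : ℝ) ^ 2))} := by
    rintro A ⟨k, hk, hA⟩
    obtain ⟨i, rfl⟩ := Nat.exists_eq_add_of_le hk
    exact Set.mem_iUnion.mpr ⟨i, hA⟩
  refine (measure_mono hsub).trans ((measure_iUnion_le _).trans ?_)
  refine le_trans (ENNReal.tsum_le_tsum fun i => ?_) (tsum_ofReal_exp_neg_le hc)
  rw [infinitePi_eval_preimage _ _ measurableSet_Ioi]
  refine (h _).trans (ENNReal.ofReal_le_ofReal (Real.exp_le_exp.mpr ?_))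
  -- Reduces the doubly exponential sum over blocks to a geometric series.
  have h1 : Real.exp K + i ≤ Real.exp ((K + i : ℕ) : ℝ) := by
    push_cast
    rw [Real.exp_add]
    have h2 := Real.add_one_le_exp (i : ℝ)
    have h3 : 1 ≤ Real.exp (K : ℝ) := Real.one_le_exp (Nat.cast_nonneg K)
    have h4 : (0 : ℝ) ≤ i := Nat.cast_nonneg i
    nlinarith
  nlinarith

theorem infinitePi_gaussianReal_exists_gt_le (J : ℕ) :
    Measure.infinitePi (fun _ : ℕ => gaussianReal 0 1)
        {Z | ∃ j, J ≤ j ∧ √((j : ℝ) + 1) < |Z j|}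
      ≤ ENNReal.ofReal (2 * (1 - Real.exp (-(1 / 4)))⁻¹ * Real.exp (-(1 / 4) * ((J : ℝ) + 1))) := by
  have hsub : {Z : ℕ → ℝ | ∃ j, J ≤ j ∧ √((j : ℝ) + 1) < |Z j|}
      ⊆ ⋃ i : ℕ, {Z | Z (J + i) ∈ {z | √(((J + i : ℕ) : ℝ) + 1) < |z|}} := by
    rintro Z ⟨j, hj, hZ⟩
    obtain ⟨i, rfl⟩ := Nat.exists_eq_add_of_le hj
    exact Set.mem_iUnion.mpr ⟨i, hZ⟩
  refine (measure_mono hsub).trans ((measure_iUnion_le _).trans ?_)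
  calc _ ≤ ∑' i : ℕ, 2 * ENNReal.ofReal (Real.exp (-(1 / 4) * (((J : ℝ) + 1) + i))) := by
        refine ENNReal.tsum_le_tsum fun i => ?_
        rw [infinitePi_eval_preimage (fun _ => gaussianReal 0 1) _
          (measurableSet_lt measurable_const measurable_abs)]
        refine (gaussianReal_abs_gt_le (Real.sqrt_nonneg _)).trans_eq ?_
        rw [Real.sq_sqrt (by positivity)]
        congr 3
        push_cast
        ring
    _ ≤ 2 * ENNReal.ofReal ((1 - Real.exp (-(1 / 4)))⁻¹ * Real.exp (-(1 / 4) * ((J : ℝ) + 1))) := by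
        rw [ENNReal.tsum_mul_left]
        gcongr
        exact tsum_ofReal_exp_neg_le (by norm_num)
    _ = _ := by
        rw [← ENNReal.ofReal_ofNat 2, ← ENNReal.ofReal_mul (by norm_num), mul_assoc]

/-- Unless some `A_k > e^{-k²}` or some `|Z_j| > √(j+1)` beyond the cutoff, the tail energy is a sum
of rapidly decreasing terms. Both exceptional events have probability `exp(-c e^{K+m})` up to
constants, and `e^m` can be made to exceed any prescribed constant. -/
theorem exists_blockPrior_tail_le {g : ℕ → ℝ → ℝ} (hg : IsMixingClass g) {α : ℝ} (hα : 0 ≤ α)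
    (C : ℝ) :
    ∃ m : ℕ, ∀ᶠ K : ℕ in atTop,
      blockPrior g {θ | ENNReal.ofReal (Real.exp (-(2 * α * K)))
          < ∑' j, (if j < headSize (K + m) then 0 else ENNReal.ofReal (θ j ^ 2))}
        ≤ ENNReal.ofReal (Real.exp (-(C * Real.exp K))) := by
  have _ k := isProbabilityMeasure_mixingLaw (hg.density k)
  obtain ⟨c₃, hc₃, htail⟩ := hg.exists_mixingLaw_Ioi_le
  -- One power of `j + 1` is lost to `Z_j² ≤ j + 1`; the remaining `2α + 3` fit
  -- `eventually_tsum_tail_rpow_le` with `p = 2α`.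
  obtain ⟨D, hD, hDj⟩ := exists_exp_neg_sq_blockIndex_le one_pos (show 0 ≤ 2 * α + 4 by linarith)
  have hev := eventually_tsum_tail_rpow_le (show 0 ≤ 2 * α by linarith) hD.le one_pos
  set c := min c₃ (1 / 8) with hc
  have hc0 : 0 < c := lt_min hc₃ (by norm_num)
  set G := (1 - Real.exp (-c₃))⁻¹ + 2 * (1 - Real.exp (-(1 / 4)))⁻¹ with hG
  have hG1 : 0 ≤ (1 - Real.exp (-c₃))⁻¹ :=
    inv_nonneg.mpr (sub_nonneg.mpr (Real.exp_le_one_iff.mpr (by linarith)))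
  have hG2 : 0 ≤ (1 - Real.exp (-(1 / 4)))⁻¹ :=
    inv_nonneg.mpr (sub_nonneg.mpr (Real.exp_le_one_iff.mpr (by norm_num)))
  -- Gives `c e^m ≥ C + 1`. The surplus factor `exp(-e^K)` absorbs the constant `G` of the union
  -- bounds.
  obtain ⟨m, hm⟩ := exists_nat_ge ((C + 1) / c)
  have hm' : C + 1 ≤ c * Real.exp m := by
    rw [div_le_iff₀ hc0] at hm
    have := Real.add_one_le_exp (m : ℝ)
    nlinarith
  have hlim : Tendsto (fun K : ℕ => G * Real.exp (-Real.exp (K : ℝ))) atTop (𝓝 0) := by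
    have h := (Real.tendsto_exp_neg_atTop_nhds_zero.comp
      (Real.tendsto_exp_atTop.comp tendsto_natCast_atTop_atTop)).const_mul G
    rw [mul_zero] at h
    exact h
  refine ⟨m, ?_⟩
  filter_upwards [(tendsto_add_atTop_nat m).eventually hev,
    hlim.eventually (eventually_le_nhds one_pos)] with K hK hKG
  set bad : Set (ℕ → ℝ) := {θ | ENNReal.ofReal (Real.exp (-(2 * α * K)))
          < ∑' j, (if j < headSize (K + m) then 0 else ENNReal.ofReal (θ j ^ 2))} with hbad
  have hbadm : MeasurableSet bad :=
    measurableSet_lt measurable_const (measurable_tailSum _ (f := fun x => x ^ 2) (by fun_prop))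
  have hsub : priorMap ⁻¹' bad ⊆
      (Prod.fst ⁻¹' {A | ∃ k, K + m ≤ k ∧ Real.exp (-(k : ℝ) ^ 2) < A k}) ∪
      (Prod.snd ⁻¹' {Z | ∃ j, headSize (K + m) ≤ j ∧ √((j : ℝ) + 1) < |Z j|}) := by
    rintro ⟨A, Z⟩ hAZ
    by_contra hcon
    simp only [Set.mem_union, Set.mem_preimage, Set.mem_ofPred_eq, not_or, not_exists, not_and,
      not_lt] at hcon
    obtain ⟨hA, hZ⟩ := hcon
    have hAZ' : ENNReal.ofReal (Real.exp (-(2 * α * K)))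
      < ∑' j, (if j < headSize (K + m) then 0 else ENNReal.ofReal (priorMap (A, Z) j ^ 2)) := hAZ
    refine absurd hAZ' (not_lt.mpr ?_)
    refine (ENNReal.tsum_le_tsum fun j => ?_).trans (hK.trans (ENNReal.ofReal_le_ofReal ?_))
    · split_ifs with hj
      · exact le_rfl
      refine ENNReal.ofReal_le_ofReal ?_
      have h1 := hA (blockIndex (j + 1)) (not_lt.mp (lt_headSize_iff.not.mp hj))
      have h2 := hZ j (not_lt.mp hj)
      have h3 : Z j ^ 2 ≤ (j : ℝ) + 1 := by
        rw [← sq_abs, ← Real.sq_sqrt (show (0 : ℝ) ≤ (j : ℝ) + 1 by positivity)]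
        exact pow_le_pow_left₀ (abs_nonneg _) h2 2
      have h4 : √(A (blockIndex (j + 1))) ^ 2 ≤ Real.exp (-(blockIndex (j + 1) : ℝ) ^ 2) := by
        rw [← Real.sq_sqrt (Real.exp_nonneg (-(blockIndex (j + 1) : ℝ) ^ 2))]
        exact pow_le_pow_left₀ (Real.sqrt_nonneg _) (Real.sqrt_le_sqrt h1) 2
      have h5 := hDj j
      rw [neg_one_mul] at h5
      have hj0 : (0 : ℝ) < (j : ℝ) + 1 := by positivity
      calc priorMap (A, Z) j ^ 2 = √(A (blockIndex (j + 1))) ^ 2 * Z j ^ 2 := mul_pow _ _ _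
        _ ≤ (D * ((j : ℝ) + 1) ^ (-(2 * α + 4))) * ((j : ℝ) + 1) :=
          mul_le_mul (h4.trans h5) h3 (sq_nonneg _) (by positivity)
        _ = D * ((j : ℝ) + 1) ^ (-(2 * α + 3)) := by
          rw [mul_assoc, ← Real.rpow_add_one hj0.ne']
          congr 2; ring
    · rw [one_mul, Real.exp_le_exp]
      push_cast
      have : (0 : ℝ) ≤ m := Nat.cast_nonneg m
      nlinarith
  have hmap : blockPrior g bad = ((Measure.infinitePi fun k => mixingLaw (g k)).prod
      (Measure.infinitePi fun _ : ℕ => gaussianReal 0 1)) (priorMap ⁻¹' bad) :=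
    Measure.map_apply measurable_priorMap hbadm
  have hA' := infinitePi_mixingLaw_exists_gt_le hg.density hc₃ htail (K + m)
  have hZ' := infinitePi_gaussianReal_exists_gt_le (headSize (K + m))
  have hAm : MeasurableSet {A : ℕ → ℝ | ∃ k, K + m ≤ k ∧ Real.exp (-(k : ℝ) ^ 2) < A k} := by
    have : {A : ℕ → ℝ | ∃ k, K + m ≤ k ∧ Real.exp (-(k : ℝ) ^ 2) < A k}
        = ⋃ k, ⋃ (_ : K + m ≤ k), {A | Real.exp (-(k : ℝ) ^ 2) < A k} := by ext; simp
    rw [this]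
    exact MeasurableSet.iUnion fun k => MeasurableSet.iUnion fun _ =>
      measurableSet_lt measurable_const (measurable_pi_apply k)
  have hZm : MeasurableSet {Z : ℕ → ℝ | ∃ j, headSize (K + m) ≤ j ∧ √((j : ℝ) + 1) < |Z j|} := by
    have : {Z : ℕ → ℝ | ∃ j, headSize (K + m) ≤ j ∧ √((j : ℝ) + 1) < |Z j|}
        = ⋃ j, ⋃ (_ : headSize (K + m) ≤ j), {Z | √((j : ℝ) + 1) < |Z j|} := by ext; simp
    rw [this]
    exact MeasurableSet.iUnion fun k => MeasurableSet.iUnion fun _ =>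
      measurableSet_lt measurable_const (by fun_prop)
  have hexp : Real.exp ((K + m : ℕ) : ℝ) = Real.exp m * Real.exp K := by
    rw [← Real.exp_add]; push_cast; ring_nf
  have hfin : ∀ x : ℝ, c * Real.exp ((K + m : ℕ) : ℝ) ≤ x →
      Real.exp (-x) ≤ Real.exp (-(C * Real.exp K)) * Real.exp (-Real.exp K) := by
    intro x hx
    rw [← Real.exp_add, Real.exp_le_exp]
    rw [hexp] at hx
    nlinarith [Real.exp_pos (K : ℝ)]
  rw [hmap]
  calc _ ≤ Measure.infinitePi (fun k => mixingLaw (g k))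
            {A | ∃ k, K + m ≤ k ∧ Real.exp (-(k : ℝ) ^ 2) < A k}
          + Measure.infinitePi (fun _ : ℕ => gaussianReal 0 1)
            {Z | ∃ j, headSize (K + m) ≤ j ∧ √((j : ℝ) + 1) < |Z j|} := by
        refine (measure_mono hsub).trans ((measure_union_le _ _).trans_eq ?_)
        rw [measurePreserving_fst.measure_preimage hAm.nullMeasurableSet,
          measurePreserving_snd.measure_preimage hZm.nullMeasurableSet]
    _ ≤ _ := add_le_add hA' hZ'
    _ ≤ ENNReal.ofReal (G * Real.exp (-Real.exp (K : ℝ)) * Real.exp (-(C * Real.exp K))) := by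
        rw [← ENNReal.ofReal_add (by positivity) (by positivity)]
        refine ENNReal.ofReal_le_ofReal ?_
        have h1 : Real.exp (-c₃ * Real.exp ((K + m : ℕ) : ℝ))
            ≤ Real.exp (-(C * Real.exp K)) * Real.exp (-Real.exp K) := by
          rw [neg_mul]
          refine hfin _ ?_
          gcongr
          exact min_le_left _ _
        have h2 : Real.exp (-(1 / 4) * ((headSize (K + m) : ℝ) + 1))
            ≤ Real.exp (-(C * Real.exp K)) * Real.exp (-Real.exp K) := by
          rw [neg_mul]
          refine hfin _ ?_
          have h3 := exp_le_two_mul_headSize_add_one (K + m)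
          have h4 : c ≤ 1 / 8 := min_le_right _ _
          nlinarith [Real.exp_pos ((K + m : ℕ) : ℝ)]
        rw [hG]
        nlinarith
    _ ≤ _ := by
        refine ENNReal.ofReal_le_ofReal ?_
        exact mul_le_of_le_one_left (Real.exp_nonneg _) hKG

/-! ### Sequence spaces -/

theorem summable_of_tsum_ofReal_le {a : ℕ → ℝ} (h0 : ∀ j, 0 ≤ a j) {b : ℝ} (hb : 0 ≤ b)
    (h : ∑' j, ENNReal.ofReal (a j) ≤ ENNReal.ofReal b) : Summable a ∧ ∑' j, a j ≤ b := by
  have h1 : Summable a := by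
    have := ENNReal.summable_toReal (h.trans_lt ENNReal.ofReal_lt_top).ne
    simpa [ENNReal.toReal_ofReal (h0 _)] using this
  refine ⟨h1, ?_⟩
  rw [← ENNReal.ofReal_tsum_of_nonneg h0 h1] at h
  exact (ENNReal.ofReal_le_ofReal_iff hb).mp h

theorem summable_sq_of_summable_abs {a : ℕ → ℝ} (ha : Summable fun j => |a j|) :
    Summable fun j => a j ^ 2 := by
  refine Summable.of_nonneg_of_le (fun j => sq_nonneg _) (fun j => ?_) (ha.mul_right (∑' i, |a i|))
  rw [← sq_abs, sq]
  exact mul_le_mul_of_nonneg_left (ha.le_tsum j fun i _ => abs_nonneg _) (abs_nonneg _)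

theorem summable_abs_sub {a b : ℕ → ℝ} (ha : Summable fun j => |a j|)
    (hb : Summable fun j => |b j|) : Summable fun j => |a j - b j| :=
  Summable.of_nonneg_of_le (fun _ => abs_nonneg _) (fun j => abs_sub (a j) (b j)) (ha.add hb)

theorem tsum_abs_sub_le {a b : ℕ → ℝ} (ha : Summable fun j => |a j|)
    (hb : Summable fun j => |b j|) : ∑' j, |a j - b j| ≤ ∑' j, |a j| + ∑' j, |b j| := by
  rw [← ha.tsum_add hb]
  exact (summable_abs_sub ha hb).tsum_le_tsum (fun j => abs_sub (a j) (b j)) (ha.add hb)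

theorem summable_rpow_neg_two_mul {αs : ℝ} (hαs : 1 / 2 < αs) :
    Summable fun j : ℕ => ((j : ℝ) + 1) ^ (-(2 * αs)) := by
  have := (summable_nat_add_iff 1).mpr
    (Real.summable_nat_rpow.mpr (show -(2 * αs) < -1 by linarith))
  simpa using this

theorem one_le_gammaConst {αs : ℝ} (hαs : 1 / 2 < αs) : 1 ≤ gammaConst αs := by
  refine Real.one_le_sqrt.mpr ?_
  have h := (summable_rpow_neg_two_mul hαs).le_tsum 0 fun j _ => by positivity
  simpa using h

/-- Cauchy–Schwarz for `j^{-α*} · j^{α*}|θ_j|`; the constant `γ` is the `ℓ²` norm of the first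
factor. -/
theorem summable_abs_of_sobolev {αs α Q : ℝ} (hαs : 1 / 2 < αs) (hα : αs ≤ α) (hQ : 0 ≤ Q)
    {θ : ℕ → ℝ} (hs : Summable fun j : ℕ => ((j : ℝ) + 1) ^ (2 * α) * θ j ^ 2)
    (hθ : ∑' j : ℕ, ((j : ℝ) + 1) ^ (2 * α) * θ j ^ 2 ≤ Q ^ 2) :
    (Summable fun j => |θ j|) ∧ ∑' j, |θ j| ≤ gammaConst αs * Q := by
  have hpos : ∀ j : ℕ, (0 : ℝ) < (j : ℝ) + 1 := fun j => by positivity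
  have h1 : ∀ j : ℕ, (((j : ℝ) + 1) ^ (-αs)) ^ (2 : ℝ) = ((j : ℝ) + 1) ^ (-(2 * αs)) := fun j => by
    rw [← Real.rpow_mul (hpos j).le]; ring_nf
  have h2 : ∀ j : ℕ, (((j : ℝ) + 1) ^ αs * |θ j|) ^ (2 : ℝ)
      = ((j : ℝ) + 1) ^ (2 * αs) * θ j ^ 2 := fun j => by
    rw [Real.mul_rpow (by positivity) (abs_nonneg _), ← Real.rpow_mul (hpos j).le, Real.rpow_two,
      sq_abs, mul_comm αs]
  have h2le : ∀ j : ℕ, (((j : ℝ) + 1) ^ αs * |θ j|) ^ (2 : ℝ)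
      ≤ ((j : ℝ) + 1) ^ (2 * α) * θ j ^ 2 := fun j => by
    rw [h2]
    have hj : (1 : ℝ) ≤ (j : ℝ) + 1 := by linarith [Nat.cast_nonneg (α := ℝ) j]
    gcongr
  have h2s : Summable fun j : ℕ => (((j : ℝ) + 1) ^ αs * |θ j|) ^ (2 : ℝ) :=
    Summable.of_nonneg_of_le (fun j => by positivity) h2le hs
  have h1s : Summable fun j : ℕ => (((j : ℝ) + 1) ^ (-αs)) ^ (2 : ℝ) := by
    simp_rw [h1]
    exact summable_rpow_neg_two_mul hαs
  have h3 := Real.summable_mul_of_Lp_Lq_of_nonneg Real.HolderConjugate.two_two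
    (f := fun j : ℕ => ((j : ℝ) + 1) ^ (-αs)) (g := fun j => ((j : ℝ) + 1) ^ αs * |θ j|)
    (fun j => by positivity) (fun j => by positivity) h1s h2s
  have h4 := Real.inner_le_Lp_mul_Lq_tsum_of_nonneg Real.HolderConjugate.two_two
    (f := fun j : ℕ => ((j : ℝ) + 1) ^ (-αs)) (g := fun j => ((j : ℝ) + 1) ^ αs * |θ j|)
    (fun j => by positivity) (fun j => by positivity) h1s h2s
  have h5 : ∀ j : ℕ, ((j : ℝ) + 1) ^ (-αs) * (((j : ℝ) + 1) ^ αs * |θ j|) = |θ j| := fun j => by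
    rw [← mul_assoc, ← Real.rpow_add (hpos j), neg_add_cancel, Real.rpow_zero, one_mul]
  simp_rw [h5] at h3 h4
  refine ⟨h3, h4.trans ?_⟩
  simp_rw [h1, ← Real.sqrt_eq_rpow]
  unfold gammaConst
  gcongr
  rw [Real.sqrt_le_left hQ]
  exact (h2s.tsum_le_tsum h2le hs).trans hθ

/-! ### The posterior as a ratio -/

/-- The likelihood ratio of the sample. -/
def sampleRatio (f₀ : unitInterval → ℝ) {n : ℕ} (θ : ℕ → ℝ) (z : Fin n → unitInterval × ℝ) :
    ℝ≥0∞ := ∏ i, obsRatio f₀ (seriesFun θ) (z i)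

theorem measurable_sampleRatio {f₀ : unitInterval → ℝ} (hf₀ : Measurable f₀) (n : ℕ) :
    Measurable (Function.uncurry (sampleRatio f₀ (n := n))) := by
  unfold sampleRatio Function.uncurry obsRatio
  refine Finset.measurable_prod _ fun i _ => ?_
  have h1 : Measurable fun p : (ℕ → ℝ) × (Fin n → unitInterval × ℝ) =>
      seriesFun p.1 (p.2 i).1 :=
    measurable_seriesFun_uncurry.comp (measurable_fst.prodMk (by fun_prop))
  fun_prop

theorem sampleRatio_ne_zero (f₀ : unitInterval → ℝ) {n : ℕ} (θ : ℕ → ℝ)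
    (z : Fin n → unitInterval × ℝ) : sampleRatio f₀ θ z ≠ 0 :=
  Finset.prod_ne_zero_iff.mpr fun _ _ => (ENNReal.ofReal_pos.mpr (Real.exp_pos _)).ne'

theorem sampleRatio_ne_top (f₀ : unitInterval → ℝ) {n : ℕ} (θ : ℕ → ℝ)
    (z : Fin n → unitInterval × ℝ) : sampleRatio f₀ θ z ≠ ∞ :=
  ENNReal.prod_ne_top fun _ _ => ENNReal.ofReal_ne_top

/-- Both the normalisation `π(D)⁻¹` and `p_{f₀}^{(n)}(z)` cancel in the ratio, so no lower bound on
`π(D)` is needed. -/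
theorem posterior_cond_eq {π : Measure (ℕ → ℝ)} [IsFiniteMeasure π] {D : Set (ℕ → ℝ)}
    (hD : π D ≠ 0) {f₀ : unitInterval → ℝ} (hf₀ : Measurable f₀) {n : ℕ}
    (z : Fin n → unitInterval × ℝ) (A : Set (ℕ → ℝ)) :
    posterior (ProbabilityTheory.cond π D) z A
      = (∫⁻ θ in A, sampleRatio f₀ θ z ∂(π.restrict D)) / ∫⁻ θ, sampleRatio f₀ θ z ∂(π.restrict D) := by
  have hlik : ∀ θ, likelihood z θ = (∏ i, obsDensity f₀ (z i)) * sampleRatio f₀ θ z := by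
    intro θ
    unfold likelihood sampleRatio
    rw [← Finset.prod_mul_distrib]
    exact Finset.prod_congr rfl fun i _ => obsDensity_eq_mul_obsRatio _ _ _
  have hm : Measurable fun θ => sampleRatio f₀ θ z :=
    (measurable_sampleRatio hf₀ n).of_uncurry_right
  set c := ∏ i, obsDensity f₀ (z i) with hc
  have hc0 : c ≠ 0 := Finset.prod_ne_zero_iff.mpr fun i _ =>
    (gaussianPDF_pos (f₀ (z i).1) one_ne_zero (z i).2).ne'
  have hct : c ≠ ∞ := ENNReal.prod_ne_top fun i _ => by
    unfold obsDensity gaussianPDF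
    exact ENNReal.ofReal_ne_top
  have hD' : (π D)⁻¹ ≠ 0 := ENNReal.inv_ne_zero.mpr (measure_ne_top _ _)
  have hDt : (π D)⁻¹ ≠ ∞ := ENNReal.inv_ne_top.mpr hD
  unfold posterior ProbabilityTheory.cond
  simp_rw [hlik]
  rw [Measure.restrict_smul, lintegral_smul_measure, lintegral_smul_measure,
    lintegral_const_mul _ hm, lintegral_const_mul _ hm, smul_eq_mul, smul_eq_mul,
    ENNReal.mul_div_mul_left _ _ hD' hDt, ENNReal.mul_div_mul_left _ _ hc0 hct]

theorem measurableSet_constraintSet (B : ℝ) : MeasurableSet (constraintSet B) :=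
  measurableSet_lt (Measurable.tsum fun j => by fun_prop) measurable_const

theorem sampleLaw_congr {f₀ f : unitInterval → ℝ} (h : f₀ =ᵐ[volume] f) (n : ℕ) :
    sampleLaw f₀ n = sampleLaw f n := by
  have h1 : obsLaw f₀ = obsLaw f := by
    refine withDensity_congr_ae ?_
    have h2 : ∀ᵐ p : unitInterval × ℝ, f₀ p.1 = f p.1 := by
      rw [Measure.volume_eq_prod]
      exact Measure.quasiMeasurePreserving_fst.ae h
    filter_upwards [h2] with p hp
    simp only [obsDensity, hp]
  simp only [sampleLaw, h1]

theorem lt_tsum_of_mem_farSet {f₀ : unitInterval → ℝ} {θ₀ θ : ℕ → ℝ}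
    (hf₀ : f₀ =ᵐ[volume] seriesFun θ₀) (hθ₀ : Summable fun j => |θ₀ j|)
    (hθ : Summable fun j => |θ j|) {r : ℝ} (hr : 0 ≤ r) (h : θ ∈ farSet f₀ r) :
    r ^ 2 < ∑' j, (θ j - θ₀ j) ^ 2 := by
  have h1 : (fun x => seriesFun θ x - f₀ x) =ᵐ[volume] seriesFun fun j => θ j - θ₀ j := by
    filter_upwards [hf₀] with x hx
    rw [hx, seriesFun_sub hθ hθ₀]
  have h2 : ENNReal.ofReal r < eLpNorm (fun x => seriesFun θ x - f₀ x) 2 volume := h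
  rw [eLpNorm_congr_ae h1, eLpNorm_seriesFun (summable_abs_sub hθ hθ₀)] at h2
  exact (Real.lt_sqrt hr).mp (ENNReal.ofReal_lt_ofReal_iff_of_nonneg hr |>.mp h2)

/-- The tail of the difference has energy at most `2w + 2w₀`, so a large distance must show in the
head, where the tests see it. -/
theorem sum_head_ge {θ θ₀ : ℕ → ℝ} (hθ : Summable fun j => |θ j|) (hθ₀ : Summable fun j => |θ₀ j|)
    {J : ℕ} {w w₀ r u : ℝ} (hw : 0 ≤ w) (hw₀ : 0 ≤ w₀)
    (htail : ∑' j, (if j < J then 0 else ENNReal.ofReal (θ j ^ 2)) ≤ ENNReal.ofReal w)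
    (htail₀ : ∑' j, (if j < J then 0 else ENNReal.ofReal (θ₀ j ^ 2)) ≤ ENNReal.ofReal w₀)
    (hr : r < ∑' j, (θ j - θ₀ j) ^ 2) (hu : u + 2 * w + 2 * w₀ ≤ r) :
    u ≤ ∑ j ∈ Finset.range J, (θ j - θ₀ j) ^ 2 := by
  have aux : ∀ {a : ℕ → ℝ} {b : ℝ}, 0 ≤ b →
      ∑' j, (if j < J then 0 else ENNReal.ofReal (a j ^ 2)) ≤ ENNReal.ofReal b →
      (Summable fun j => if j < J then 0 else a j ^ 2) ∧
        ∑' j, (if j < J then 0 else a j ^ 2) ≤ b := by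
    intro a b hb h
    refine summable_of_tsum_ofReal_le (fun j => ?_) hb (le_trans (ENNReal.tsum_le_tsum fun j => ?_) h)
    · split_ifs <;> positivity
    · split_ifs <;> simp
  obtain ⟨h1, h2⟩ := aux hw htail
  obtain ⟨h3, h4⟩ := aux hw₀ htail₀
  have hs := summable_sq_of_summable_abs (summable_abs_sub hθ hθ₀)
  have h5 : ∑' j, (θ j - θ₀ j) ^ 2 ≤ ∑' j, ((if j < J then (θ j - θ₀ j) ^ 2 else 0)
      + (2 * (if j < J then 0 else θ j ^ 2) + 2 * (if j < J then 0 else θ₀ j ^ 2))) := by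
    have hfin : Summable fun j => if j < J then (θ j - θ₀ j) ^ 2 else 0 :=
      summable_of_ne_finset_zero (s := Finset.range J) fun j hj => if_neg (by simpa using hj)
    refine hs.tsum_le_tsum (fun j => ?_) (hfin.add ((h1.mul_left 2).add (h3.mul_left 2)))
    split_ifs
    · simp
    · nlinarith [sq_nonneg (θ j + θ₀ j)]
  have hfin : Summable fun j => if j < J then (θ j - θ₀ j) ^ 2 else 0 :=
    summable_of_ne_finset_zero (s := Finset.range J) fun j hj => if_neg (by simpa using hj)
  rw [hfin.tsum_add ((h1.mul_left 2).add (h3.mul_left 2)),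
    (h1.mul_left 2).tsum_add (h3.mul_left 2), tsum_mul_left, tsum_mul_left] at h5
  have h6 : ∑' j, (if j < J then (θ j - θ₀ j) ^ 2 else 0)
      = ∑ j ∈ Finset.range J, (θ j - θ₀ j) ^ 2 := by
    rw [tsum_eq_sum (s := Finset.range J) fun j hj => if_neg (by simpa using hj)]
    exact Finset.sum_congr rfl fun j hj => if_pos (Finset.mem_range.mp hj)
  linarith

/-- The posterior mass of the complement of a ball, in terms of the prior mass `π S` of a
neighbourhood and the prior mass of the complement of the sieve. -/
theorem lintegral_posterior_farSet_le {π : Measure (ℕ → ℝ)} [IsProbabilityMeasure π] {B : ℝ}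
    (hB : 0 ≤ B) {f₀ : unitInterval → ℝ} {θ₀ : ℕ → ℝ} (hf₀ : f₀ =ᵐ[volume] seriesFun θ₀)
    (hθ₀ : Summable fun j => |θ₀ j|) (hθ₀B : ∑' j, |θ₀ j| ≤ B) (n J : ℕ) {t r v w w₀ : ℝ}
    (ht : 0 ≤ t) (htJ : t * (√2 * √J) ≤ 1) (hr : 0 ≤ r) (hv : 0 ≤ v) (hw : 0 ≤ w) (hw₀ : 0 ≤ w₀)
    (htail₀ : ∑' j, (if j < J then 0 else ENNReal.ofReal (θ₀ j ^ 2)) ≤ ENNReal.ofReal w₀)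
    (hrt : (4 * t) ^ 2 + 2 * w + 2 * w₀ ≤ r ^ 2) {S : Set (ℕ → ℝ)}
    (hS : S = {θ | θ ∈ constraintSet B ∧
      ∑' j, ENNReal.ofReal ((θ j - θ₀ j) ^ 2) ≤ ENNReal.ofReal v}) (hS0 : π S ≠ 0)
    {H : ℝ} (hH : √2 * (2 * B) ≤ H) {b : ℝ≥0∞} (hb0 : b ≠ 0) (hbt : b ≠ ∞) :
    ∫⁻ z, posterior (ProbabilityTheory.cond π (constraintSet B)) z (farSet f₀ r) ∂(sampleLaw f₀ n)
      ≤ 5 ^ J * ENNReal.ofReal (Real.exp (-(n * (t ^ 2 / 4))))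
        + ENNReal.ofReal (Real.exp (n * (Real.exp (H ^ 2) * v))) * b
        + (b * π S)⁻¹ * (ENNReal.ofReal (Real.exp (-(n * (t ^ 2 / (4 * (2 * H ^ 2 + 2))))))
          + π {θ | ENNReal.ofReal w < ∑' j, (if j < J then 0 else ENNReal.ofReal (θ j ^ 2))}) := by
  set D := constraintSet B with hD
  have hDm : MeasurableSet D := measurableSet_constraintSet B
  have hDs : ∀ θ ∈ D, (Summable fun j => |θ j|) ∧ ∑' j, |θ j| ≤ B := fun θ hθ =>
    summable_of_tsum_ofReal_le (fun j => abs_nonneg _) hB (le_of_lt hθ)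
  have hdistm : Measurable fun θ : ℕ → ℝ => ∑' j, ENNReal.ofReal ((θ j - θ₀ j) ^ 2) :=
    Measurable.tsum fun j => by fun_prop
  have hSm : MeasurableSet S := by
    rw [hS]; exact hDm.inter (measurableSet_le hdistm measurable_const)
  have hSD : S ⊆ D := by rw [hS]; exact fun θ hθ => hθ.1
  have hD0 : π D ≠ 0 := fun h => hS0 (measure_mono_null hSD h)
  have hsf := measurable_seriesFun θ₀
  have hP := isProbabilityMeasure_sampleLaw hsf n
  set bad : Set (ℕ → ℝ) :=
    {θ | ENNReal.ofReal w < ∑' j, (if j < J then 0 else ENNReal.ofReal (θ j ^ 2))} with hbad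
  have hbadm : MeasurableSet bad :=
    measurableSet_lt measurable_const (measurable_tailSum _ (f := fun x => x ^ 2) (by fun_prop))
  -- A measurable set that contains `farSet`. Off `D` the series need not converge, so `Dᶜ` is
  -- added; it is null for the restricted prior.
  set A : Set (ℕ → ℝ) :=
    {θ | ENNReal.ofReal (r ^ 2) < ∑' j, ENNReal.ofReal ((θ j - θ₀ j) ^ 2)} ∪ Dᶜ with hA
  have hAm : MeasurableSet A := (measurableSet_lt measurable_const hdistm).union hDm.compl
  have hfarA : farSet f₀ r ⊆ A := by
    intro θ hθ
    by_cases hθD : θ ∈ D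
    · refine Or.inl ?_
      have hθ1 := (hDs θ hθD).1
      have h1 := lt_tsum_of_mem_farSet hf₀ hθ₀ hθ1 hr hθ
      have h2 := ENNReal.ofReal_tsum_of_nonneg (fun j => sq_nonneg (θ j - θ₀ j))
        (summable_sq_of_summable_abs (summable_abs_sub hθ1 hθ₀))
      exact ((ENNReal.ofReal_lt_ofReal_iff_of_nonneg (sq_nonneg r)).mpr h1).trans_eq h2
    · exact Or.inr hθD
  obtain ⟨R, hRm, hR, htest⟩ := exists_test hθ₀ n J (H := H) ht htJ
  have hH' : ∀ θ ∈ D, √2 * ∑' j, |θ j - θ₀ j| ≤ H := fun θ hθ => by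
    refine le_trans ?_ hH
    obtain ⟨h1, h2⟩ := hDs θ hθ
    gcongr
    linarith [tsum_abs_sub_le h1 hθ₀]
  rw [sampleLaw_congr hf₀]
  -- On `F = D ∩ badᶜ` the test has power; the complement of `F` has restricted mass at most `π
  -- bad`.
  have hpost := lintegral_posterior_le (sampleLaw (seriesFun θ₀) n) (π.restrict D)
    (measurable_sampleRatio hsf n) (fun θ z => sampleRatio_ne_zero _ θ z)
    (fun θ z => sampleRatio_ne_top _ θ z) (S := S) (A := A) (F := D ∩ badᶜ) hAm
    (hDm.inter hbadm.compl) hRm (b := b)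
    (c := ENNReal.ofReal (Real.exp (n * (Real.exp (H ^ 2) * v))))
    (d := ENNReal.ofReal (Real.exp (-(n * (t ^ 2 / (4 * (2 * H ^ 2 + 2)))))))
    (by rwa [Measure.restrict_apply hSm, Set.inter_eq_left.mpr hSD]) hb0 hbt ?_
    (fun θ => lintegral_prod_obsRatio_le_one hsf (measurable_seriesFun θ) n) ?_ hSm
  · have hmono : ∫⁻ z, posterior (ProbabilityTheory.cond π D) z (farSet f₀ r)
          ∂(sampleLaw (seriesFun θ₀) n)
        ≤ ∫⁻ z, (∫⁻ θ in A, sampleRatio (seriesFun θ₀) θ z ∂(π.restrict D))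
            / (∫⁻ θ, sampleRatio (seriesFun θ₀) θ z ∂(π.restrict D))
            ∂(sampleLaw (seriesFun θ₀) n) := by
      refine lintegral_mono fun z => ?_
      rw [posterior_cond_eq hD0 hsf]
      exact ENNReal.div_le_div_right (lintegral_mono_set hfarA) _
    refine hmono.trans (hpost.trans ?_)
    rw [Measure.restrict_apply hSm, Set.inter_eq_left.mpr hSD]
    refine add_le_add (add_le_add hR le_rfl) (mul_le_mul_right (add_le_add ?_ ?_) _)
    · refine mul_le_of_le_one_right zero_le ?_
      rw [Measure.restrict_apply_univ]
      exact prob_le_one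
    · rw [Measure.restrict_apply (hDm.inter hbadm.compl).compl]
      refine measure_mono ?_
      rintro θ ⟨h1, h2⟩
      by_contra h3
      exact h1 ⟨h2, h3⟩
  · intro θ hθ
    have hθ' : θ ∈ D ∧ ∑' j, ENNReal.ofReal ((θ j - θ₀ j) ^ 2) ≤ ENNReal.ofReal v := by
      rw [hS] at hθ; exact hθ
    have hθ1 := (hDs θ hθ'.1).1
    have hd := summable_abs_sub hθ1 hθ₀
    refine lintegral_inv_prod_obsRatio_le hsf (measurable_seriesFun θ) n (fun x => ?_) ?_
    · rw [seriesFun_sub hθ1 hθ₀]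
      exact (abs_seriesFun_le hd x).trans (hH' θ hθ'.1)
    · simp_rw [seriesFun_sub hθ1 hθ₀]
      rw [integral_seriesFun_sq hd]
      exact (summable_of_tsum_ofReal_le (fun j => sq_nonneg _) hv hθ'.2).2
  · rintro θ hθA ⟨hθD, hθb⟩
    have hθ1 := (hDs θ hθD).1
    have hfar : ENNReal.ofReal (r ^ 2) < ∑' j, ENNReal.ofReal ((θ j - θ₀ j) ^ 2) :=
      hθA.resolve_right fun h => h hθD
    rw [← ENNReal.ofReal_tsum_of_nonneg (fun j => sq_nonneg (θ j - θ₀ j))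
        (summable_sq_of_summable_abs (summable_abs_sub hθ1 hθ₀)),
      ENNReal.ofReal_lt_ofReal_iff_of_nonneg (sq_nonneg r)] at hfar
    exact htest θ hθ1 (hH' θ hθD) (sum_head_ge hθ1 hθ₀ hw hw₀ (not_lt.mp hθb) htail₀ hfar hrt)

/-! ### The rate -/

/-- The number `n ε_n² = n^{1/(2α+1)}`. -/
def effDim (α : ℝ) (n : ℕ) : ℝ := (n : ℝ) ^ (1 / (2 * α + 1))

theorem effDim_pos {α : ℝ} {n : ℕ} (hn : 1 ≤ n) : 0 < effDim α n :=
  Real.rpow_pos_of_pos (by exact_mod_cast hn) _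

theorem one_le_effDim {α : ℝ} (hα : 0 < α) {n : ℕ} (hn : 1 ≤ n) : 1 ≤ effDim α n :=
  Real.one_le_rpow (by exact_mod_cast hn) (by positivity)

theorem rate_eq (α : ℝ) (n : ℕ) : rate α n = effDim α n ^ (-α) := by
  unfold rate effDim
  rw [← Real.rpow_mul (Nat.cast_nonneg n)]
  congr 1
  ring

theorem natCast_mul_rate_sq {α : ℝ} (hα : 0 < α) {n : ℕ} (hn : 1 ≤ n) :
    n * rate α n ^ 2 = effDim α n := by
  have hn0 : (0 : ℝ) < n := by exact_mod_cast hn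
  have h : (0 : ℝ) < 2 * α + 1 := by linarith
  unfold rate effDim
  rw [← Real.rpow_natCast, ← Real.rpow_mul hn0.le]
  nth_rewrite 1 [← Real.rpow_one (n : ℝ)]
  rw [← Real.rpow_add hn0]
  congr 1
  push_cast
  field_simp
  ring

theorem tendsto_effDim {α : ℝ} (hα : 0 < α) : Tendsto (effDim α) atTop atTop :=
  (tendsto_rpow_atTop (by positivity)).comp tendsto_natCast_atTop_atTop

/-- The number of blocks `⌈log (n ε_n²)⌉` that are relevant at sample size `n`. -/
def cutoff (α : ℝ) (n : ℕ) : ℕ := ⌈Real.log (effDim α n)⌉₊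

theorem tendsto_cutoff {α : ℝ} (hα : 0 < α) : Tendsto (cutoff α) atTop atTop :=
  tendsto_nat_ceil_atTop.comp (Real.tendsto_log_atTop.comp (tendsto_effDim hα))

theorem effDim_le_exp_cutoff {α : ℝ} {n : ℕ} (hn : 1 ≤ n) :
    effDim α n ≤ Real.exp (cutoff α n) := by
  rw [← Real.log_le_iff_le_exp (effDim_pos hn)]
  exact Nat.le_ceil _

theorem exp_cutoff_le {α : ℝ} (hα : 0 < α) {n : ℕ} (hn : 1 ≤ n) :
    Real.exp (cutoff α n) ≤ 3 * effDim α n := by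
  have h1 : (cutoff α n : ℝ) < Real.log (effDim α n) + 1 :=
    Nat.ceil_lt_add_one (Real.log_nonneg (one_le_effDim hα hn))
  calc Real.exp (cutoff α n) ≤ Real.exp (Real.log (effDim α n) + 1) := Real.exp_le_exp.mpr h1.le
    _ = effDim α n * Real.exp 1 := by rw [Real.exp_add, Real.exp_log (effDim_pos hn)]
    _ ≤ _ := by nlinarith [Real.exp_one_lt_d9, effDim_pos (α := α) hn]

theorem exp_neg_cutoff_le {α : ℝ} (hα : 0 < α) {n : ℕ} (hn : 1 ≤ n) :
    Real.exp (-(2 * α * cutoff α n)) ≤ rate α n ^ 2 := by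
  have h1 : Real.log (effDim α n) ≤ cutoff α n := Nat.le_ceil _
  rw [rate_eq, ← Real.rpow_natCast, ← Real.rpow_mul (effDim_pos hn).le,
    Real.rpow_def_of_pos (effDim_pos hn), Real.exp_le_exp]
  push_cast
  nlinarith

/-- `ε_n √N = N^{1/2-α}`. This supplies the condition `t √(2J) ≤ 1` of the tests. -/
theorem tendsto_mul_rate_mul_sqrt_effDim {α : ℝ} (hα : 1 / 2 < α) (c : ℝ) :
    Tendsto (fun n : ℕ => c * (rate α n * √(effDim α n))) atTop (𝓝 0) := by
  have h := ((tendsto_rpow_neg_atTop (show 0 < α - 1 / 2 by linarith)).comp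
    (tendsto_effDim (show 0 < α by linarith))).const_mul c
  rw [mul_zero] at h
  refine h.congr' ?_
  filter_upwards [eventually_ge_atTop 1] with n hn
  rw [Function.comp_apply, rate_eq, Real.sqrt_eq_rpow, ← Real.rpow_add (effDim_pos hn)]
  ring_nf

theorem sobolevBall_coef {α Q : ℝ} {f₀ : Lp ℝ 2 (volume : Measure unitInterval)}
    (h : f₀ ∈ sobolevBall α Q) :
    (Summable fun j : ℕ => ((j : ℝ) + 1) ^ (2 * α) * fourierCoef f₀ j ^ 2) ∧
      ∑' j : ℕ, ((j : ℝ) + 1) ^ (2 * α) * fourierCoef f₀ j ^ 2 ≤ Q ^ 2 :=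
  summable_of_tsum_ofReal_le (fun j => by positivity) (sq_nonneg Q) h

/-- Each of the four error terms is at most `e^{-N}`. The evidence level `b = e^{-(C+1)N}` beats the
moment `e^{CN}` of the inverse likelihood, and dividing by `b π(S)` costs `e^{(C+1+3C₀)N}`. So the
second test error and the sieve complement must have exponent one larger. The first test error uses
`5 ≤ e²`. -/
theorem posterior_bound_terms_le {J n : ℕ} {N t C C₀ H v E m : ℝ} {p s : ℝ≥0∞}
    (hJ : (J : ℝ) ≤ 3 * m * N) (ht1 : (6 * m + 1) * N ≤ n * (t ^ 2 / 4))
    (hv : n * (Real.exp (H ^ 2) * v) ≤ C * N)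
    (ht2 : (C + 1 + 3 * C₀ + 1) * N ≤ n * (t ^ 2 / (4 * (2 * H ^ 2 + 2))))
    (hC₀ : 0 ≤ C₀) (hE : E ≤ 3 * N) (hs : ENNReal.ofReal (Real.exp (-(C₀ * E))) ≤ s)
    (hp : p ≤ ENNReal.ofReal (Real.exp (-((C + 1 + 3 * C₀ + 1) * N)))) :
    5 ^ J * ENNReal.ofReal (Real.exp (-(n * (t ^ 2 / 4))))
        + ENNReal.ofReal (Real.exp (n * (Real.exp (H ^ 2) * v)))
          * ENNReal.ofReal (Real.exp (-((C + 1) * N)))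
        + (ENNReal.ofReal (Real.exp (-((C + 1) * N))) * s)⁻¹
          * (ENNReal.ofReal (Real.exp (-(n * (t ^ 2 / (4 * (2 * H ^ 2 + 2)))))) + p)
      ≤ ENNReal.ofReal (4 * Real.exp (-N)) := by
  have h1 : 5 ^ J * ENNReal.ofReal (Real.exp (-(n * (t ^ 2 / 4)))) ≤ ENNReal.ofReal (Real.exp (-N)) := by
    have h5 : (5 : ℝ) ≤ Real.exp 2 := by
      have h6 : Real.exp 2 = Real.exp 1 * Real.exp 1 := by rw [← Real.exp_add]; norm_num
      nlinarith [Real.exp_one_gt_d9]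
    rw [← ENNReal.ofReal_ofNat 5, ← ENNReal.ofReal_pow (by norm_num),
      ← ENNReal.ofReal_mul (by positivity)]
    refine ENNReal.ofReal_le_ofReal ?_
    calc (5 : ℝ) ^ J * Real.exp (-(n * (t ^ 2 / 4)))
        ≤ Real.exp 2 ^ J * Real.exp (-(n * (t ^ 2 / 4))) := by gcongr
      _ = Real.exp (J * 2 + -(n * (t ^ 2 / 4))) := by rw [← Real.exp_nat_mul, ← Real.exp_add]
      _ ≤ _ := Real.exp_le_exp.mpr (by linarith)
  have h2 : ENNReal.ofReal (Real.exp (n * (Real.exp (H ^ 2) * v)))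
      * ENNReal.ofReal (Real.exp (-((C + 1) * N))) ≤ ENNReal.ofReal (Real.exp (-N)) := by
    rw [← ENNReal.ofReal_mul (Real.exp_nonneg _), ← Real.exp_add]
    exact ENNReal.ofReal_le_ofReal (Real.exp_le_exp.mpr (by linarith))
  have h3 : (ENNReal.ofReal (Real.exp (-((C + 1) * N))) * s)⁻¹
      ≤ ENNReal.ofReal (Real.exp ((C + 1 + 3 * C₀) * N)) := by
    have h4 : ENNReal.ofReal (Real.exp (-((C + 1 + 3 * C₀) * N)))
        ≤ ENNReal.ofReal (Real.exp (-((C + 1) * N))) * s := by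
      refine le_trans ?_ (mul_le_mul_right hs _)
      rw [← ENNReal.ofReal_mul (Real.exp_nonneg _), ← Real.exp_add]
      exact ENNReal.ofReal_le_ofReal (Real.exp_le_exp.mpr (by nlinarith))
    refine (ENNReal.inv_le_inv.mpr h4).trans_eq ?_
    rw [← ENNReal.ofReal_inv_of_pos (Real.exp_pos _), ← Real.exp_neg, neg_neg]
  have h4 : ENNReal.ofReal (Real.exp (-(n * (t ^ 2 / (4 * (2 * H ^ 2 + 2))))))
      ≤ ENNReal.ofReal (Real.exp (-((C + 1 + 3 * C₀ + 1) * N))) :=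
    ENNReal.ofReal_le_ofReal (Real.exp_le_exp.mpr (by linarith))
  calc _ ≤ ENNReal.ofReal (Real.exp (-N)) + ENNReal.ofReal (Real.exp (-N))
        + ENNReal.ofReal (Real.exp ((C + 1 + 3 * C₀) * N))
          * (ENNReal.ofReal (Real.exp (-((C + 1 + 3 * C₀ + 1) * N)))
            + ENNReal.ofReal (Real.exp (-((C + 1 + 3 * C₀ + 1) * N)))) := by
        gcongr
    _ = _ := by
        rw [← ENNReal.ofReal_add (by positivity) (by positivity),
          ← ENNReal.ofReal_add (by positivity) (by positivity),
          ← ENNReal.ofReal_mul (by positivity), ← ENNReal.ofReal_add (by positivity) (by positivity),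
          mul_add, ← Real.exp_add]
        congr 1
        ring_nf

end BlockPrior

end

/-! ### The contraction theorem -/

theorem theorem3p4 (g : ℕ → ℝ → ℝ) (hg : BlockPrior.IsMixingClass g)
    (αs B : ℝ) (hαs : 1 / 2 < αs)
    (α Q : ℝ) (hα : αs ≤ α) (hQ : 0 < Q) (hQB : 3 * BlockPrior.gammaConst αs * Q ≤ B) :
    ∃ M : ℝ, 0 < M ∧
      Tendsto
        (fun n : ℕ => ⨆ f₀ ∈ BlockPrior.sobolevBall α Q,
          ∫⁻ z, BlockPrior.posterior (BlockPrior.modifiedPrior g B) z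
              (BlockPrior.farSet f₀ (M * BlockPrior.rate α n))
            ∂(BlockPrior.sampleLaw f₀ n))
        atTop (𝓝 0) := by
  open BlockPrior in
  have hα2 : 1 / 2 < α := hαs.trans_le hα
  have hα0 : 0 < α := by linarith
  have hB : 0 < B := by nlinarith [one_le_gammaConst hαs]
  have hπ := isProbabilityMeasure_blockPrior hg.density
  obtain ⟨C₀, hC₀, hmass⟩ := exists_le_blockPrior_neighborhood hg (Q := Q) hα2 hB
  set H := √2 * (2 * B) with hH
  set C := Real.exp (H ^ 2) * C₀ with hC
  have hC0 : 0 < C := by positivity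
  -- The order of choices matters: `C₀` fixes the sieve exponent and hence `m`, and `m` fixes the
  -- dimension `J` that `T` has to beat.
  obtain ⟨m, hsieve⟩ := exists_blockPrior_tail_le hg hα0.le (C + 1 + 3 * C₀ + 1)
  set W := 2 ^ (2 * α) * Q ^ 2 with hW
  have hW0 : 0 ≤ W := by positivity
  -- The tests are run at `t = T ε_n`, so that `n t² = T² N`. As `T ≤ T²`, the two summands provide
  -- the exponents needed for the second and the first test error.
  set T := 4 * (2 * H ^ 2 + 2) * (C + 1 + 3 * C₀ + 1) + 4 * (6 * Real.exp m + 1) with hT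
  have hT1 : 4 * (2 * H ^ 2 + 2) * (C + 1 + 3 * C₀ + 1) ≤ T := by
    rw [hT]; linarith [Real.exp_pos (m : ℝ)]
  have hT2 : 4 * (6 * Real.exp m + 1) ≤ T := by
    rw [hT]; linarith [show 0 ≤ 4 * (2 * H ^ 2 + 2) * (C + 1 + 3 * C₀ + 1) by positivity]
  have hT3 : 1 ≤ T := by linarith [Real.exp_pos (m : ℝ)]
  have hTT : T ≤ T ^ 2 := by nlinarith
  -- The squared radius must cover `(4t)²` for the head and `2w + 2w₀` for the tails, where `w ≤
  -- ε_n²` and `w₀ ≤ W ε_n²`.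
  set M := √(16 * T ^ 2 + 2 + 2 * W) with hM
  have hM2 : M ^ 2 = 16 * T ^ 2 + 2 + 2 * W := Real.sq_sqrt (by positivity)
  refine ⟨M, Real.sqrt_pos.mpr (by positivity), ?_⟩
  have hlim : Tendsto (fun n : ℕ => ENNReal.ofReal (4 * Real.exp (-effDim α n))) atTop (𝓝 0) := by
    have h := (Real.tendsto_exp_neg_atTop_nhds_zero.comp (tendsto_effDim hα0)).const_mul 4
    rw [mul_zero] at h
    rw [← ENNReal.ofReal_zero]
    exact ENNReal.tendsto_ofReal h
  refine tendsto_of_tendsto_of_tendsto_of_le_of_le' tendsto_const_nhds hlim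
    (Eventually.of_forall fun _ => zero_le) ?_
  filter_upwards [eventually_ge_atTop 1, (tendsto_cutoff hα0).eventually hmass,
    (tendsto_cutoff hα0).eventually hsieve,
    (tendsto_mul_rate_mul_sqrt_effDim hα2 (T * √(6 * Real.exp m))).eventually
      (eventually_le_nhds one_pos)] with n hn hmassn hsieven hTn
  refine iSup₂_le fun f₀ hf₀ => ?_
  set N := effDim α n with hN
  set K := cutoff α n with hK
  have hN0 : 0 < N := effDim_pos hn
  have hε0 : 0 ≤ rate α n := Real.rpow_nonneg (Nat.cast_nonneg n) _
  have hnε : n * rate α n ^ 2 = N := natCast_mul_rate_sq hα0 hn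
  obtain ⟨hsum, hsumQ⟩ := sobolevBall_coef hf₀
  obtain ⟨habs, habsB⟩ := summable_abs_of_sobolev hαs hα hQ.le hsum hsumQ
  have hfs := ae_eq_seriesFun_fourierCoef (Lp.memLp f₀) habs
  have hγ : gammaConst αs * Q ≤ B / 3 := by linarith
  have hS := hmassn (fourierCoef f₀) hsum hsumQ habs (habsB.trans hγ)
  have hexpα : Real.exp (-(2 * α * K)) ≤ rate α n ^ 2 := exp_neg_cutoff_le hα0 hn
  have hJ : (headSize (K + m) : ℝ) ≤ 3 * Real.exp m * N := by
    refine (headSize_le_exp _).trans ?_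
    push_cast
    rw [Real.exp_add]
    calc Real.exp K * Real.exp m ≤ 3 * N * Real.exp m := by
          gcongr
          exact exp_cutoff_le hα0 hn
      _ = _ := by ring
  have hJt : T * rate α n * (√2 * √(headSize (K + m) : ℝ)) ≤ 1 := by
    refine le_trans ?_ hTn
    have h1 : √2 * √(headSize (K + m) : ℝ) ≤ √(6 * Real.exp m) * √N := by
      rw [← Real.sqrt_mul (by norm_num), ← Real.sqrt_mul (by positivity)]
      exact Real.sqrt_le_sqrt (by linarith)
    calc _ ≤ T * rate α n * (√(6 * Real.exp m) * √N) := by gcongr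
      _ = _ := by ring
  have htail := tail_sq_le hα0.le hsum hsumQ (K + m)
  have hKm : Real.exp (-(2 * α * (K + m : ℕ))) ≤ Real.exp (-(2 * α * K)) := by
    rw [Real.exp_le_exp]
    have h1 : 0 ≤ 2 * α * (m : ℝ) := by positivity
    push_cast
    linarith
  have hbound := lintegral_posterior_farSet_le (π := blockPrior g) hB.le hfs habs
    (by linarith) n (headSize (K + m)) (t := T * rate α n) (r := M * rate α n)
    (v := C₀ * Real.exp (-(2 * α * K))) (w := Real.exp (-(2 * α * K)))
    (w₀ := W * Real.exp (-(2 * α * K))) (by positivity) hJt (by positivity) (by positivity)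
    (Real.exp_nonneg _) (by positivity)
    (htail.trans (ENNReal.ofReal_le_ofReal (mul_le_mul_of_nonneg_left hKm hW0)))
    (by
      rw [mul_pow M, hM2]
      have h1 := mul_le_mul_of_nonneg_left hexpα hW0
      linarith)
    rfl ((ENNReal.ofReal_pos.mpr (Real.exp_pos _)).trans_le hS).ne' (H := H) le_rfl
    (b := ENNReal.ofReal (Real.exp (-((C + 1) * N))))
    (ENNReal.ofReal_pos.mpr (Real.exp_pos _)).ne' ENNReal.ofReal_ne_top
  have hnt : ∀ x : ℝ, n * ((T * rate α n) ^ 2 / x) = T ^ 2 / x * N := fun x => by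
    rw [← hnε]; ring
  refine hbound.trans (posterior_bound_terms_le (C := C) hJ ?_ ?_ ?_ hC₀.le
    (exp_cutoff_le hα0 hn) hS (hsieven.trans (ENNReal.ofReal_le_ofReal ?_)))
  · rw [hnt]
    gcongr
    linarith
  · calc n * (Real.exp (H ^ 2) * (C₀ * Real.exp (-(2 * α * K))))
        ≤ n * (Real.exp (H ^ 2) * (C₀ * rate α n ^ 2)) := by gcongr
      _ = _ := by rw [← hnε, hC]; ring
  · rw [hnt]
    gcongr
    rw [le_div_iff₀ (by positivity)]
    linarith
  · rw [Real.exp_le_exp, neg_le_neg_iff]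
    gcongr
    exact effDim_le_exp_cutoff hn
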